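/- **Setting.** Let $C=(c_{ij})_{i,j\in\mathbb I}$ be an irreducible Cartan matrix of type ADE and let $\tau$ be an involution of its Dynkin diagram ($\tau=\mathrm{id}$ allowed). Put $\mathbb I_0=\{i:\tau i=i\}$, let $\mathbb I_1$ be a set of representatives of the two-element $\tau$-orbits, $\mathbb I_{-1}=\tau\mathbb I_1$ and ${}^\imath\mathbb I=\mathbb I_1\sqcup\mathbb I_0$. Let $\lambda$ be a dominant integral coweight with $\tau\lambda=\lambda$, and let $\mu\le\lambda$ be an integral coweight that is even ($\mu\in 2P^\vee$) and spherical ($\mu=\mu_1+\tau\mu_1$ for a coweight $\mu_1$). Write $\lambda-\mu=\sum_i\mathbf v_i\alpha_i^\vee$ with $\mathbf v_i\in\mathbb N$, and $\mathbf w_i=\langle\lambda,\alpha_i\rangle$. For $i\ne\tau i$ put $\mathfrak v_i=\mathbf v_i$, $\mathfrak w_i=\mathbf w_i$, $\theta_i=\varsigma_i=\vartheta_i=0$. For $i=\tau i$ put $\mathfrak v_i=\lfloor\mathbf v_i/2\rfloor$, $\mathfrak w_i=\lfloor\mathbf w_i/2\rfloor$, let $\theta_i,\varsigma_i\in\{0,1\}$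 be the parities of $\mathbf v_i,\mathbf w_i$, and $\vartheta_i=\max\{\theta_j: c_{ij}\neq0\}$. Assume the parity condition $c_{ij}\theta_i\theta_j=0$ for all $i\ne j$. Fix an orientation of the Dynkin diagram such that, whenever $i\neq\tau i$, $i\to j$ implies $\tau j\to\tau i$ and $j\to i$ implies $\tau i\to\tau j$; write $j\leftrightarrow i$ if $i,j$ are joined. Put $\wp_i=1$ if $i\leftarrow\tau i$, $\wp_i=-1$ if $i\to\tau i$, and $\wp_i=0$ otherwise. Fix integers $0\le\zeta_i\le\mathfrak v_i$ for $i\in\mathbb I_1$ and set $\zeta_{\tau i}=\mathfrak v_i-\zeta_i$. **The algebra ${}^\imath\mathcal Y_\mu$.** It is the $\mathbb C$-algebra generated by $H_i^{(r)},B_i^{(s)}$ ($i\in\mathbb I$, $r\in\mathbb Z$, $s\in\mathbb Z_{>0}$) with the following relations, where $[a,b]_+=ab+ba$, $i,j\in\mathbb I$, $r,r_1,r_2\in\mathbb Z$, $s,s_1,s_2\in\mathbb Z_{>0}$: $$H_i^{(r)}=0\ (r<-\langle\mu,\alpha_i\rangle),\qquad H_i^{(-\langle\mu,\alpha_i\rangle)}=1,\qquad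 [H_i^{(r_1)},H_j^{(r_2)}]=0,$$ $$[H_i^{(r+2)},B_j^{(s)}]-[H_i^{(r)},B_j^{(s+2)}]=\tfrac{c_{ij}-c_{\tau i,j}}2[H_i^{(r+1)},B_j^{(s)}]_++\tfrac{c_{ij}+c_{\tau i,j}}2[H_i^{(r)},B_j^{(s+1)}]_++\tfrac{c_{ij}c_{\tau i,j}}4[H_i^{(r)},B_j^{(s)}],$$ $$[B_i^{(s_1+1)},B_j^{(s_2)}]-[B_i^{(s_1)},B_j^{(s_2+1)}]=\tfrac{c_{ij}}2[B_i^{(s_1)},B_j^{(s_2)}]_++2\delta_{\tau i,j}(-1)^{s_1}H_j^{(s_1+s_2)},$$ $$[B_i^{(s_1)},B_j^{(s_2)}]=(-1)^{s_1-1}\delta_{\tau i,j}H_j^{(s_1+s_2-1)}\quad(c_{ij}=0),$$ and, with $S_{ij}=[B_i^{(s_1)},[B_i^{(s_2)},B_j^{(s)}]]+[B_i^{(s_2)},[B_i^{(s_1)},B_j^{(s)}]]$: $S_{ij}=0$ if $c_{ij}=-1$ and $i\ne\tau i\neq j$; $S_{ij}=(-1)^{s_1-1}[H_i^{(s_1+s_2)},B_j^{(s-1)}]$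 if $c_{ij}=-1$ and $i=\tau i$; and if $c_{i,\tau i}=-1$, $$S_{i,\tau i}=4\,\mathrm{Sym}_{s_1,s_2}(-1)^{s_1-1}\sum_{p\ge0}3^{-p-1}[B_i^{(s_2+p)},H_{\tau i}^{(s_1+s-p-1)}].$$ Here $\mathrm{Sym}_{s_1,s_2}f(s_1,s_2)=f(s_1,s_2)+f(s_2,s_1)$, and for $s=1$ the symbol $[H_i^{(r)},B_j^{(0)}]$ means $\sum_{p\ge0}2^{-2p}\big([H_i^{(r-2p-2)},B_j^{(2)}]-[H_i^{(r-2p-2)},B_j^{(1)}]_+\big)$. Put $H_i(u)=\sum_{r\in\mathbb Z}H_i^{(r)}u^{-r}$ and $B_i(u)=\sum_{s>0}B_i^{(s)}u^{-s}$. **The ring $\mathcal A$.** Let $\mathbb C[\boldsymbol z]$ be the polynomial ring in $z_{i,s}$ ($i\in{}^\imath\mathbb I$, $1\le s\le\mathfrak w_i$), and ${}^\imath\mathcal Y_\mu[\boldsymbol z]={}^\imath\mathcal Y_\mu\otimes_{\mathbb C}\mathbb C[\boldsymbol z]$. Let $\mathcal A$ be the $\mathbb C[\boldsymbol z]$-algebra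 generated by $w_{i,r}$, $\eth_{i,r}^{\pm1}$, $(w_{i,r}\pm w_{i,r'}+m)^{-1}$, $(w_{i,r}+\tfrac12m)^{-1}$ ($i\in{}^\imath\mathbb I$, $1\le r\ne r'\le\mathfrak v_i$, $m\in\mathbb Z$) with relations $[\eth_{i,r}^{\pm1},w_{j,r'}]=\pm\delta_{ij}\delta_{rr'}\eth_{i,r}^{\pm1}$, $[w_{i,r},w_{j,r'}]=[\eth_{i,r},\eth_{j,r'}]=0$, $\eth_{i,r}^{\pm1}\eth_{i,r}^{\mp1}=1$; equivalently, the corresponding subalgebra of the difference operators in the $w_{i,r}$ with rational coefficients. For $i\in\mathbb I_1$ set $z_{\tau i,s}=-z_{i,s}$, $w_{\tau i,r}=-w_{i,\mathfrak v_i+1-r}$, $\eth_{\tau i,r}=\eth_{i,\mathfrak v_i+1-r}^{-1}$. For a monic polynomial $f$ set $f^-(u)=(-1)^{\deg f}f(-u)$. For $i\in\mathbb I_0$ put $$W_i(u)=\prod_{r=1}^{\mathfrak v_i}(u-w_{i,r}),\quad Z_i(u)=\prod_{s=1}^{\mathfrak w_i}(u-z_{i,s}),\quad \mathbf W_i^\circ(u)=\prod_{r=1}^{\mathfrak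 v_i}(u^2-w_{i,r}^2),\quad \mathbf W_i(u)=u^{\theta_i}\mathbf W_i^\circ(u),$$ $$\mathbf Z_i(u)=u^{\varsigma_i}\prod_{s=1}^{\mathfrak w_i}(u^2-z_{i,s}^2),\quad \mathbf W_{i,r}(u)=u^{\theta_i}(u+w_{i,r})\prod_{s\ne r}(u^2-w_{i,s}^2),\quad \overline W_i^-=u^{\theta_i}W_i^-,\quad \overline Z_i^-=u^{\varsigma_i}Z_i^-.$$ For $i\ne\tau i$ put $$W_i(u)=\prod_{r=1}^{\zeta_i}(u-w_{i,r}),\quad \mathbf W_i(u)=\prod_{r=1}^{\mathfrak v_i}(u-w_{i,r}),\quad \mathbf W_{i,r}(u)=\prod_{s\ne r}(u-w_{i,s}),\quad \mathbf Z_i(u)=\prod_{s=1}^{\mathfrak w_i}(u-z_{i,s}),$$ and choose monic polynomials $Z_i(u)$ over $\mathbb C[\boldsymbol z]$ with $\mathbf Z_i=Z_iZ_{\tau i}^-$. Put $\varkappa(u)=1-\frac1{2u}$ and $\boldsymbol\varkappa(u)=1-\frac1{4u^2}$. **Theorem B.** For every such choice (of $\mathbb I_1$, the orientation, the $\zeta_i$,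 the $Z_i$, and the square roots below) there is a unique $\mathbb C$-algebra homomorphism $\Phi_\mu^\lambda:{}^\imath\mathcal Y_\mu[\boldsymbol z]\to\mathcal A$ that is the identity on $\mathbb C[\boldsymbol z]$ and satisfies (rational functions of $u$ being expanded at $u=\infty$) $$H_i(u)\mapsto\Big(1+\frac{\wp_i}{4u}\Big)\frac{\boldsymbol\varkappa(u)^{\vartheta_i}\mathbf Z_i(u)}{\mathbf W_i(u-\frac12)\mathbf W_i(u+\frac12)}\prod_{j\leftrightarrow i}\mathbf W_j(u)\qquad(i\in\mathbb I),$$ for $i\in\mathbb I\setminus\mathbb I_0$: $$B_i(u)\mapsto-\sum_{r=1}^{\zeta_i}\frac{Z_i(w_{i,r}-\frac12)}{(u+\frac12-w_{i,r})\mathbf W_{i,r}(w_{i,r})}\prod_{j\to i}\mathbf W_j(w_{i,r}-\tfrac12)\,\eth_{i,r}^{-1}-\sum_{r=1}^{\zeta_{\tau i}}\frac{Z_i^-(w_{\tau i,r}+\frac12)}{(u+\frac12+w_{\tau i,r})\mathbf W_{\tau i,r}(w_{\tau i,r})}\prod_{\tau j\leftarrow\tau i}\mathbf W_{\tau j}(w_{\tau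 i,r}+\tfrac12)\,\eth_{\tau i,r},$$ and for $i\in\mathbb I_0$: $$\begin{aligned}B_i(u)\mapsto&-\sum_{r=1}^{\mathfrak v_i}\frac{\varkappa(w_{i,r})^{-\vartheta_i}Z_i(w_{i,r}-\frac12)}{(u+\frac12-w_{i,r})\mathbf W_{i,r}(w_{i,r})}\prod_{j\to i}\mathbf W_j(w_{i,r}-\tfrac12)\prod_{j\leftarrow i,\,j\in\mathbb I_0}\overline W_j^-(w_{i,r}-\tfrac12)\,\eth_{i,r}^{-1}\\&-\sum_{r=1}^{\mathfrak v_i}\frac{\varkappa(-w_{i,r})^{-\vartheta_i}\overline Z_i^-(w_{i,r}+\frac12)}{(u+\frac12+w_{i,r})\mathbf W_{i,r}(w_{i,r})}\prod_{j\leftarrow i,\,j\in\mathbb I_{\pm1}}\mathbf W_j(w_{i,r}+\tfrac12)\prod_{j\leftarrow i,\,j\in\mathbb I_0}W_j(w_{i,r}+\tfrac12)\,\eth_{i,r}\\&+\sqrt{(-1)^{\mathfrak w_i+\sum_{i\leftrightarrow j\in{}^\imath\mathbb I}\mathfrak v_j}}\;\frac{\theta_iZ_i(0)}{u\,\mathbf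 W_i^\circ(\frac12)}\prod_{j\leftrightarrow i}W_j(0).\end{aligned}$$ -/

import Mathlib

noncomputable section

open scoped Classical

namespace IYangian

universe uI

/-! ## Quasi-split Satake diagrams of type ADE -/

/-- `C` is, up to a relabelling of the index set, a Cartan matrix of type
`A_n` (`n ≥ 1`), `D_n` (`n ≥ 4`), `E_6`, `E_7` or `E_8`. -/
def IsADE {I : Type uI} (C : Matrix I I ℤ) : Prop :=
  (∃ n : ℕ, 1 ≤ n ∧ ∃ e : I ≃ Fin n, C = (CartanMatrix.A n).submatrix e e) ∨
  (∃ n : ℕ, 4 ≤ n ∧ ∃ e : I ≃ Fin n, C = (CartanMatrix.D n).submatrix e e) ∨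
  (∃ e : I ≃ Fin 6, C = CartanMatrix.E₆.submatrix e e) ∨
  (∃ e : I ≃ Fin 7, C = CartanMatrix.E₇.submatrix e e) ∨
  (∃ e : I ≃ Fin 8, C = CartanMatrix.E₈.submatrix e e)

/-- `τ` is an involution (possibly the identity) of the Dynkin diagram of `C`. -/
def IsDiagramInvolution {I : Type uI} (C : Matrix I I ℤ) (τ : I → I) : Prop :=
  (∀ i, τ (τ i) = i) ∧ ∀ i j, C (τ i) (τ j) = C i j

/-! An integral coweight `μ` is encoded by its pairings `μ i = ⟨μ, α_i⟩` with the simple roots;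
`τ μ` is then `μ ∘ τ`, and `⟨α_j^∨, α_i⟩ = c_{ji}`. -/

/-- Spherical coweights: `μ = μ₁ + τ μ₁`. -/
def IsSpherical {I : Type uI} (τ : I → I) (μ : I → ℤ) : Prop :=
  ∃ μ₁ : I → ℤ, μ = μ₁ + μ₁ ∘ τ

/-- Even coweights: `μ = 2 μ'`. -/
def IsEven {I : Type uI} (μ : I → ℤ) : Prop :=
  ∃ μ' : I → ℤ, μ = 2 • μ'

/-! ## Shifted iYangians -/

/-- The generators `H_i^{(r)}` (`r ∈ ℤ`) and `B_i^{(s)}` (`s ∈ ℤ_{>0}`). -/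
inductive Gen (I : Type uI) : Type uI
  | H (i : I) (r : ℤ) : Gen I
  | B (i : I) (s : ℕ+) : Gen I

/-- `H_i^{(r)}` in the free algebra. -/
def gH {I : Type uI} (i : I) (r : ℤ) : FreeAlgebra ℂ (Gen I) := FreeAlgebra.ι ℂ (Gen.H i r)

/-- `B_i^{(s)}` in the free algebra. -/
def gB {I : Type uI} (i : I) (s : ℕ+) : FreeAlgebra ℂ (Gen I) := FreeAlgebra.ι ℂ (Gen.B i s)

/-- The anticommutator `[a, b]_+ = ab + ba`. -/
def acomm {R : Type*} [Ring R] (a b : R) : R := a * b + b * a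

/-- `Sym_{s₁,s₂} [B_i^{(s₁)}, [B_i^{(s₂)}, B_j^{(s)}]]`. -/
def serreLHS {I : Type uI} (i j : I) (s₁ s₂ s : ℕ+) : FreeAlgebra ℂ (Gen I) :=
  ⁅gB i s₁, ⁅gB i s₂, gB j s⁆⁆ + ⁅gB i s₂, ⁅gB i s₁, gB j s⁆⁆

/-- `[H_i^{(r)}, B_j^{(s-1)}]`, where for `s = 1` it stands for
`∑_{p ≥ 0} 2^{-2p} ([H_i^{(r-2p-2)}, B_j^{(s+1)}] - [H_i^{(r-2p-2)}, B_j^{(s)}]_+)`.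
Only the terms with `r-2p-2 ≥ -⟨μ, α_i⟩` matter, since `H_i^{(k)} = 0` for `k < -⟨μ, α_i⟩`;
all of them have `p < r + ⟨μ, α_i⟩`. -/
def serreSplitBracket {I : Type uI} (μ : I → ℤ) (i j : I) (r : ℤ) (s : ℕ+) :
    FreeAlgebra ℂ (Gen I) :=
  if s = 1 then
    ∑ p ∈ Finset.range (r + μ i).toNat, ((1 / 4 : ℂ) ^ p) •
      (⁅gH i (r - 2 * p - 2), gB j (s + 1)⁆ - acomm (gH i (r - 2 * p - 2)) (gB j s))
  else ⁅gH i r, gB j (s - 1)⁆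

/-- `(-1)^{a-1} ∑_{p ≥ 0} 3^{-p-1} [B_i^{(b+p)}, H_{τ i}^{(a+s-p-1)}]`. The terms with
`a+s-p-1 < -⟨μ, α_{τ i}⟩` vanish, since `H_{τ i}^{(k)} = 0` for `k < -⟨μ, α_{τ i}⟩`; the remaining
ones are exactly those with `p < a + s + ⟨μ, α_{τ i}⟩`. -/
def serreAIIIBracket {I : Type uI} (τ : I → I) (μ : I → ℤ) (i : I) (a b s : ℕ+) :
    FreeAlgebra ℂ (Gen I) :=
  ((-1 : ℂ) ^ ((a : ℕ) - 1)) •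
    ∑ p ∈ Finset.range ((a : ℤ) + s + μ (τ i)).toNat, (((3 : ℂ) ^ (p + 1))⁻¹) •
      ⁅gB i ⟨(b : ℕ) + p, Nat.add_pos_left b.pos p⟩, gH (τ i) ((a : ℤ) + s - p - 1)⁆

/-- The defining relations of the shifted iYangian of quasi-split type. -/
inductive Rel {I : Type uI} (C : Matrix I I ℤ) (τ : I → I) (μ : I → ℤ) :
    FreeAlgebra ℂ (Gen I) → FreeAlgebra ℂ (Gen I) → Prop
  | H_low (i : I) (r : ℤ) (hr : r < -μ i) : Rel C τ μ (gH i r) 0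
  | H_lead (i : I) : Rel C τ μ (gH i (-μ i)) 1
  | HH (i j : I) (r₁ r₂ : ℤ) : Rel C τ μ ⁅gH i r₁, gH j r₂⁆ 0
  | HB (i j : I) (r : ℤ) (s : ℕ+) :
      Rel C τ μ
        (⁅gH i (r + 2), gB j s⁆ - ⁅gH i r, gB j (s + 2)⁆)
        ((((C i j : ℂ) - C (τ i) j) / 2) • acomm (gH i (r + 1)) (gB j s)
          + (((C i j : ℂ) + C (τ i) j) / 2) • acomm (gH i r) (gB j (s + 1))
          + (((C i j : ℂ) * C (τ i) j) / 4) • ⁅gH i r, gB j s⁆)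
  | BB (i j : I) (s₁ s₂ : ℕ+) :
      Rel C τ μ
        (⁅gB i (s₁ + 1), gB j s₂⁆ - ⁅gB i s₁, gB j (s₂ + 1)⁆)
        (((C i j : ℂ) / 2) • acomm (gB i s₁) (gB j s₂)
          + (if τ i = j then (2 * (-1 : ℂ) ^ (s₁ : ℕ)) • gH j ((s₁ : ℤ) + s₂) else 0))
  | BB_zero (i j : I) (s₁ s₂ : ℕ+) (hij : C i j = 0) :
      Rel C τ μ
        ⁅gB i s₁, gB j s₂⁆
        (if τ i = j then ((-1 : ℂ) ^ ((s₁ : ℕ) - 1)) • gH j ((s₁ : ℤ) + s₂ - 1) else 0)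
  | serre_ordinary (i j : I) (s₁ s₂ s : ℕ+) (hij : C i j = -1) (hi : i ≠ τ i) (hj : τ i ≠ j) :
      Rel C τ μ (serreLHS i j s₁ s₂ s) 0
  | serre_split (i j : I) (s₁ s₂ s : ℕ+) (hij : C i j = -1) (hi : i = τ i) :
      Rel C τ μ (serreLHS i j s₁ s₂ s)
        (((-1 : ℂ) ^ ((s₁ : ℕ) - 1)) • serreSplitBracket μ i j ((s₁ : ℤ) + s₂) s)
  | serre_AIII (i : I) (s₁ s₂ s : ℕ+) (hi : C i (τ i) = -1) :
      Rel C τ μ (serreLHS i (τ i) s₁ s₂ s)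
        ((4 : ℂ) • (serreAIIIBracket τ μ i s₁ s₂ s + serreAIIIBracket τ μ i s₂ s₁ s))

/-- The shifted iYangian `ıY_μ`, presented by generators and relations. -/
abbrev Y {I : Type uI} (C : Matrix I I ℤ) (τ : I → I) (μ : I → ℤ) : Type uI :=
  RingQuot (Rel C τ μ)

/-- The generator `H_i^{(r)}` of `ıY_μ`. -/
def yH {I : Type uI} (C : Matrix I I ℤ) (τ : I → I) (μ : I → ℤ) (i : I) (r : ℤ) : Y C τ μ :=
  RingQuot.mkAlgHom ℂ (Rel C τ μ) (gH i r)

/-- The generator `B_i^{(s)}` of `ıY_μ`. -/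
def yB {I : Type uI} (C : Matrix I I ℤ) (τ : I → I) (μ : I → ℤ) (i : I) (s : ℕ+) : Y C τ μ :=
  RingQuot.mkAlgHom ℂ (Rel C τ μ) (gB i s)

/-! ## Difference operators with rational coefficients -/

section Difference

variable (ζ ω : Type*)

/-- The field of rational functions over `ℂ` in variables `z_k` (`k : ζ`) and `w_k` (`k : ω`). -/
abbrev RatField : Type _ := FractionRing (MvPolynomial (ζ ⊕ ω) ℂ)

/-- The lattice of shifts of the variables `w_k`, written multiplicatively. -/
abbrev Shifts : Type _ := Multiplicative (ω → ℤ)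

variable {ζ ω}

/-- The substitution `z_k ↦ z_k`, `w_k ↦ w_k + n_k`. -/
def shiftHom (n : ω → ℤ) : MvPolynomial (ζ ⊕ ω) ℂ →ₐ[ℂ] MvPolynomial (ζ ⊕ ω) ℂ :=
  MvPolynomial.aeval (Sum.elim (fun k => MvPolynomial.X (Sum.inl k))
    (fun k => MvPolynomial.X (Sum.inr k) + MvPolynomial.C (n k : ℂ)))

theorem shiftHom_zero : shiftHom (ζ := ζ) (0 : ω → ℤ) = AlgHom.id ℂ _ := by
  apply MvPolynomial.algHom_ext
  rintro (k | k) <;> simp [shiftHom]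

theorem shiftHom_add (m n : ω → ℤ) :
    shiftHom (ζ := ζ) (m + n) = (shiftHom m).comp (shiftHom n) := by
  apply MvPolynomial.algHom_ext
  rintro (k | k)
  · simp [shiftHom]
  · simp [shiftHom, add_assoc]

instance : MulSemiringAction (Shifts ω) (MvPolynomial (ζ ⊕ ω) ℂ) where
  smul g p := shiftHom g.toAdd p
  one_smul p := congrArg (fun f : _ →ₐ[ℂ] _ => f p) (shiftHom_zero (ζ := ζ) (ω := ω))
  mul_smul g h p := congrArg (fun f : _ →ₐ[ℂ] _ => f p) (shiftHom_add (ζ := ζ) g.toAdd h.toAdd)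
  smul_zero g := map_zero (shiftHom (ζ := ζ) g.toAdd)
  smul_add g := map_add (shiftHom (ζ := ζ) g.toAdd)
  smul_one g := map_one (shiftHom (ζ := ζ) g.toAdd)
  smul_mul g := map_mul (shiftHom (ζ := ζ) g.toAdd)

instance : MulSemiringAction (Shifts ω) (RatField ζ ω) :=
  IsFractionRing.mulSemiringAction (Shifts ω) (MvPolynomial (ζ ⊕ ω) ℂ) (RatField ζ ω)

theorem shifts_smul_algebraMap (g : Shifts ω) (p : MvPolynomial (ζ ⊕ ω) ℂ) :
    g • algebraMap _ (RatField ζ ω) p = algebraMap _ (RatField ζ ω) (shiftHom g.toAdd p) :=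
  IsFractionRing.ringEquivOfRingEquiv_algebraMap _ p

instance : SMulCommClass (Shifts ω) ℂ (RatField ζ ω) where
  smul_comm g c f := by
    have h : g • algebraMap ℂ (RatField ζ ω) c = algebraMap ℂ (RatField ζ ω) c := by
      rw [IsScalarTower.algebraMap_apply ℂ (MvPolynomial (ζ ⊕ ω) ℂ) (RatField ζ ω),
        shifts_smul_algebraMap, AlgHom.commutes]
    rw [Algebra.smul_def, Algebra.smul_def, smul_mul', h]

variable (ζ ω)

/-- The algebra of difference operators `∑ f_a ð^a` with rational coefficients `f_a`, where
`ð^a f(w) = f(w + a) ð^a`. -/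
abbrev DiffOp : Type _ := SkewMonoidAlgebra (RatField ζ ω) (Shifts ω)

variable {ζ ω}

/-- The difference operator `f ð^a`. -/
def op (f : RatField ζ ω) (a : ω → ℤ) : DiffOp ζ ω :=
  SkewMonoidAlgebra.single (Multiplicative.ofAdd a) f

/-- A rational function viewed as an operator of multiplication. -/
def scal (f : RatField ζ ω) : DiffOp ζ ω := op f 0

end Difference

/-! ## The data of the iGKLO homomorphism -/

/-- The combinatorial data (their properties are imposed separately): Cartan matrix `cartan`, diagram
involution `τ`, a set `I₁` of representatives of the two-element `τ`-orbits, coweights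
`lam = λ` and `mu = μ`, the numbers `v i` with `λ - μ = ∑ v_i α_i^∨`, an orientation
(`arrow i j` means `i → j`) and the numbers `zeta i`. -/
structure Datum (I : Type uI) where
  cartan : Matrix I I ℤ
  τ : I → I
  I₁ : Set I
  lam : I → ℤ
  mu : I → ℤ
  v : I → ℕ
  arrow : I → I → Prop
  zeta : I → ℕ

namespace Datum

variable {I : Type uI} (D : Datum I)

/-- `I₁` contains exactly one element of each two-element `τ`-orbit, and nothing else. -/
def IsOrbitReps : Prop :=
  (∀ i ∈ D.I₁, D.τ i ≠ i) ∧ ∀ i, D.τ i ≠ i → Xor (i ∈ D.I₁) (D.τ i ∈ D.I₁)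

/-- `arrow` is an orientation of the Dynkin diagram with: if `τ i ≠ i`, then `i → j` implies
`τ j → τ i`, and `j → i` implies `τ i → τ j`. -/
def IsOrientation : Prop :=
  (∀ i j, D.arrow i j → D.cartan i j = -1) ∧
  (∀ i j, D.cartan i j = -1 → Xor (D.arrow i j) (D.arrow j i)) ∧
  (∀ i j, D.τ i ≠ i → D.arrow i j → D.arrow (D.τ j) (D.τ i)) ∧
  (∀ i j, D.τ i ≠ i → D.arrow j i → D.arrow (D.τ i) (D.τ j))

/-- `j ↔ i`: the nodes `i` and `j` are joined by an arrow. -/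
def adj (i j : I) : Prop := D.arrow j i ∨ D.arrow i j

/-- `ıI = I₁ ∪ I₀`, where `I₀` is the set of fixed points of `τ`. -/
def mem (i : I) : Prop := i ∈ D.I₁ ∨ D.τ i = i

/-- `𝔳_i`. -/
def fv (i : I) : ℕ := if D.τ i = i then D.v i / 2 else D.v i

/-- `θ_i`. -/
def theta (i : I) : ℕ := if D.τ i = i then D.v i % 2 else 0

/-- `𝐰_i = ⟨λ, α_i⟩`, for `λ` dominant. -/
def wt (i : I) : ℕ := (D.lam i).toNat

/-- `𝔴_i`. -/
def fw (i : I) : ℕ := if D.τ i = i then D.wt i / 2 else D.wt i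

/-- `ς_i`. -/
def sigma (i : I) : ℕ := if D.τ i = i then D.wt i % 2 else 0

/-- `℘_i`. -/
def wp (i : I) : ℤ :=
  if D.arrow (D.τ i) i then 1 else if D.arrow i (D.τ i) then -1 else 0

/-- The indices `(i, s)` of the variables `z_{i,s}`. -/
abbrev ZIdx : Type uI := Σ i : {i : I // D.mem i}, Fin (D.fw i)

/-- The indices `(i, r)` of the variables `w_{i,r}` and the operators `ð_{i,r}`. -/
abbrev WIdx : Type uI := Σ i : {i : I // D.mem i}, Fin (D.fv i)

/-- The polynomial ring `ℂ[z]`. -/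
abbrev ZRing : Type uI := MvPolynomial D.ZIdx ℂ

/-- The field of rational functions in all the `z_{i,s}` and `w_{i,r}`. -/
abbrev K : Type uI := RatField D.ZIdx D.WIdx

/-- The difference operators in the `w_{i,r}` over this field. -/
abbrev Op : Type uI := DiffOp D.ZIdx D.WIdx

/-- The inclusion of `ℂ[z]` in the field of rational functions. -/
def zToK : D.ZRing →+* D.K :=
  (algebraMap (MvPolynomial (D.ZIdx ⊕ D.WIdx) ℂ) D.K).comp
    (MvPolynomial.rename (R := ℂ) Sum.inl).toRingHom

/-- The variable `w_k` for an index `k`. -/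
def wVar (k : D.WIdx) : D.K :=
  algebraMap (MvPolynomial (D.ZIdx ⊕ D.WIdx) ℂ) D.K (MvPolynomial.X (Sum.inr k))

/-- `z_{i,s}` for `i ∈ ıI` and `1 ≤ s ≤ 𝔴_i` (and `0` outside of this range). -/
def z₀ (i : I) (s : ℕ) : D.ZRing :=
  if h : D.mem i ∧ 1 ≤ s ∧ s ≤ D.fw i then
    MvPolynomial.X ⟨⟨i, h.1⟩, ⟨s - 1, by have := h.2; simp only; omega⟩⟩
  else 0

/-- `z_{i,s}` for all `i`, with `z_{τ i,s} = -z_{i,s}` for `i ∈ I₁`. -/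
def z (i : I) (s : ℕ) : D.ZRing := if D.mem i then D.z₀ i s else -D.z₀ (D.τ i) s

/-- `w_{i,r}` for `i ∈ ıI` and `1 ≤ r ≤ 𝔳_i` (and `0` outside of this range). -/
def w₀ (i : I) (r : ℕ) : D.K :=
  if h : D.mem i ∧ 1 ≤ r ∧ r ≤ D.fv i then
    D.wVar ⟨⟨i, h.1⟩, ⟨r - 1, by have := h.2; simp only; omega⟩⟩
  else 0

/-- `w_{i,r}` for all `i`, with `w_{τ i,r} = -w_{i,𝔳_i+1-r}` for `i ∈ I₁`. -/
def w (i : I) (r : ℕ) : D.K :=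
  if D.mem i then D.w₀ i r else -D.w₀ (D.τ i) (D.fv (D.τ i) + 1 - r)

/-- The exponent of `ð_{i,r}` for `i ∈ ıI` and `1 ≤ r ≤ 𝔳_i` (and `0` outside of this range). -/
def e₀ (i : I) (r : ℕ) : D.WIdx → ℤ :=
  if h : D.mem i ∧ 1 ≤ r ∧ r ≤ D.fv i then
    Pi.single ⟨⟨i, h.1⟩, ⟨r - 1, by have := h.2; simp only; omega⟩⟩ 1
  else 0

/-- The exponent of `ð_{i,r}` for all `i`, with `ð_{τ i,r} = ð_{i,𝔳_i+1-r}⁻¹` for `i ∈ I₁`. -/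
def e (i : I) (r : ℕ) : D.WIdx → ℤ :=
  if D.mem i then D.e₀ i r else -D.e₀ (D.τ i) (D.fv (D.τ i) + 1 - r)

/-- The ring `𝒜`: the subalgebra of the difference operators generated by all `z_{i,s}`,
`w_{i,r}`, `ð_{i,r}^{±1}`, `(w_{i,r} ± w_{i,r'} + m)⁻¹` with `r ≠ r'`, and `(w_{i,r} + m/2)⁻¹`,
for `i ∈ ıI` and `m ∈ ℤ`. It is the localized ring with these generators and the relations
`[ð_{i,r}^{±1}, w_{j,r'}] = ± δ_{ij} δ_{rr'} ð_{i,r}^{±1}`, `[w_{i,r}, w_{j,r'}] = 0`,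
`[ð_{i,r}, ð_{j,r'}] = 0`, realized inside the difference operators with rational coefficients. -/
def A : Subalgebra ℂ D.Op :=
  Algebra.adjoin ℂ
    (Set.range (fun f : D.ZRing => scal (D.zToK f)) ∪
     Set.range (fun k : D.WIdx => scal (D.wVar k)) ∪
     Set.range (fun k : D.WIdx => op 1 (Pi.single k 1)) ∪
     Set.range (fun k : D.WIdx => op 1 (-Pi.single k 1)) ∪
     {x | ∃ (i : {i : I // D.mem i}) (r r' : Fin (D.fv i)) (m : ℤ), r ≠ r' ∧
        (x = scal ((D.wVar ⟨i, r⟩ + D.wVar ⟨i, r'⟩ + (m : D.K))⁻¹) ∨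
         x = scal ((D.wVar ⟨i, r⟩ - D.wVar ⟨i, r'⟩ + (m : D.K))⁻¹))} ∪
     {x | ∃ (k : D.WIdx) (m : ℤ), x = scal ((D.wVar k + (m : D.K) / 2)⁻¹)})

/-! ### The polynomials entering the formulas -/

open Polynomial

/-- `f⁻(u) = (-1)^{deg f} f(-u)`. -/
def minus {R : Type*} [CommRing R] (f : R[X]) : R[X] :=
  C ((-1) ^ f.natDegree) * f.comp (-X)

/-- `W_i(u)`. -/
def W (i : I) : D.K[X] :=
  if D.τ i = i then ∏ r ∈ Finset.Icc 1 (D.fv i), (X - C (D.w i r))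
  else ∏ r ∈ Finset.Icc 1 (D.zeta i), (X - C (D.w i r))

/-- The boldface `𝐖_i(u)`. -/
def bW (i : I) : D.K[X] :=
  if D.τ i = i then
    X ^ D.theta i * ∏ r ∈ Finset.Icc 1 (D.fv i), (X ^ 2 - C (D.w i r) ^ 2)
  else ∏ r ∈ Finset.Icc 1 (D.fv i), (X - C (D.w i r))

/-- The boldface `𝐖_{i,r}(u)`. -/
def bWr (i : I) (r : ℕ) : D.K[X] :=
  if D.τ i = i then
    X ^ D.theta i * (X + C (D.w i r)) *
      ∏ s ∈ (Finset.Icc 1 (D.fv i)).erase r, (X ^ 2 - C (D.w i s) ^ 2)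
  else ∏ s ∈ (Finset.Icc 1 (D.fv i)).erase r, (X - C (D.w i s))

/-- `𝐖_i^∘(u)`, for `i ∈ I₀`. -/
def Wcirc (i : I) : D.K[X] := ∏ r ∈ Finset.Icc 1 (D.fv i), (X ^ 2 - C (D.w i r) ^ 2)

/-- `W̄_i⁻(u) = u^{θ_i} W_i⁻(u)`, for `i ∈ I₀`. -/
def Wbar (i : I) : D.K[X] := X ^ D.theta i * minus (D.W i)

/-- The boldface `𝐙_i(u)`, over `ℂ[z]`. -/
def bZ (i : I) : D.ZRing[X] :=
  if D.τ i = i then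
    X ^ D.sigma i * ∏ s ∈ Finset.Icc 1 (D.fw i), (X ^ 2 - C (D.z i s) ^ 2)
  else ∏ s ∈ Finset.Icc 1 (D.fw i), (X - C (D.z i s))

/-- A choice of monic polynomials `Z_i(u)` over `ℂ[z]`, for `τ i ≠ i`, such that
`𝐙_i(u) = Z_i(u) Z_{τ i}⁻(u)`. -/
def IsZSplitting (Zs : I → D.ZRing[X]) : Prop :=
  ∀ i, D.τ i ≠ i → (Zs i).Monic ∧ D.bZ i = Zs i * minus (Zs (D.τ i))

/-- `Z_i(u)`: the product of the `u - z_{i,s}` for `i ∈ I₀`, the chosen factor otherwise. -/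
def Z (Zs : I → D.ZRing[X]) (i : I) : D.ZRing[X] :=
  if D.τ i = i then ∏ s ∈ Finset.Icc 1 (D.fw i), (X - C (D.z i s)) else Zs i

/-- `Z̄_i⁻(u) = u^{ς_i} Z_i⁻(u)`, for `i ∈ I₀`. -/
def Zbar (Zs : I → D.ZRing[X]) (i : I) : D.ZRing[X] := X ^ D.sigma i * minus (D.Z Zs i)

/-- The value in the field of rational functions of a polynomial over `ℂ[z]`. -/
def zeval (p : D.ZRing[X]) (x : D.K) : D.K := p.eval₂ D.zToK x

/-- `ϰ(x) = 1 - 1/(2x)`. -/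
def kap (x : D.K) : D.K := 1 - 1 / (2 * x)

/-! ### Series in `u⁻¹`

Rational functions of `u` are expanded at `u = ∞`, in the field of Laurent series in the
variable `u⁻¹`: the coefficient of `u^{-r}` is the coefficient of index `r`. -/

/-- The field `K((u⁻¹))`. -/
abbrev Ser : Type uI := LaurentSeries D.K

/-- The element `u` of `K((u⁻¹))`. -/
def u : D.Ser := HahnSeries.single (-1 : ℤ) (1 : D.K)

/-- A constant series. -/
def const : D.K →+* D.Ser := HahnSeries.C

/-- The value of a polynomial over `K` at a series. -/
def seval (p : D.K[X]) (x : D.Ser) : D.Ser := p.eval₂ D.const x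

variable [Fintype I]

/-- `ϑ_i`. -/
def vartheta (i : I) : ℕ :=
  if D.τ i = i then (Finset.univ.filter (fun j => D.cartan i j ≠ 0)).sup D.theta else D.theta i

/-- The parity condition `c_{ij} θ_i θ_j = 0` for `i ≠ j`. -/
def Parity : Prop := ∀ i j, i ≠ j → D.cartan i j * D.theta i * D.theta j = 0

/-- `λ - μ = ∑_j v_j α_j^∨`. -/
def IsDiff : Prop := ∀ i, D.lam i - D.mu i = ∑ j, (D.v j : ℤ) * D.cartan j i

/-- A choice of the square roots `√((-1)^{𝔴_i + ∑ 𝔳_j})` for `i ∈ I₀`, where the sum runs over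
the `j ∈ ıI` joined to `i`. -/
def IsRootChoice (ε : I → ℂ) : Prop :=
  ∀ i, D.τ i = i →
    ε i ^ 2 = (-1) ^ (D.fw i + ∑ j with D.adj i j ∧ D.mem j, D.fv j)

/-- The series in `u⁻¹` to which `H_i(u) = ∑_r H_i^{(r)} u^{-r}` is sent:
`(1 + ℘_i/(4u)) ϰ(u)^{ϑ_i} 𝐙_i(u) / (𝐖_i(u - 1/2) 𝐖_i(u + 1/2)) ∏_{j ↔ i} 𝐖_j(u)`,
here with the boldface `ϰ(u) = 1 - 1/(4u²)`. -/
def HSer (i : I) : D.Ser :=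
  (1 + (D.wp i : D.Ser) / (4 * D.u)) *
    ((1 - 1 / (4 * D.u ^ 2)) ^ D.vartheta i * D.seval ((D.bZ i).map D.zToK) D.u /
      (D.seval (D.bW i) (D.u - 1 / 2) * D.seval (D.bW i) (D.u + 1 / 2))) *
    ∏ j with D.adj i j, D.seval (D.bW j) D.u

/-- The image of `B_i^{(s)}` for `τ i ≠ i`: the coefficient of `u^{-s}` in the image of `B_i(u)`. -/
def BNonfixed (Zs : I → D.ZRing[X]) (i : I) (s : ℕ+) : D.Op :=
  - (∑ r ∈ Finset.Icc 1 (D.zeta i),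
      op (D.zeval (D.Z Zs i) (D.w i r - 1 / 2) / (D.bWr i r).eval (D.w i r)
          * (∏ j with D.arrow j i, (D.bW j).eval (D.w i r - 1 / 2))
          * ((D.u + 1 / 2 - D.const (D.w i r))⁻¹).coeff (s : ℤ))
        (-D.e i r))
  - (∑ r ∈ Finset.Icc 1 (D.zeta (D.τ i)),
      op (D.zeval (minus (D.Z Zs i)) (D.w (D.τ i) r + 1 / 2)
            / (D.bWr (D.τ i) r).eval (D.w (D.τ i) r)
          * (∏ j with D.arrow (D.τ i) (D.τ j), (D.bW (D.τ j)).eval (D.w (D.τ i) r + 1 / 2))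
          * ((D.u + 1 / 2 + D.const (D.w (D.τ i) r))⁻¹).coeff (s : ℤ))
        (D.e (D.τ i) r))

/-- The image of `B_i^{(s)}` for `τ i = i`: the coefficient of `u^{-s}` in the image of `B_i(u)`. -/
def BFixed (Zs : I → D.ZRing[X]) (ε : I → ℂ) (i : I) (s : ℕ+) : D.Op :=
  - (∑ r ∈ Finset.Icc 1 (D.fv i),
      op ((D.kap (D.w i r) ^ D.vartheta i)⁻¹
            * D.zeval (D.Z Zs i) (D.w i r - 1 / 2) / (D.bWr i r).eval (D.w i r)
          * (∏ j with D.arrow j i, (D.bW j).eval (D.w i r - 1 / 2))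
          * (∏ j with D.arrow i j ∧ D.τ j = j, (D.Wbar j).eval (D.w i r - 1 / 2))
          * ((D.u + 1 / 2 - D.const (D.w i r))⁻¹).coeff (s : ℤ))
        (-D.e i r))
  - (∑ r ∈ Finset.Icc 1 (D.fv i),
      op ((D.kap (-D.w i r) ^ D.vartheta i)⁻¹
            * D.zeval (D.Zbar Zs i) (D.w i r + 1 / 2) / (D.bWr i r).eval (D.w i r)
          * (∏ j with D.arrow i j ∧ D.τ j ≠ j, (D.bW j).eval (D.w i r + 1 / 2))
          * (∏ j with D.arrow i j ∧ D.τ j = j, (D.W j).eval (D.w i r + 1 / 2))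
          * ((D.u + 1 / 2 + D.const (D.w i r))⁻¹).coeff (s : ℤ))
        (D.e i r))
  + scal (algebraMap ℂ D.K (ε i)
      * ((D.theta i : D.K) * D.zeval (D.Z Zs i) 0 / (D.Wcirc i).eval (1 / 2))
      * (∏ j with D.adj i j, (D.W j).eval 0)
      * ((D.u)⁻¹).coeff (s : ℤ))

end Datum

end IYangian

end

open scoped TensorProduct

noncomputable section

open scoped Classical

namespace IYangian

section

/-- Elements `y a` of a ring `R` over a field `K`, indexed by roots `a`: `y a` acts on `K` through
the endomorphism `σ a`, shifts the coordinate `x a` by `-1`, and the `y a` obey quadratic exchange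
relations governed by a simply laced Cartan matrix `c`. -/
structure ShiftSystem (I P K R : Type*) [Field K] [Ring R] [Module K R] where
  σ : P → K →+* K
  y : P → R
  x : P → K
  h : P → K
  nd : P → I
  neg : P → P
  τ : I → I
  c : I → I → ℤ
  smul_mul : ∀ (f : K) (r s : R), (f • r) * s = f • (r * s)
  neg_neg : ∀ a, neg (neg a) = a
  nd_neg : ∀ a, nd (neg a) = τ (nd a)
  y_mul : ∀ a (f : K) (r : R), y a * (f • r) = σ a f • (y a * r)
  σ_x : ∀ a b, b ≠ a → b ≠ neg a → σ a (x b) = x b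
  σ_x_self : ∀ a, a ≠ neg a → σ a (x a) = x a - 1
  σ_x_neg : ∀ a, σ a (x (neg a)) = -x a
  x_sub_ne : ∀ a b (q : ℚ), q ≠ 0 → x a - x b + q ≠ 0
  x_add_ne : ∀ a b (q : ℚ), b ≠ neg a → q ≠ 0 → x a + x b + q ≠ 0
  exch : ∀ a b, b ≠ a → b ≠ neg a →
    (x a - x b - (c (nd a) (nd b) : K) / 2) • (y a * y b) =
      (x a - x b + (c (nd a) (nd b) : K) / 2) • (y b * y a)
  exch_zero : ∀ a b, b ≠ a → b ≠ neg a → c (nd a) (nd b) = 0 → y a * y b = y b * y a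
  y_neg : ∀ a, y a * y (neg a) = h a • 1
  c_self : ∀ i, c i i = 2
  c_symm : ∀ i j, c i j = c j i

namespace ShiftSystem

variable {I P K R : Type*} [Field K] [Ring R] [Module K R] (S : ShiftSystem I P K R)

/-- The `p`-th weighted copy `x_a^p y_a` of `y_a`. -/
def t (a : P) (p : ℕ) : R := (S.x a ^ p) • S.y a

theorem smul_one_mul (S : ShiftSystem I P K R) (f : K) (r : R) : (f • (1 : R)) * r = f • r := by
  rw [S.smul_mul, one_mul]

theorem y_neg' (a : P) : S.y (S.neg a) * S.y a = S.h (S.neg a) • 1 := by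
  have := S.y_neg (S.neg a); rwa [S.neg_neg] at this

theorem t_mul (a b : P) (p q : ℕ) :
    S.t a p * S.t b q = (S.x a ^ p * S.σ a (S.x b) ^ q) • (S.y a * S.y b) := by
  simp only [t]
  rw [S.smul_mul, S.y_mul, smul_smul, map_pow]

theorem t_mul₃ (a b d : P) (p q m : ℕ) :
    S.t a p * (S.t b q * S.t d m) =
      (S.x a ^ p * S.σ a (S.x b) ^ q * S.σ a (S.σ b (S.x d)) ^ m) •
        (S.y a * (S.y b * S.y d)) := by
  rw [S.t_mul]; simp only [t]
  rw [S.smul_mul, S.y_mul, smul_smul, map_mul, map_pow, map_pow, mul_assoc]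

theorem ne_neg_symm {a b : P} (h : b ≠ S.neg a) : a ≠ S.neg b := by
  rintro rfl; exact h (S.neg_neg b).symm

theorem σ_x_neg' (a : P) : S.σ (S.neg a) (S.x a) = -S.x (S.neg a) := by
  have := S.σ_x_neg (S.neg a); rwa [S.neg_neg] at this

/-- The contribution of a pair of roots to the quadratic relation. -/
def quad (i j : I) (a b : P) (p q : ℕ) : R :=
  ⁅S.t a (p + 1), S.t b q⁆ - ⁅S.t a p, S.t b (q + 1)⁆
    - ((S.c i j : K) / 2) • acomm (S.t a p) (S.t b q)

theorem quad_neg (i j : I) (a : P) (p q : ℕ) :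
    S.quad i j a (S.neg a) p q =
      ((-1) ^ q * S.x a ^ (p + q) * (2 * S.x a - (S.c i j : K) / 2) * S.h a
      + (-1) ^ p * S.x (S.neg a) ^ (p + q) * (2 * S.x (S.neg a) - (S.c i j : K) / 2)
        * S.h (S.neg a)) • (1 : R) := by
  simp only [quad, acomm, Ring.lie_def, S.t_mul, S.y_neg, S.y_neg', S.σ_x_neg, S.σ_x_neg']
  rw [neg_pow (S.x a), neg_pow (S.x a), neg_pow (S.x (S.neg a)), neg_pow (S.x (S.neg a))]
  match_scalars
  ring

variable [CharZero K]

theorem half_ne (a b : P) : S.x a - S.x b + 1 / 2 ≠ 0 := by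
  simpa using S.x_sub_ne a b (1 / 2) (by norm_num)

theorem sub_one_ne (a b : P) : S.x a - S.x b - 1 ≠ 0 := by
  have := S.x_sub_ne a b (-1) (by norm_num)
  push_cast at this; rwa [← sub_eq_add_neg] at this

theorem quad_of_ne (a b : P) (p q : ℕ) (h : b ≠ S.neg a) :
    S.quad (S.nd a) (S.nd b) a b p q = 0 := by
  simp only [quad, acomm, Ring.lie_def, S.t_mul]
  by_cases hab : b = a
  · subst hab
    rw [S.σ_x_self _ h, S.c_self]
    match_scalars
    ring
  · rw [S.σ_x a b hab h, S.σ_x b a (Ne.symm hab) (S.ne_neg_symm h)]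
    have e := S.exch a b hab h
    linear_combination (norm := skip) (S.x a ^ p * S.x b ^ q) • e
    match_scalars <;> ring

/-- Exchange of `y a` and `y b` at adjacent nodes. -/
theorem exch_adj {a b : P} (h1 : b ≠ a) (h2 : b ≠ S.neg a) (hc : S.c (S.nd a) (S.nd b) = -1) :
    S.y a * S.y b = ((S.x a - S.x b - 1 / 2) / (S.x a - S.x b + 1 / 2)) • (S.y b * S.y a) := by
  have h := S.exch a b h1 h2
  rw [hc] at h
  have hn := S.half_ne a b
  have h' : (S.x a - S.x b + 1 / 2) • (S.y a * S.y b) =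
      (S.x a - S.x b - 1 / 2) • (S.y b * S.y a) := by
    convert h using 2 <;> (push_cast; ring)
  rw [div_eq_inv_mul, ← smul_smul, ← h', smul_smul, inv_mul_cancel₀ hn, one_smul]

/-- Exchange of `y a` and `y b` at the same node. -/
theorem exch_same {a b : P} (h1 : b ≠ a) (h2 : b ≠ S.neg a) (hc : S.nd a = S.nd b) :
    S.y a * S.y b = ((S.x a - S.x b + 1) / (S.x a - S.x b - 1)) • (S.y b * S.y a) := by
  have h := S.exch a b h1 h2
  rw [hc, S.c_self] at h
  have hn := S.sub_one_ne a b
  have h' : (S.x a - S.x b - 1) • (S.y a * S.y b) =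
      (S.x a - S.x b + 1) • (S.y b * S.y a) := by
    convert h using 2 <;> (push_cast; ring)
  rw [div_eq_inv_mul, ← smul_smul, ← h', smul_smul, inv_mul_cancel₀ hn, one_smul]

/-- The contribution of a triple of roots to the Serre relation. -/
def cubic (a a' b : P) (p q m : ℕ) : R :=
  ⁅S.t a p, ⁅S.t a' q, S.t b m⁆⁆ + ⁅S.t a' q, ⁅S.t a p, S.t b m⁆⁆

theorem cubic_eq (a a' b : P) (p q m : ℕ) :
    S.cubic a a' b p q m =
      S.t a p * (S.t a' q * S.t b m) + S.t a' q * (S.t a p * S.t b m)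
      - (2 : K) • (S.t a p * (S.t b m * S.t a' q)) - (2 : K) • (S.t a' q * (S.t b m * S.t a p))
      + S.t b m * (S.t a p * S.t a' q) + S.t b m * (S.t a' q * S.t a p) := by
  simp only [cubic, Ring.lie_def, two_smul]
  noncomm_ring

theorem cubic_add_swap {a a' b : P} (p q m : ℕ) (h1 : a' ≠ a) (h2 : a' ≠ S.neg a) (h3 : b ≠ a)
    (h4 : b ≠ S.neg a) (h5 : b ≠ a') (h6 : b ≠ S.neg a') (hn : S.nd a = S.nd a')
    (hc : S.c (S.nd a) (S.nd b) = -1) :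
    S.cubic a a' b p q m + S.cubic a' a b p q m = 0 := by
  have e1 := S.exch_adj h3 h4 hc
  have e2 := S.exch_adj h5 h6 (hn ▸ hc)
  have e3 := S.exch_same (Ne.symm h1) (S.ne_neg_symm h2) hn.symm
  have k1 : S.σ a (S.x a') = S.x a' := S.σ_x _ _ h1 h2
  have k2 : S.σ a' (S.x a) = S.x a := S.σ_x _ _ (Ne.symm h1) (S.ne_neg_symm h2)
  have k3 : S.σ a (S.x b) = S.x b := S.σ_x _ _ h3 h4
  have k4 : S.σ a' (S.x b) = S.x b := S.σ_x _ _ h5 h6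
  have k5 : S.σ b (S.x a) = S.x a := S.σ_x _ _ (Ne.symm h3) (S.ne_neg_symm h4)
  have k6 : S.σ b (S.x a') = S.x a' := S.σ_x _ _ (Ne.symm h5) (S.ne_neg_symm h6)
  have n1 := S.half_ne a b
  have n2 := S.half_ne a' b
  have n3 := S.sub_one_ne a' a
  set r := (S.x a - S.x b - 1 / 2) / (S.x a - S.x b + 1 / 2) with hr
  set r' := (S.x a' - S.x b - 1 / 2) / (S.x a' - S.x b + 1 / 2) with hr'
  set k := (S.x a' - S.x a + 1) / (S.x a' - S.x a - 1) with hk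
  have s1 : S.σ a r' = r' := by simp [hr', k1, k3, map_ofNat]
  have s2 : S.σ a' r = r := by simp [hr, k2, k4, map_ofNat]
  have s3 : S.σ b k = k := by simp [hk, k5, k6]
  have f1 : S.y a * (S.y b * S.y a') = r • (S.y b * (S.y a * S.y a')) := by
    rw [← mul_assoc, e1, S.smul_mul, mul_assoc]
  have f2 : S.y b * (S.y a' * S.y a) = k • (S.y b * (S.y a * S.y a')) := by
    rw [e3, S.y_mul, s3]
  have f3 : S.y a' * (S.y b * S.y a) = (r' * k) • (S.y b * (S.y a * S.y a')) := by
    rw [← mul_assoc, e2, S.smul_mul, mul_assoc, f2, smul_smul]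
  have f4 : S.y a * (S.y a' * S.y b) = (r' * r) • (S.y b * (S.y a * S.y a')) := by
    rw [e2, S.y_mul, s1, f1, smul_smul]
  have f5 : S.y a' * (S.y a * S.y b) = (r * (r' * k)) • (S.y b * (S.y a * S.y a')) := by
    rw [e1, S.y_mul, s2, f3, smul_smul]
  simp only [S.cubic_eq, S.t_mul₃, k1, k2, k3, k4, k5, k6, f1, f2, f3, f4, f5]
  match_scalars
  have : r' * r * (1 + k) - 2 * r - 2 * r' * k + 1 + k = 0 := by
    have : ∀ d e : K, d ≠ 0 → e ≠ 0 → e - d - 1 ≠ 0 → (e - 1) / e * ((d - 1) / d)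
        * (1 + (e - d + 1) / (e - d - 1)) - 2 * ((d - 1) / d)
        - 2 * ((e - 1) / e) * ((e - d + 1) / (e - d - 1)) + 1
        + (e - d + 1) / (e - d - 1) = 0 := by
      intro d e h1 h2 h3; field_simp; ring
    have := this _ _ n1 n2 (by convert n3 using 1; ring)
    rw [hr, hr', hk, show S.x a - S.x b - 1 / 2 = S.x a - S.x b + 1 / 2 - 1 by ring,
      show S.x a' - S.x b - 1 / 2 = S.x a' - S.x b + 1 / 2 - 1 by ring,
      show S.x a' - S.x a + 1 = S.x a' - S.x b + 1 / 2 - (S.x a - S.x b + 1 / 2) + 1 by ring,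
      show S.x a' - S.x a - 1 = S.x a' - S.x b + 1 / 2 - (S.x a - S.x b + 1 / 2) - 1 by ring]
    linear_combination this
  linear_combination (S.x a ^ p * S.x a' ^ q * S.x b ^ m + S.x a ^ q * S.x a' ^ p * S.x b ^ m) * this

theorem cubic_self {a b : P} (p q m : ℕ) (h2 : a ≠ S.neg a) (h3 : b ≠ a)
    (h4 : b ≠ S.neg a) (hc : S.c (S.nd a) (S.nd b) = -1) :
    S.cubic a a b p q m = 0 := by
  have e1 := S.exch_adj h3 h4 hc
  have k1 : S.σ a (S.x a) = S.x a - 1 := S.σ_x_self _ h2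
  have k3 : S.σ a (S.x b) = S.x b := S.σ_x _ _ h3 h4
  have k5 : S.σ b (S.x a) = S.x a := S.σ_x _ _ (Ne.symm h3) (S.ne_neg_symm h4)
  have n1 := S.half_ne a b
  have n2 : S.x a - 1 - S.x b + 1 / 2 ≠ 0 := by
    have := S.x_sub_ne a b (-1/2) (by norm_num)
    convert this using 1; push_cast; ring
  set r := (S.x a - S.x b - 1 / 2) / (S.x a - S.x b + 1 / 2) with hr
  have s1 : S.σ a r = (S.x a - 1 - S.x b - 1 / 2) / (S.x a - 1 - S.x b + 1 / 2) := by
    simp [hr, k1, k3, map_ofNat]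
  have f1 : S.y a * (S.y b * S.y a) = r • (S.y b * (S.y a * S.y a)) := by
    rw [← mul_assoc, e1, S.smul_mul, mul_assoc]
  have f2 : S.y a * (S.y a * S.y b) = (S.σ a r * r) • (S.y b * (S.y a * S.y a)) := by
    rw [e1, S.y_mul, f1, smul_smul]
  simp only [S.cubic_eq, S.t_mul₃, k1, k3, k5, f1, f2, map_sub, map_one]
  match_scalars
  have : S.σ a r * r - 2 * r + 1 = 0 := by
    have : ∀ d : K, d ≠ 0 → d - 1 ≠ 0 →
        (d - 1 - 1) / (d - 1) * ((d - 1) / d) - 2 * ((d - 1) / d) + 1 = 0 := by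
      intro d h1 h2; field_simp; ring
    rw [s1, hr]
    have := this _ n1 (by convert n2 using 1; ring)
    rw [show S.x a - S.x b - 1 / 2 = S.x a - S.x b + 1 / 2 - 1 by ring,
      show S.x a - 1 - S.x b - 1 / 2 = S.x a - S.x b + 1 / 2 - 1 - 1 by ring,
      show S.x a - 1 - S.x b + 1 / 2 = S.x a - S.x b + 1 / 2 - 1 by ring]
    exact this
  linear_combination (S.x a ^ p * (S.x a - 1) ^ q * S.x b ^ m
    + S.x a ^ q * (S.x a - 1) ^ p * S.x b ^ m) * this

/-- The contribution of `a`, `neg a` and a root at an adjacent node. -/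
theorem cubic_neg {a b : P} (p q m : ℕ) (h3 : b ≠ a) (h4 : b ≠ S.neg a)
    (hc : S.c (S.nd a) (S.nd b) = -1) (hn : S.τ (S.nd a) = S.nd a) :
    S.cubic a (S.neg a) b p q m =
      (S.x b ^ m * (
        (-1) ^ q * S.x a ^ (p + q) * S.h a * (1 - 2 * S.x a)
          / ((S.x b + 1 / 2) ^ 2 - S.x a ^ 2)
        + (-1) ^ p * S.x (S.neg a) ^ (p + q) * S.h (S.neg a) * (1 - 2 * S.x (S.neg a))
          / ((S.x b + 1 / 2) ^ 2 - S.x (S.neg a) ^ 2))) • S.y b := by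
  have h5 : b ≠ S.neg (S.neg a) := by rwa [S.neg_neg]
  have hc' : S.c (S.nd (S.neg a)) (S.nd b) = -1 := by rw [S.nd_neg, hn, hc]
  have k3 : S.σ a (S.x b) = S.x b := S.σ_x _ _ h3 h4
  have k4 : S.σ (S.neg a) (S.x b) = S.x b := S.σ_x _ _ h4 h5
  have k5 : S.σ b (S.x a) = S.x a := S.σ_x _ _ (Ne.symm h3) (S.ne_neg_symm h4)
  have k6 : S.σ b (S.x (S.neg a)) = S.x (S.neg a) := S.σ_x _ _ (Ne.symm h4) (S.ne_neg_symm h5)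
  have key : ∀ a b : P, b ≠ a → b ≠ S.neg a → S.c (S.nd a) (S.nd b) = -1 →
      S.c (S.nd (S.neg a)) (S.nd b) = -1 →
      S.y a * (S.y b * S.y (S.neg a)) = ((S.x b + S.x a - 1 / 2) / (S.x b + S.x a + 1 / 2)
        * S.h a) • S.y b ∧
      S.y b * (S.y a * S.y (S.neg a)) = ((S.x b + S.x a - 1 / 2) / (S.x b + S.x a + 1 / 2)
        * ((S.x b - S.x a - 1 / 2) / (S.x b - S.x a + 1 / 2)) * S.h a) • S.y b := by
    intro a b h3 h4 hc hc'
    have e : S.y b * S.y (S.neg a) = _ :=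
      S.exch_adj (a := b) (b := S.neg a) h4.symm (fun h => h3 (by
        have := congrArg S.neg h; rw [S.neg_neg, S.neg_neg] at this; exact this.symm))
        (by rw [S.c_symm, hc'])
    have e' : S.y b * S.y a = _ :=
      S.exch_adj (a := b) (b := a) h3.symm (S.ne_neg_symm h4) (by rw [S.c_symm, hc])
    have k3 : S.σ a (S.x b) = S.x b := S.σ_x _ _ h3 h4
    have f1 : S.y a * (S.y b * S.y (S.neg a)) =
        ((S.x b + S.x a - 1 / 2) / (S.x b + S.x a + 1 / 2) * S.h a) • S.y b := by
      rw [e, S.y_mul, ← mul_assoc, S.y_neg, S.smul_one_mul, smul_smul]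
      simp [k3, S.σ_x_neg, map_ofNat]
    refine ⟨f1, ?_⟩
    rw [← mul_assoc, e', S.smul_mul, mul_assoc, f1, smul_smul]
    congr 1; ring
  obtain ⟨f1, f2⟩ := key a b h3 h4 hc hc'
  obtain ⟨f3, f4⟩ := key (S.neg a) b h4 h5 hc' (by rwa [S.neg_neg])
  rw [S.neg_neg] at f3 f4
  have f5 : S.y a * (S.y (S.neg a) * S.y b) = S.h a • S.y b := by
    rw [← mul_assoc, S.y_neg, S.smul_one_mul]
  have f6 : S.y (S.neg a) * (S.y a * S.y b) = S.h (S.neg a) • S.y b := by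
    rw [← mul_assoc, S.y_neg', S.smul_one_mul]
  have n : ∀ a b : P, b ≠ S.neg a → S.x b + S.x a + 1 / 2 ≠ 0 := fun a b h => by
    have := S.x_add_ne b a (1/2) (S.ne_neg_symm h) (by norm_num)
    convert this using 1; push_cast; ring
  have n1 := n a b h4
  have n2 := n _ _ h5
  have n3 := S.half_ne b a
  have n4 := S.half_ne b (S.neg a)
  have d : ∀ a b : P, (S.x b + 1 / 2) ^ 2 - S.x a ^ 2 =
    (S.x b + S.x a + 1 / 2) * (S.x b - S.x a + 1 / 2) := fun a b => by ring
  simp only [S.cubic_eq, S.t_mul₃, k3, k4, k5, k6, f1, f2, f3, f4, f5, f6, S.σ_x_neg, S.σ_x_neg',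
    map_neg, d]
  match_scalars
  have key : ∀ x d e : K, d ≠ 0 → e ≠ 0 → d - e = 2 * x → 1 - 2 * ((d - 1) / d)
      + (d - 1) / d * ((e - 1) / e) = (1 - 2 * x) / (d * e) := by
    intro x d e h1 h2 h; field_simp; linear_combination -h
  have g1 := key (S.x a) _ _ n1 n3 (by ring)
  have g2 := key (S.x (S.neg a)) _ _ n2 n4 (by ring)
  have r1 : ∀ z : K, z - 1 / 2 = z + 1 / 2 - 1 := fun z => by ring
  simp only [neg_pow (S.x a), neg_pow (S.x (S.neg a)), r1, mul_div_assoc]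
  linear_combination (S.x b ^ m * (-1) ^ q * S.x a ^ (p + q) * S.h a) * g1
    + (S.x b ^ m * (-1) ^ p * S.x (S.neg a) ^ (p + q) * S.h (S.neg a)) * g2

theorem cubic_swap (a a' b : P) (p q m : ℕ) :
    S.cubic a a' b p q m = S.cubic a' a b q p m := by
  simp only [cubic]; rw [add_comm]

theorem neg_injective : Function.Injective S.neg := fun a b h => by
  have := congrArg S.neg h; rwa [S.neg_neg, S.neg_neg] at this

/-- The contribution of `a`, `a'` and `neg a'` when a node is adjacent to its image under `τ`. -/
theorem cubic_neg_right {a a' : P} (p q m : ℕ) (h1 : a' ≠ a) (hn : S.nd a' = S.nd a)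
    (hτ : S.τ (S.nd a) ≠ S.nd a) (hc : S.c (S.nd a) (S.τ (S.nd a)) = -1) :
    S.cubic a a' (S.neg a') p q m =
      (S.x a ^ p * (
        (-1) ^ m * S.x a' ^ (q + m) * S.h a' * (4 * S.x a' + 1)
          / ((S.x a - S.x a' - 1) * (S.x a + S.x a' + 1 / 2))
        + (-1) ^ q * S.x (S.neg a') ^ (q + m) * S.h (S.neg a') * (4 * S.x (S.neg a') + 1)
          / ((S.x a - S.x (S.neg a') + 1 / 2) * (S.x a + S.x (S.neg a') - 1)))) • S.y a := by
  have h2 : a' ≠ S.neg a := fun h => hτ (by rw [← S.nd_neg, ← h, hn])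
  have h3 : S.neg a' ≠ a := fun h => h2 (S.neg_injective (by rw [S.neg_neg, h]))
  have h4 : S.neg a' ≠ S.neg a := fun h => h1 (S.neg_injective h)
  have e1 := S.exch_adj h3 h4 (by rw [S.nd_neg, hn, hc])
  have e2 := S.exch_same h1 h2 hn.symm
  have k1 : S.σ a (S.x a') = S.x a' := S.σ_x _ _ h1 h2
  have k2 : S.σ a (S.x (S.neg a')) = S.x (S.neg a') := S.σ_x _ _ h3 h4
  have k3 : S.σ a' (S.x a) = S.x a := S.σ_x _ _ h1.symm (S.ne_neg_symm h2)
  have k4 : S.σ (S.neg a') (S.x a) = S.x a := S.σ_x _ _ h3.symm (S.ne_neg_symm h4)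
  set b := S.neg a' with hb
  set r := (S.x a - S.x b - 1 / 2) / (S.x a - S.x b + 1 / 2) with hr
  set k := (S.x a - S.x a' + 1) / (S.x a - S.x a' - 1) with hk
  have s1 : S.σ a' r = (S.x a + S.x a' - 1 / 2) / (S.x a + S.x a' + 1 / 2) := by
    simp [hr, k3, map_ofNat, hb, S.σ_x_neg]
  have s2 : S.σ b k = (S.x a + S.x b + 1) / (S.x a + S.x b - 1) := by
    have k5 : S.σ b (S.x a') = -S.x b := S.σ_x_neg' a'
    simp [hk, k4, k5]
  have e3 : S.y a' * S.y b = S.h a' • 1 := S.y_neg a'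
  have e4 : S.y b * S.y a' = S.h b • 1 := S.y_neg' a'
  have f1 : S.y a' * (S.y b * S.y a) = S.h a' • S.y a := by
    rw [← mul_assoc, e3, S.smul_one_mul]
  have f2 : S.y a' * (S.y a * S.y b) = (S.σ a' r * S.h a') • S.y a := by
    rw [e1, S.y_mul, f1, smul_smul]
  have f3 : S.y a * (S.y a' * S.y b) = (k * (S.σ a' r * S.h a')) • S.y a := by
    rw [← mul_assoc, e2, S.smul_mul, mul_assoc, f2, smul_smul]
  have f4 : S.y b * (S.y a' * S.y a) = S.h b • S.y a := by
    rw [← mul_assoc, e4, S.smul_one_mul]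
  have f5 : S.y b * (S.y a * S.y a') = (S.σ b k * S.h b) • S.y a := by
    rw [e2, S.y_mul, f4, smul_smul]
  have f6 : S.y a * (S.y b * S.y a') = (r * (S.σ b k * S.h b)) • S.y a := by
    rw [← mul_assoc, e1, S.smul_mul, mul_assoc, f5, smul_smul]
  have n1 : S.x a - S.x b + 1 / 2 ≠ 0 := S.half_ne a b
  have n2 : S.x a - S.x a' - 1 ≠ 0 := S.sub_one_ne a a'
  have n3 : S.x a + S.x a' + 1 / 2 ≠ 0 := by
    simpa using S.x_add_ne a a' (1 / 2) h2 (by norm_num)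
  have n4 : S.x a + S.x b - 1 ≠ 0 := by
    have := S.x_add_ne a b (-1) h4 (by norm_num)
    push_cast at this; rwa [← sub_eq_add_neg] at this
  have k5 : S.σ b (S.x a') = -S.x b := S.σ_x_neg' a'
  have k6 : S.σ a' (S.x b) = -S.x a' := S.σ_x_neg a'
  simp only [S.cubic_eq, S.t_mul₃, k1, k2, k3, k4, k5, k6, f1, f2, f3, f4, f5, f6, map_neg]
  match_scalars
  have i1 : ∀ d s : K, d ≠ 0 → s ≠ 0 → (1 + (d + 2) / d) * ((s - 1) / s) - 2
      = 2 * (s - d - 1) / (d * s) := by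
    intro d s h1 h2; field_simp; ring
  have i2 : ∀ d s : K, d ≠ 0 → s ≠ 0 → 1 + (s + 2) / s - 2 * ((d - 1) / d * ((s + 2) / s))
      = 2 * (s + 2 - d) / (d * s) := by
    intro d s h1 h2; field_simp; ring
  have j1 := i1 _ _ n2 n3
  have j2 := i2 _ _ n1 n4
  rw [s1, s2, hr, hk, show S.x a + S.x a' - 1 / 2 = S.x a + S.x a' + 1 / 2 - 1 by ring,
    show S.x a - S.x a' + 1 = S.x a - S.x a' - 1 + 2 by ring,
    show S.x a - S.x b - 1 / 2 = S.x a - S.x b + 1 / 2 - 1 by ring,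
    show S.x a + S.x b + 1 = S.x a + S.x b - 1 + 2 by ring,
    show 4 * S.x a' + 1 = 2 * (S.x a + S.x a' + 1 / 2 - (S.x a - S.x a' - 1) - 1) by ring,
    show 4 * S.x b + 1 = 2 * (S.x a + S.x b - 1 + 2 - (S.x a - S.x b + 1 / 2)) by ring]
  simp only [neg_pow (S.x a'), neg_pow (S.x b), mul_div_assoc] at j1 j2 ⊢
  linear_combination (S.x a ^ p * (-1) ^ m * S.x a' ^ (q + m) * S.h a') * j1
    + (S.x a ^ p * (-1) ^ q * S.x b ^ (q + m) * S.h b) * j2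

/-- The contribution of `a`, `a` and `neg a`. -/
theorem cubic_self_neg {a : P} (p q m : ℕ) (h : a ≠ S.neg a) (hx : S.x (S.neg a) = -S.x a - 1) :
    S.cubic a a (S.neg a) p q m =
      ((S.x a ^ p * (S.x a - 1) ^ q + S.x a ^ q * (S.x a - 1) ^ p) * (1 - S.x a) ^ m
          * S.σ a (S.h a)
        - 4 * (S.x a ^ (p + q) * (-S.x a) ^ m * S.h a)
        + S.x (S.neg a) ^ m * ((S.x a + 1) ^ p * S.x a ^ q + (S.x a + 1) ^ q * S.x a ^ p)
          * S.h (S.neg a)) • S.y a := by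
  have f1 : S.y a * (S.y a * S.y (S.neg a)) = S.σ a (S.h a) • S.y a := by
    rw [S.y_neg, S.y_mul, mul_one]
  have f2 : S.y a * (S.y (S.neg a) * S.y a) = S.h a • S.y a := by
    rw [← mul_assoc, S.y_neg, S.smul_one_mul]
  have f3 : S.y (S.neg a) * (S.y a * S.y a) = S.h (S.neg a) • S.y a := by
    rw [← mul_assoc, S.y_neg', S.smul_one_mul]
  have k1 := S.σ_x_self _ h
  simp only [S.cubic_eq, S.t_mul₃, k1, f1, f2, f3, S.σ_x_neg, S.σ_x_neg', map_neg, map_sub, map_one]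
  match_scalars
  rw [hx]
  ring

end ShiftSystem

end

section

namespace ShiftSystem

/-- A double sum over a swap-antisymmetric summand vanishes. -/
theorem sum_eq_zero_of_antisymm (K : Type*) {R P : Type*} [Field K] [CharZero K] [Ring R]
    [Module K R] (s : Finset P) (G : P → P → R)
    (h : ∀ a ∈ s, ∀ b ∈ s, G a b + G b a = 0) : ∑ a ∈ s, ∑ b ∈ s, G a b = 0 := by
  have h1 : ∑ a ∈ s, ∑ b ∈ s, G a b + ∑ a ∈ s, ∑ b ∈ s, G a b = 0 := by
    conv_lhs => arg 2; rw [Finset.sum_comm]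
    rw [← Finset.sum_add_distrib]
    refine Finset.sum_eq_zero fun a ha => ?_
    rw [← Finset.sum_add_distrib]
    exact Finset.sum_eq_zero fun b hb => h a ha b hb
  have h2 : (2 : K) • ∑ a ∈ s, ∑ b ∈ s, G a b = 0 := by rw [two_smul, h1]
  have := congrArg (fun z => (2⁻¹ : K) • z) h2
  simpa [smul_smul] using this

variable {I P K R : Type*} [Field K] [Ring R] [Module K R] (S : ShiftSystem I P K R)
variable [Fintype P]

/-- The generator `B_i^{(p+1)}`. -/
def B (i : I) (p : ℕ) : R := -∑ a with S.nd a = i, S.t a p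

theorem acomm_sum {ι κ : Type*} (s : Finset ι) (s' : Finset κ) (f : ι → R) (g : κ → R) :
    acomm (∑ a ∈ s, f a) (∑ b ∈ s', g b) = ∑ a ∈ s, ∑ b ∈ s', acomm (f a) (g b) := by
  simp only [acomm, Finset.sum_mul_sum, Finset.sum_add_distrib]
  rw [Finset.sum_comm (f := fun a b => g b * f a)]

theorem lie_sum_sum {ι κ : Type*} (s : Finset ι) (s' : Finset κ) (f : ι → R) (g : κ → R) :
    ⁅∑ a ∈ s, f a, ∑ b ∈ s', g b⁆ = ∑ a ∈ s, ∑ b ∈ s', ⁅f a, g b⁆ := by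
  simp only [Ring.lie_def, Finset.sum_mul_sum, Finset.sum_sub_distrib]
  rw [Finset.sum_comm (f := fun a b => g b * f a)]

theorem acomm_neg_neg (a b : R) : acomm (-a) (-b) = acomm a b := by simp [acomm]

theorem lie_neg_neg (a b : R) : ⁅-a, -b⁆ = ⁅a, b⁆ := by simp [Ring.lie_def]

theorem neg_lie_ring (a b : R) : ⁅-a, b⁆ = -⁅a, b⁆ := by
  simp only [Ring.lie_def]; noncomm_ring

theorem quad_sum (i j : I) (p q : ℕ) :
    ⁅S.B i (p + 1), S.B j q⁆ - ⁅S.B i p, S.B j (q + 1)⁆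
      - ((S.c i j : K) / 2) • acomm (S.B i p) (S.B j q) =
    ∑ a with S.nd a = i, ∑ b with S.nd b = j, S.quad i j a b p q := by
  simp only [B, lie_neg_neg, acomm_neg_neg, acomm_sum, lie_sum_sum, quad, Finset.smul_sum,
    Finset.sum_sub_distrib]

theorem serre_sum (i j : I) (p q m : ℕ) :
    ⁅S.B i p, ⁅S.B i q, S.B j m⁆⁆ + ⁅S.B i q, ⁅S.B i p, S.B j m⁆⁆ =
    -∑ a with S.nd a = i, ∑ a' with S.nd a' = i, ∑ b with S.nd b = j, S.cubic a a' b p q m := by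
  have h : ∀ p q, ⁅S.B i p, ⁅S.B i q, S.B j m⁆⁆ = -∑ a with S.nd a = i,
      ∑ a' with S.nd a' = i, ∑ b with S.nd b = j, ⁅S.t a p, ⁅S.t a' q, S.t b m⁆⁆ := by
    intro p q
    rw [B, B, B, lie_neg_neg, lie_sum_sum, neg_lie_ring, lie_sum_sum]
    congr 1
    refine Finset.sum_congr rfl fun a _ => Finset.sum_congr rfl fun b _ => ?_
    simp only [Ring.lie_def, ← Finset.sum_sub_distrib, Finset.mul_sum, Finset.sum_mul]
  rw [h, h, Finset.sum_comm (f := fun a a' => ∑ b with S.nd b = j, ⁅S.t a q, ⁅S.t a' p, S.t b m⁆⁆)]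
  simp only [cubic, Finset.sum_add_distrib]
  rw [neg_add]

variable [CharZero K]

/-- The polar part of `H_i`: the residue at the pole `x a`. -/
def res (a : P) : K := -((S.x a - (S.c (S.nd a) (S.τ (S.nd a)) : K) / 4) * S.h a)

theorem sum_neg (i : I) (hτ : S.τ (S.τ i) = i) (f : P → K) :
    ∑ a with S.nd a = i, f (S.neg a) = ∑ b with S.nd b = S.τ i, f b := by
  refine Finset.sum_nbij' S.neg S.neg ?_ ?_ ?_ ?_ ?_ <;> simp [S.nd_neg, S.neg_neg]
  · intro a h; rw [h]
  · intro a h; rw [h, hτ]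

/-- The quadratic relation between the `B_i`. -/
theorem quad_rel (hτ : ∀ i, S.τ (S.τ i) = i) (i j : I) (p q : ℕ) (f : K)
    (hf : S.τ i = j → f = ∑ a with S.nd a = j, S.res a * S.x a ^ (p + q)
      + ∑ a with S.nd a = i, S.res a * (-S.x a) ^ (p + q)) :
    ⁅S.B i (p + 1), S.B j q⁆ - ⁅S.B i p, S.B j (q + 1)⁆ =
      ((S.c i j : K) / 2) • acomm (S.B i p) (S.B j q)
      + (if S.τ i = j then (2 * (-1) ^ (p + 1) * f) • (1 : R) else 0) := by
  rw [← sub_eq_iff_eq_add', quad_sum]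
  have h1 : ∀ a, S.nd a = i → ∑ b with S.nd b = j, S.quad i j a b p q =
      if S.τ i = j then S.quad i j a (S.neg a) p q else 0 := by
    rintro a rfl
    split_ifs with h
    · rw [Finset.sum_eq_single (S.neg a)]
      · rintro b hb hne
        simp only [Finset.mem_filter, Finset.mem_univ, true_and] at hb
        subst hb; exact S.quad_of_ne a b p q hne
      · intro hb; exfalso; apply hb; simp [S.nd_neg, h]
    · refine Finset.sum_eq_zero fun b hb => ?_
      simp only [Finset.mem_filter, Finset.mem_univ, true_and] at hb
      subst hb; exact S.quad_of_ne a b p q (by rintro rfl; exact h (S.nd_neg a).symm)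
  rw [Finset.sum_congr rfl fun a ha => h1 a (by simpa using ha)]
  split_ifs with h
  · subst h
    rw [hf rfl]
    simp only [S.quad_neg, ← Finset.sum_smul]
    congr 1
    rw [Finset.sum_add_distrib, S.sum_neg i (hτ i) (fun b => (-1) ^ p * S.x b ^ (p + q) *
      (2 * S.x b - (S.c i (S.τ i) : K) / 2) * S.h b), mul_add, Finset.mul_sum, Finset.mul_sum,
      add_comm]
    congr 1
    · refine Finset.sum_congr rfl fun a ha => ?_
      simp only [Finset.mem_filter, Finset.mem_univ, true_and] at ha
      rw [res, ha, hτ, S.c_symm]; ring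
    · refine Finset.sum_congr rfl fun a ha => ?_
      simp only [Finset.mem_filter, Finset.mem_univ, true_and] at ha
      rw [res, ha, neg_pow]
      have : ((-1 : K)) ^ (p + 1) * (-1) ^ (p + q) = - (-1) ^ q := by
        rw [← pow_add, show p + 1 + (p + q) = 2 * p + (q + 1) by ring, pow_add, pow_mul]; simp
        rw [pow_succ]; ring
      linear_combination (2 * (S.x a - (S.c i (S.τ i) : K) / 4) * S.h a * S.x a ^ (p + q)) * this
  · simp

/-- The commutation relation between the `B_i` at nonadjacent nodes. -/
theorem comm_rel (hτ : ∀ i, S.τ (S.τ i) = i) (i j : I) (p q : ℕ) (f : K) (hc : S.c i j = 0)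
    (hf : S.τ i = j → f = -∑ a with S.nd a = j, S.h a * S.x a ^ (p + q)
      + ∑ a with S.nd a = i, S.h a * (-S.x a) ^ (p + q)) :
    ⁅S.B i p, S.B j q⁆ = (if S.τ i = j then ((-1) ^ p * f) • (1 : R) else 0) := by
  rw [B, B, lie_neg_neg, lie_sum_sum]
  have h0 : ∀ a b, S.nd a = i → S.nd b = j → b ≠ S.neg a → ⁅S.t a p, S.t b q⁆ = 0 := by
    rintro a b rfl rfl h
    have hab : b ≠ a := by rintro rfl; rw [S.c_self] at hc; norm_num at hc
    rw [Ring.lie_def, S.t_mul, S.t_mul, S.σ_x a b hab h, S.σ_x b a (Ne.symm hab) (S.ne_neg_symm h),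
      S.exch_zero a b hab h hc, mul_comm, sub_self]
  have h1 : ∀ a, S.nd a = i → ∑ b with S.nd b = j, ⁅S.t a p, S.t b q⁆ =
      if S.τ i = j then ⁅S.t a p, S.t (S.neg a) q⁆ else 0 := by
    rintro a rfl
    split_ifs with h
    · rw [Finset.sum_eq_single (S.neg a)]
      · rintro b hb hne
        exact h0 a b rfl (by simpa using hb) hne
      · intro hb; exfalso; apply hb; simp [S.nd_neg, h]
    · refine Finset.sum_eq_zero fun b hb => ?_
      refine h0 a b rfl (by simpa using hb) ?_
      rintro rfl
      simp only [Finset.mem_filter, Finset.mem_univ, true_and] at hb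
      exact h (by rw [← S.nd_neg, hb])
  rw [Finset.sum_congr rfl fun a ha => h1 a (by simpa using ha)]
  split_ifs with h
  · subst h
    rw [hf rfl]
    have h2 : ∀ a, ⁅S.t a p, S.t (S.neg a) q⁆ = ((-1) ^ q * S.x a ^ (p + q) * S.h a
        - (-1) ^ p * S.x (S.neg a) ^ (p + q) * S.h (S.neg a)) • (1 : R) := by
      intro a
      simp only [Ring.lie_def, S.t_mul, S.y_neg, S.y_neg', S.σ_x_neg, S.σ_x_neg']
      match_scalars
      rw [neg_pow, neg_pow (S.x (S.neg a))]; ring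
    simp only [h2, ← Finset.sum_smul]
    congr 1
    rw [Finset.sum_sub_distrib, S.sum_neg i (hτ i) (fun b => (-1) ^ p * S.x b ^ (p + q) * S.h b),
      mul_add, Finset.mul_sum, mul_neg, Finset.mul_sum, neg_add_eq_sub]
    congr 1
    · refine Finset.sum_congr rfl fun a ha => ?_
      rw [neg_pow]
      have : ((-1 : K)) ^ p * (-1) ^ (p + q) = (-1) ^ q := by
        rw [← pow_add, show p + (p + q) = 2 * p + q by ring, pow_add, pow_mul]; simp
      linear_combination -(S.h a * S.x a ^ (p + q)) * this
    · refine Finset.sum_congr rfl fun a ha => by ring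
  · simp

/-- The Serre relation for two nodes that are not `τ`-related. -/
theorem serre_rel (i j : I) (p q m : ℕ) (hc : S.c i j = -1) (hi : S.τ i ≠ i)
    (hj : S.τ i ≠ j) :
    ⁅S.B i p, ⁅S.B i q, S.B j m⁆⁆ + ⁅S.B i q, ⁅S.B i p, S.B j m⁆⁆ = 0 := by
  rw [serre_sum, neg_eq_zero]
  refine sum_eq_zero_of_antisymm K _ _ fun a ha a' ha' => ?_
  rw [← Finset.sum_add_distrib]
  refine Finset.sum_eq_zero fun b hb => ?_
  simp only [Finset.mem_filter, Finset.mem_univ, true_and] at ha ha' hb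
  have hij : i ≠ j := by rintro rfl; rw [S.c_self] at hc; norm_num at hc
  have key : ∀ a, S.nd a = i → b ≠ a ∧ b ≠ S.neg a := by
    rintro a rfl
    exact ⟨fun h => hij (by rw [← h, hb]), fun h => hj (by rw [← S.nd_neg, ← h, hb])⟩
  have hneg : a' ≠ S.neg a := fun h => hi (by rw [← ha, ← S.nd_neg, ← h, ha', ha])
  by_cases h : a' = a
  · subst h
    rw [S.cubic_self p q m hneg (key _ ha).1 (key _ ha).2 (by rw [ha, hb, hc]), add_zero]
  · exact S.cubic_add_swap p q m h hneg (key _ ha).1 (key _ ha).2 (key _ ha').1 (key _ ha').2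
      (by rw [ha, ha']) (by rw [ha, hb, hc])

/-- The left-hand side of the Serre relation at a `τ`-fixed node. -/
theorem serre_fixed (i j : I) (p q m : ℕ) (hc : S.c i j = -1) (hi : S.τ i = i) :
    ⁅S.B i p, ⁅S.B i q, S.B j m⁆⁆ + ⁅S.B i q, ⁅S.B i p, S.B j m⁆⁆ =
      -∑ b with S.nd b = j, (S.x b ^ m * (∑ a with S.nd a = i, ((-1) ^ p + (-1) ^ q) *
        S.x a ^ (p + q) * S.h a * (1 - 2 * S.x a) / ((S.x b + 1 / 2) ^ 2 - S.x a ^ 2))) • S.y b := by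
  rw [serre_sum, neg_inj]
  have hij : i ≠ j := by rintro rfl; rw [S.c_self] at hc; norm_num at hc
  simp only [Finset.sum_comm (s := Finset.univ.filter fun a' => S.nd a' = i)
    (t := Finset.univ.filter fun b => S.nd b = j)]
  refine Finset.sum_congr rfl fun b hb => ?_
  simp only [Finset.mem_filter, Finset.mem_univ, true_and] at hb
  have key : ∀ a, S.nd a = i → b ≠ a ∧ b ≠ S.neg a := by
    rintro a rfl
    exact ⟨fun h => hij (by rw [← h, hb]),
      fun h => hij (by rw [← hi, ← S.nd_neg, ← h, hb])⟩
  have hneg : ∀ a, S.nd a = i → S.nd (S.neg a) = i := fun a h => by rw [S.nd_neg, h, hi]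
  set G : P → P → R := fun a a' => if a' = S.neg a then 0 else S.cubic a a' b p q m with hG
  have h1 : ∑ a with S.nd a = i, ∑ a' with S.nd a' = i, G a a' = 0 := by
    refine sum_eq_zero_of_antisymm K _ _ fun a ha a' ha' => ?_
    simp only [Finset.mem_filter, Finset.mem_univ, true_and] at ha ha'
    by_cases h : a' = S.neg a
    · have h' : a = S.neg a' := by rw [h, S.neg_neg]
      simp only [hG]; rw [if_pos h, if_pos h', add_zero]
    · have h' : a ≠ S.neg a' := S.ne_neg_symm h
      simp only [hG]; rw [if_neg h, if_neg h']
      by_cases e : a' = a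
      · subst e
        rw [S.cubic_self p q m h (key _ ha).1 (key _ ha).2 (by rw [ha, hb, hc]), add_zero]
      · exact S.cubic_add_swap p q m e h (key _ ha).1 (key _ ha).2 (key _ ha').1 (key _ ha').2
          (by rw [ha, ha']) (by rw [ha, hb, hc])
  have h2 : ∑ a with S.nd a = i, ∑ a' with S.nd a' = i, S.cubic a a' b p q m =
      ∑ a with S.nd a = i, S.cubic a (S.neg a) b p q m := by
    rw [← sub_zero (∑ a with S.nd a = i, ∑ a' with S.nd a' = i, S.cubic a a' b p q m), ← h1,
      ← Finset.sum_sub_distrib]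
    refine Finset.sum_congr rfl fun a ha => ?_
    simp only [Finset.mem_filter, Finset.mem_univ, true_and] at ha
    rw [← Finset.sum_sub_distrib, Finset.sum_eq_single (S.neg a)]
    · simp [hG]
    · intro a' _ h; simp [hG, h]
    · intro h; exfalso; apply h; simp [hneg a ha]
  rw [h2, Finset.sum_congr rfl fun a ha => S.cubic_neg p q m (key a (by simpa using ha)).1
    (key a (by simpa using ha)).2 (by rw [hb, show S.nd a = i by simpa using ha, hc])
    (by rw [show S.nd a = i by simpa using ha, hi]), ← Finset.sum_smul, ← Finset.mul_sum,
    Finset.sum_add_distrib]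
  have h3 := S.sum_neg i (by rw [hi, hi]) (fun a => (-1) ^ p * S.x a ^ (p + q) * S.h a *
    (1 - 2 * S.x a) / ((S.x b + 1 / 2) ^ 2 - S.x a ^ 2))
  rw [hi] at h3
  rw [h3, ← Finset.sum_add_distrib]
  congr 2
  refine Finset.sum_congr rfl fun a _ => ?_
  ring

theorem smul_one_lie_B (j : I) (p : ℕ) (f : K) :
    ⁅f • (1 : R), S.B j p⁆ = -∑ a with S.nd a = j, (S.x a ^ p * (f - S.σ a f)) • S.y a := by
  rw [Ring.lie_def, B, mul_neg, neg_mul, sub_neg_eq_add, neg_add_eq_sub, Finset.mul_sum,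
    Finset.sum_mul, ← Finset.sum_sub_distrib, ← Finset.sum_neg_distrib]
  refine Finset.sum_congr rfl fun a _ => ?_
  rw [S.smul_one_mul, t, S.smul_mul, S.y_mul, mul_one]
  module

theorem B_lie_smul_one (j : I) (p : ℕ) (f : K) :
    ⁅S.B j p, f • (1 : R)⁆ = -∑ a with S.nd a = j, (S.x a ^ p * (S.σ a f - f)) • S.y a := by
  have h := S.smul_one_lie_B j p f
  rw [Ring.lie_def] at h ⊢
  rw [← neg_sub, h, ← Finset.sum_neg_distrib, ← Finset.sum_neg_distrib, ← Finset.sum_neg_distrib]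
  refine Finset.sum_congr rfl fun a _ => ?_
  module

theorem acomm_smul_one_B (j : I) (p : ℕ) (f : K) :
    acomm (f • (1 : R)) (S.B j p) =
      -∑ a with S.nd a = j, (S.x a ^ p * (f + S.σ a f)) • S.y a := by
  rw [acomm, B, mul_neg, neg_mul, ← neg_add, Finset.mul_sum,
    Finset.sum_mul, ← Finset.sum_add_distrib]
  congr 1
  refine Finset.sum_congr rfl fun a _ => ?_
  rw [S.smul_one_mul, t, S.smul_mul, S.y_mul, mul_one]
  module

/-- The relation between a multiplication operator and the `B_j`. -/
theorem cartan_rel (j : I) (p : ℕ) (f : ℤ → K) (r : ℤ) (d₁ d₂ d₃ : K)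
    (hf : ∀ a, S.nd a = j → f (r + 2) - S.σ a (f (r + 2)) - S.x a ^ 2 * (f r - S.σ a (f r)) =
      d₁ * (f (r + 1) + S.σ a (f (r + 1))) + d₂ * S.x a * (f r + S.σ a (f r))
        + d₃ * (f r - S.σ a (f r))) :
    ⁅f (r + 2) • (1 : R), S.B j p⁆ - ⁅f r • (1 : R), S.B j (p + 2)⁆ =
      d₁ • acomm (f (r + 1) • (1 : R)) (S.B j p) + d₂ • acomm (f r • (1 : R)) (S.B j (p + 1))
      + d₃ • ⁅f r • (1 : R), S.B j p⁆ := by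
  simp only [S.smul_one_lie_B, S.acomm_smul_one_B, smul_neg, Finset.smul_sum,
    ← Finset.sum_neg_distrib, ← Finset.sum_add_distrib, ← Finset.sum_sub_distrib]
  refine Finset.sum_congr rfl fun a ha => ?_
  have := hf a (by simpa using ha)
  match_scalars
  linear_combination -(S.x a ^ p) * this

theorem telescope (g : ℕ → K) (c : K) (N : ℕ) :
    ∑ k ∈ Finset.range N, c ^ k * (g k - c * g (k + 1)) = g 0 - c ^ N * g N := by
  induction N with
  | zero => simp
  | succ N ih => rw [Finset.sum_range_succ, ih, pow_succ]; ring

/-- The right-hand side of the Serre relation at a `τ`-fixed node, for `s = 1`. -/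
theorem split_bracket_one (j : I) (f : ℤ → K) (g : P → ℤ → K) (r : ℤ) (N : ℕ)
    (hf : ∀ b, S.nd b = j → ∀ n, S.x b * (f n - S.σ b (f n)) - (f n + S.σ b (f n)) =
      -2 * (g b (n + 2) - g b n / 4))
    (hg : ∀ b, S.nd b = j → g b (r - 2 * N) = 0) :
    ∑ k ∈ Finset.range N, ((1 / 4 : K) ^ k) •
      (⁅f (r - 2 * k - 2) • (1 : R), S.B j 1⁆ - acomm (f (r - 2 * k - 2) • (1 : R)) (S.B j 0)) =
    ∑ b with S.nd b = j, (2 * g b r) • S.y b := by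
  simp only [S.smul_one_lie_B, S.acomm_smul_one_B, ← Finset.sum_neg_distrib,
    ← Finset.sum_sub_distrib, Finset.smul_sum]
  rw [Finset.sum_comm]
  refine Finset.sum_congr rfl fun b hb => ?_
  have hb' : S.nd b = j := by simpa using hb
  have := telescope (fun k : ℕ => 2 * g b (r - 2 * k)) (1 / 4) N
  simp only [hg b hb', Nat.cast_zero, mul_zero, sub_zero] at this
  rw [← this, Finset.sum_smul]
  refine Finset.sum_congr rfl fun k _ => ?_
  have h := hf b hb' (r - 2 * k - 2)
  rw [show r - 2 * (k : ℤ) - 2 + 2 = r - 2 * k by ring] at h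
  rw [show r - 2 * ((k + 1 : ℕ) : ℤ) = r - 2 * k - 2 by push_cast; ring]
  match_scalars
  linear_combination -((1 / 4 : K) ^ k) * h

/-- The right-hand side of the Serre relation at a `τ`-fixed node, for `s ≥ 2`. -/
theorem split_bracket_succ (j : I) (f : K) (g : P → K) (m : ℕ)
    (hf : ∀ b, S.nd b = j → f - S.σ b f = -2 * S.x b * g b) :
    ⁅f • (1 : R), S.B j m⁆ = ∑ b with S.nd b = j, (2 * S.x b ^ (m + 1) * g b) • S.y b := by
  rw [S.smul_one_lie_B, ← Finset.sum_neg_distrib]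
  refine Finset.sum_congr rfl fun b hb => ?_
  rw [hf b (by simpa using hb)]
  match_scalars; ring

/-- The right-hand side of the Serre relation for adjacent `i` and `τ i`. -/
theorem aiii_bracket (i : I) (f : ℤ → K) (g : P → ℤ → K) (r : ℤ) (q N : ℕ)
    (hf : ∀ a, S.nd a = i → ∀ n, S.σ a (f n) - f n = 3 * g a n - S.x a * g a (n - 1))
    (hg : ∀ a, S.nd a = i → g a (r - N) = 0) :
    ∑ k ∈ Finset.range N, ((3 : K) ^ (k + 1))⁻¹ • ⁅S.B i (q + k), f (r - k) • (1 : R)⁆ =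
    -∑ a with S.nd a = i, (S.x a ^ q * g a r) • S.y a := by
  simp only [S.B_lie_smul_one, ← Finset.sum_neg_distrib, Finset.smul_sum]
  rw [Finset.sum_comm]
  refine Finset.sum_congr rfl fun a ha => ?_
  have ha' : S.nd a = i := by simpa using ha
  have := telescope (fun k : ℕ => g a (r - k)) (S.x a / 3) N
  simp only [hg a ha', Nat.cast_zero, mul_zero, sub_zero] at this
  rw [← this, Finset.mul_sum, Finset.sum_smul, ← Finset.sum_neg_distrib]
  refine Finset.sum_congr rfl fun k _ => ?_
  rw [hf a ha', show r - ((k + 1 : ℕ) : ℤ) = r - k - 1 by push_cast; ring, div_pow]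
  match_scalars
  field_simp
  ring

/-- The coefficient of `y a` in the Serre relation for adjacent `i` and `τ i`. -/
def aiiiCoeff (i : I) (a : P) (n : ℕ) : K :=
  ∑ a' with S.nd a' = i ∧ a' ≠ a,
      (S.res (S.neg a') * S.x (S.neg a') ^ n
          / ((S.x (S.neg a') - S.x a - 1 / 2) * (S.x (S.neg a') + S.x a - 1))
        + S.res a' * (-S.x a') ^ n / ((-S.x a' - S.x a - 1 / 2) * (-S.x a' + S.x a - 1)))
    + S.h (S.neg a) * S.x (S.neg a) ^ n / 4 - S.h a * (-S.x a) ^ n / 2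
    + S.σ a (S.h a) * (1 - S.x a) ^ n / 4

theorem aiii_sum (i : I) (hττ : S.τ (S.τ i) = i) (hτ : S.τ i ≠ i) (hc : S.c i (S.τ i) = -1)
    (hx : ∀ a, S.nd a = i → S.x (S.neg a) = -S.x a - 1) (p q m : ℕ) (g : P → ℕ → K)
    (hg : ∀ a, S.nd a = i → ∀ n, g a n = S.aiiiCoeff i a n) :
    ⁅S.B i p, ⁅S.B i q, S.B (S.τ i) m⁆⁆ + ⁅S.B i q, ⁅S.B i p, S.B (S.τ i) m⁆⁆ =
      -∑ a with S.nd a = i, (4 * ((-1) ^ p * S.x a ^ q * g a (p + m)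
        + (-1) ^ q * S.x a ^ p * g a (q + m))) • S.y a := by
  rw [serre_sum, neg_inj]
  have hnn : ∀ a, S.nd a = i → S.nd (S.neg a) = S.τ i := fun a h => by rw [S.nd_neg, h]
  have hne : ∀ a b, S.nd a = i → S.nd b = i → a ≠ S.neg b := fun a b ha hb h => hτ (by
    rw [← hnn b hb, ← h, ha])
  set G : P → P → R := fun a a' => ∑ b with S.nd b = S.τ i ∧ b ≠ S.neg a ∧ b ≠ S.neg a',
    S.cubic a a' b p q m with hG
  have h1 : ∑ a with S.nd a = i, ∑ a' with S.nd a' = i, G a a' = 0 := by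
    refine sum_eq_zero_of_antisymm K _ _ fun a ha a' ha' => ?_
    simp only [Finset.mem_filter, Finset.mem_univ, true_and] at ha ha'
    have : G a' a = ∑ b with S.nd b = S.τ i ∧ b ≠ S.neg a ∧ b ≠ S.neg a',
        S.cubic a' a b p q m := by
      rw [hG]; refine Finset.sum_congr ?_ fun _ _ => rfl
      ext b; simp only [Finset.mem_filter]; tauto
    rw [this, ← Finset.sum_add_distrib]
    refine Finset.sum_eq_zero fun b hb => ?_
    simp only [Finset.mem_filter, Finset.mem_univ, true_and] at hb
    obtain ⟨hb, hb1, hb2⟩ := hb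
    have e1 : b ≠ a := fun h => hτ (by rw [← hb, h, ha])
    have e2 : b ≠ a' := fun h => hτ (by rw [← hb, h, ha'])
    by_cases h : a' = a
    · subst h
      rw [S.cubic_self p q m (hne _ _ ha ha) e1 hb1 (by rw [ha, hb, hc]), add_zero]
    · exact S.cubic_add_swap p q m h (hne _ _ ha' ha) e1 hb1 e2 hb2 (by rw [ha, ha'])
        (by rw [ha, hb, hc])
  have h2 : ∀ a a', S.nd a = i → S.nd a' = i → ∑ b with S.nd b = S.τ i, S.cubic a a' b p q m =
      G a a' + (S.cubic a a' (S.neg a') p q m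
        + if a' = a then 0 else S.cubic a' a (S.neg a) q p m) := by
    intro a a' ha ha'
    have e : (Finset.univ.filter fun b => S.nd b = S.τ i) =
        (Finset.univ.filter fun b => S.nd b = S.τ i ∧ b ≠ S.neg a ∧ b ≠ S.neg a')
          ∪ {S.neg a, S.neg a'} := by
      ext b
      simp only [Finset.mem_filter, Finset.mem_univ, true_and, Finset.mem_union,
        Finset.mem_insert, Finset.mem_singleton]
      constructor
      · intro h; tauto
      · rintro (h | rfl | rfl)
        exacts [h.1, hnn _ ha, hnn _ ha']
    rw [e, Finset.sum_union]
    · congr 1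
      by_cases h : a' = a
      · subst h; simp
      · rw [if_neg h, Finset.sum_pair (fun h' => h (S.neg_injective h').symm), add_comm,
          S.cubic_swap a' a]
    · rw [Finset.disjoint_left]
      intro b hb; simp only [Finset.mem_filter] at hb; simp; tauto
  have h3 : ∑ a with S.nd a = i, ∑ a' with S.nd a' = i, ∑ b with S.nd b = S.τ i,
      S.cubic a a' b p q m = ∑ a with S.nd a = i, ((S.cubic a a (S.neg a) p q m)
        + ∑ a' with S.nd a' = i ∧ a' ≠ a, (S.cubic a a' (S.neg a') p q m
          + S.cubic a a' (S.neg a') q p m)) := by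
    have : ∀ (F : P → P → R), ∑ a with S.nd a = i, ∑ a' with S.nd a' = i, F a a' =
        ∑ a with S.nd a = i, (F a a + ∑ a' with S.nd a' = i ∧ a' ≠ a, F a a') := by
      intro F
      refine Finset.sum_congr rfl fun a ha => ?_
      rw [← Finset.add_sum_erase _ _ ha]
      congr 2
      ext b; simp only [Finset.mem_erase, Finset.mem_filter]; tauto
    have e0 : ∑ a with S.nd a = i, ∑ a' with S.nd a' = i, ∑ b with S.nd b = S.τ i,
      S.cubic a a' b p q m = ∑ a with S.nd a = i, ∑ a' with S.nd a' = i,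
        (G a a' + (S.cubic a a' (S.neg a') p q m
        + if a' = a then 0 else S.cubic a' a (S.neg a) q p m)) :=
      Finset.sum_congr rfl fun a ha => Finset.sum_congr rfl fun a' ha' =>
        h2 a a' (by simpa using ha) (by simpa using ha')
    have e1 : ∑ a with S.nd a = i, ∑ a' with S.nd a' = i,
        (if a' = a then 0 else S.cubic a' a (S.neg a) q p m) =
        ∑ a with S.nd a = i, ∑ a' with S.nd a' = i,
        (if a' = a then 0 else S.cubic a a' (S.neg a') q p m) := by
      rw [Finset.sum_comm]
      simp only [eq_comm]
    rw [e0]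
    simp only [Finset.sum_add_distrib]
    rw [h1, e1, zero_add, this, this (fun a a' => if a' = a then 0 else _)]
    simp only [Finset.sum_add_distrib, if_true, zero_add, add_assoc]
    congr 2
    refine Finset.sum_congr rfl fun a _ => Finset.sum_congr rfl fun a' ha' => ?_
    rw [if_neg (by simp only [Finset.mem_filter] at ha'; exact ha'.2.2)]
  rw [h3]
  refine Finset.sum_congr rfl fun a ha => ?_
  have ha : S.nd a = i := by simpa using ha
  rw [S.cubic_self_neg p q m (hne a a ha ha) (hx a ha)]
  have h4 : ∀ p q, ∀ a' ∈ Finset.univ.filter (fun a' => S.nd a' = i ∧ a' ≠ a),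
      S.cubic a a' (S.neg a') p q m = (4 * (-1) ^ q * S.x a ^ p * 
        (S.res (S.neg a') * S.x (S.neg a') ^ (q + m)
            / ((S.x (S.neg a') - S.x a - 1 / 2) * (S.x (S.neg a') + S.x a - 1))
          + S.res a' * (-S.x a') ^ (q + m)
            / ((-S.x a' - S.x a - 1 / 2) * (-S.x a' + S.x a - 1)))) • S.y a := by
    intro p q a' ha'
    simp only [Finset.mem_filter, Finset.mem_univ, true_and] at ha'
    obtain ⟨ha', hne'⟩ := ha'
    rw [S.cubic_neg_right p q m hne' (by rw [ha, ha']) (by rwa [ha]) (by rw [ha, hc])]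
    congr 1
    rw [res, res, ha', hnn _ ha', hττ, S.c_symm (S.τ i), hc, neg_pow (S.x a'),
      show (S.x (S.neg a') - S.x a - 1 / 2) * (S.x (S.neg a') + S.x a - 1) =
        -((S.x a - S.x (S.neg a') + 1 / 2) * (S.x a + S.x (S.neg a') - 1)) by ring,
      show (-S.x a' - S.x a - 1 / 2) * (-S.x a' + S.x a - 1) =
        -((S.x a - S.x a' - 1) * (S.x a + S.x a' + 1 / 2)) by ring, div_neg, div_neg]
    have : ((-1 : K)) ^ q * (-1) ^ (q + m) = (-1) ^ m := by
      rw [← pow_add, show q + (q + m) = 2 * q + m by ring, pow_add, pow_mul]; simp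
    push_cast
    simp only [div_eq_mul_inv]
    linear_combination (-S.x a ^ p * S.x a' ^ (q + m) * S.h a' * (4 * S.x a' + 1)
      * ((S.x a - S.x a' - 1) * (S.x a + S.x a' + 1 * 2⁻¹))⁻¹) * this
  rw [Finset.sum_add_distrib, Finset.sum_congr rfl (h4 p q), Finset.sum_congr rfl (h4 q p),
    ← Finset.sum_smul, ← Finset.sum_smul, ← Finset.mul_sum, ← Finset.mul_sum]
  have g1 := hg a ha (q + m)
  have g2 := hg a ha (p + m)
  rw [aiiiCoeff, hx a ha] at g1 g2
  rw [hx a ha]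
  have r1 : ∀ n : ℕ, (-1 : K) ^ n * (1 - S.x a) ^ n = (S.x a - 1) ^ n := fun n => by
    rw [← mul_pow]; ring
  have r2 : ∀ n : ℕ, (-1 : K) ^ n * (-S.x a) ^ n = (S.x a) ^ n := fun n => by
    rw [← mul_pow]; ring
  have r3 : ∀ n : ℕ, (-1 : K) ^ n * (-S.x a - 1) ^ n = (S.x a + 1) ^ n := fun n => by
    rw [← mul_pow]; ring
  match_scalars
  rw [pow_add, pow_add] at g1 g2
  generalize (∑ a' with S.nd a' = i ∧ a' ≠ a, _ : K) = S1 at g1 ⊢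
  generalize (∑ a' with S.nd a' = i ∧ a' ≠ a, _ : K) = S2 at g2 ⊢
  rw [g1, g2, ← r1, ← r1, ← r3, ← r3]
  linear_combination (2 * S.h a * S.x a ^ q * (-S.x a) ^ m) * r2 p
    + (2 * S.h a * S.x a ^ p * (-S.x a) ^ m) * r2 q

end ShiftSystem

end

section

/-! ### Laurent series in `u⁻¹` -/

section Series

open Polynomial

variable {K : Type*} [Field K]

variable (K) in
/-- The element `u` of `K((u⁻¹))`. -/
def invVar : LaurentSeries K := HahnSeries.single (-1 : ℤ) (1 : K)

theorem coeff_invVar_mul (F : LaurentSeries K) (n : ℤ) :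
    (invVar K * F).coeff n = F.coeff (n + 1) := by
  rw [invVar, HahnSeries.coeff_single_mul]; simp

theorem coeff_C_mul' (c : K) (F : LaurentSeries K) (n : ℤ) :
    (HahnSeries.C c * F).coeff n = c * F.coeff n := by
  rw [HahnSeries.C_apply, HahnSeries.coeff_single_mul]; simp

theorem invVar_ne_zero : invVar K ≠ 0 := by
  rw [invVar, Ne, HahnSeries.single_eq_zero_iff]; exact one_ne_zero

theorem linear_ne_zero (p : K) : invVar K - HahnSeries.C p ≠ 0 := by
  intro h
  have := congrArg (fun F => HahnSeries.coeff F (-1)) h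
  simp [invVar, HahnSeries.C_apply] at this

theorem coeff_inv_linear (p : K) (n : ℤ) : ((invVar K - HahnSeries.C p)⁻¹).coeff n =
    if 1 ≤ n then p ^ (n - 1).toNat else 0 := by
  set G : LaurentSeries K := HahnSeries.single (1 : ℤ) 1 *
    HahnSeries.ofPowerSeries ℤ K (PowerSeries.mk fun n => p ^ n) with hG
  have hc : ∀ n : ℤ, G.coeff n = if 1 ≤ n then p ^ (n - 1).toNat else 0 := by
    intro n
    rw [hG, HahnSeries.coeff_single_mul, one_mul, PowerSeries.coeff_coe]
    by_cases h : 1 ≤ n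
    · rw [if_neg (by omega), if_pos h, PowerSeries.coeff_mk]; congr 1; omega
    · rw [if_pos (by omega), if_neg h]
  have h1 : (invVar K - HahnSeries.C p) * G = 1 := by
    ext n
    rw [sub_mul, HahnSeries.coeff_sub, coeff_invVar_mul, coeff_C_mul', hc, hc, HahnSeries.coeff_one]
    rcases lt_trichotomy n 0 with h | h | h
    · rw [if_neg (by omega), if_neg (by omega), if_neg (by omega)]; simp
    · subst h; simp
    · rw [if_pos (by omega), if_pos (by omega), if_neg (by omega),
        show (n + 1 - 1).toNat = (n - 1).toNat + 1 by omega, pow_succ]; ring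
  rw [inv_eq_of_mul_eq_one_right h1, hc]

theorem coeff_inv_linear_succ (p : K) (n : ℕ) :
    ((invVar K - HahnSeries.C p)⁻¹).coeff ((n : ℤ) + 1) = p ^ n := by
  rw [coeff_inv_linear, if_pos (by omega)]; congr 1; omega

variable (K) in
/-- Evaluation of polynomials at `u`. -/
def evalU : K[X] →+* LaurentSeries K := Polynomial.eval₂RingHom HahnSeries.C (invVar K)

@[simp] theorem evalU_X : evalU K X = invVar K := by simp [evalU]
@[simp] theorem evalU_C (c : K) : evalU K (C c) = HahnSeries.C c := by simp [evalU]

theorem evalU_coeff_succ (Q : K[X]) (n : ℕ) : (evalU K Q).coeff ((n : ℤ) + 1) = 0 := by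
  induction Q using Polynomial.induction_on' with
  | add p q hp hq => rw [map_add, HahnSeries.coeff_add, hp, hq, add_zero]
  | monomial k c =>
    rw [← C_mul_X_pow_eq_monomial, map_mul, evalU_C, map_pow, evalU_X, coeff_C_mul']
    have : ∀ (k : ℕ) (m : ℤ), 1 ≤ m → (invVar K ^ k).coeff m = 0 := by
      intro k
      induction k with
      | zero => intro m hm; rw [pow_zero, HahnSeries.coeff_one, if_neg (by omega)]
      | succ k ih => intro m hm; rw [pow_succ', coeff_invVar_mul, ih _ (by omega)]
    rw [this k _ (by omega), mul_zero]

theorem evalU_prod_ne_zero {ι : Type*} (s : Finset ι) (p : ι → K) :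
    evalU K (∏ k ∈ s, (X - C (p k))) ≠ 0 := by
  rw [map_prod, Finset.prod_ne_zero_iff]
  intro k _
  rw [map_sub, evalU_X, evalU_C]; exact linear_ne_zero _

theorem coeff_sum' {ι : Type*} (s : Finset ι) (F : ι → LaurentSeries K) (n : ℤ) :
    (∑ k ∈ s, F k).coeff n = ∑ k ∈ s, (F k).coeff n := by
  induction s using Finset.induction_on with
  | empty => simp
  | insert a s ha ih => rw [Finset.sum_insert ha, Finset.sum_insert ha, HahnSeries.coeff_add, ih]

/-- Partial fractions: the coefficients of positive index in the expansion at infinity. -/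
theorem coeff_partial_fractions {ι : Type*} (s : Finset ι) (p : ι → K) (hp : Set.InjOn p s)
    (N : K[X]) (n : ℕ) :
    (evalU K N / evalU K (∏ k ∈ s, (X - C (p k)))).coeff ((n : ℤ) + 1) =
      ∑ k ∈ s, N.eval (p k) / (∏ l ∈ s.erase k, (p k - p l)) * p k ^ n := by
  set D : K[X] := ∏ k ∈ s, (X - C (p k)) with hD
  have hDm : D.Monic := monic_prod_of_monic _ _ fun k _ => monic_X_sub_C _
  have hdeg : (N %ₘ D).degree < s.card := by
    have h := degree_modByMonic_lt N hDm
    have : D.degree = s.card := by rw [hD, ← Lagrange.nodal_eq, Lagrange.degree_nodal]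
    rwa [this] at h
  have hR := Lagrange.eq_interpolate hp hdeg
  have hval : ∀ k ∈ s, (N %ₘ D).eval (p k) = N.eval (p k) := by
    intro k hk
    have h0 : D.eval (p k) = 0 := by
      rw [hD, eval_prod]; exact Finset.prod_eq_zero hk (by simp)
    conv_rhs => rw [← modByMonic_add_div N D]
    simp [h0]
  have hN : N = ∑ k ∈ s, C (N.eval (p k)) * Lagrange.basis s p k + D * (N /ₘ D) := by
    conv_lhs => rw [← modByMonic_add_div N D, hR, Lagrange.interpolate_apply]
    rw [Finset.sum_congr rfl fun k hk => by rw [hval k hk]]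
  have hD0 : evalU K D ≠ 0 := evalU_prod_ne_zero s p
  have hb : ∀ k ∈ s, evalU K (Lagrange.basis s p k) / evalU K D =
      HahnSeries.C ((∏ l ∈ s.erase k, (p k - p l))⁻¹) * (invVar K - HahnSeries.C (p k))⁻¹ := by
    intro k hk
    have h1 : Lagrange.basis s p k = C ((∏ l ∈ s.erase k, (p k - p l))⁻¹) *
        ∏ l ∈ s.erase k, (X - C (p l)) := by
      rw [Lagrange.basis, ← Finset.prod_inv_distrib, map_prod, ← Finset.prod_mul_distrib]; rfl
    have h2 : D = (X - C (p k)) * ∏ l ∈ s.erase k, (X - C (p l)) := by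
      exact (Finset.mul_prod_erase s (fun l => X - C (p l)) hk).symm
    have h3 := evalU_prod_ne_zero (s.erase k) p
    have h4 := linear_ne_zero (p k)
    rw [h1, h2, map_mul, map_mul, map_sub, evalU_X, evalU_C, evalU_C]
    field_simp
  have : evalU K N / evalU K D = ∑ k ∈ s, HahnSeries.C (N.eval (p k) *
      (∏ l ∈ s.erase k, (p k - p l))⁻¹) * (invVar K - HahnSeries.C (p k))⁻¹ +
      evalU K (N /ₘ D) := by
    conv_lhs => rw [hN]
    rw [map_add, map_mul, add_div, mul_div_cancel_left₀ _ hD0, map_sum, Finset.sum_div]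
    congr 1
    refine Finset.sum_congr rfl fun k hk => ?_
    rw [map_mul, evalU_C, mul_div_assoc, hb k hk, map_mul, mul_assoc]
  rw [this, HahnSeries.coeff_add, evalU_coeff_succ, add_zero, coeff_sum']
  refine Finset.sum_congr rfl fun k hk => ?_
  rw [coeff_C_mul', coeff_inv_linear_succ, div_eq_mul_inv]

/-- Coefficientwise action of a field endomorphism on Laurent series. -/
def mapSer (σ : K →+* K) : LaurentSeries K →+* LaurentSeries K where
  toFun F := F.map σ
  map_one' := by ext n; simp [HahnSeries.coeff_one, apply_ite σ]
  map_mul' F G := HahnSeries.map_mul (σ : K →ₙ+* K)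
  map_zero' := by ext n; simp
  map_add' F G := by ext n; simp

@[simp] theorem mapSer_coeff (σ : K →+* K) (F : LaurentSeries K) (n : ℤ) :
    (mapSer σ F).coeff n = σ (F.coeff n) := rfl

@[simp] theorem mapSer_invVar (σ : K →+* K) : mapSer σ (invVar K) = invVar K := by
  ext n; rw [mapSer_coeff, invVar, HahnSeries.coeff_single]; split_ifs <;> simp

@[simp] theorem mapSer_C (σ : K →+* K) (c : K) :
    mapSer σ (HahnSeries.C c) = HahnSeries.C (σ c) := by
  ext n; rw [mapSer_coeff, HahnSeries.C_apply, HahnSeries.C_apply, HahnSeries.coeff_single,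
    HahnSeries.coeff_single]; split_ifs <;> simp

/-- `F = u^d + (lower order terms)`. -/
def IsMonicSer (d : ℤ) (F : LaurentSeries K) : Prop :=
  (∀ n < -d, F.coeff n = 0) ∧ F.coeff (-d) = 1

theorem IsMonicSer.ne_zero {d : ℤ} {F : LaurentSeries K} (h : IsMonicSer d F) : F ≠ 0 := by
  rintro rfl; have := h.2; simp at this

theorem IsMonicSer.order_eq {d : ℤ} {F : LaurentSeries K} (h : IsMonicSer d F) :
    F.order = -d := by
  apply le_antisymm
  · exact HahnSeries.order_le_of_coeff_ne_zero (by rw [h.2]; exact one_ne_zero)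
  · by_contra hlt
    exact HahnSeries.coeff_order_eq_zero.not.mpr h.ne_zero (h.1 _ (not_le.mp hlt))

theorem IsMonicSer.mul {d e : ℤ} {F G : LaurentSeries K} (hF : IsMonicSer d F)
    (hG : IsMonicSer e G) : IsMonicSer (d + e) (F * G) := by
  have ho : (F * G).order = -d + -e := by
    rw [HahnSeries.order_mul hF.ne_zero hG.ne_zero, hF.order_eq, hG.order_eq]
  refine ⟨fun n hn => HahnSeries.coeff_eq_zero_of_lt_order (by rw [ho]; omega), ?_⟩
  have := HahnSeries.coeff_mul_order_add_order F G
  rw [HahnSeries.leadingCoeff_eq, HahnSeries.leadingCoeff_eq, hF.order_eq, hG.order_eq, hF.2, hG.2,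
    mul_one] at this
  rwa [neg_add]

theorem isMonicSer_one : IsMonicSer 0 (1 : LaurentSeries K) :=
  ⟨fun n hn => by rw [HahnSeries.coeff_one, if_neg (by omega)], by simp⟩

theorem isMonicSer_linear (p : K) : IsMonicSer 1 (invVar K - HahnSeries.C p) := by
  refine ⟨fun n hn => ?_, ?_⟩ <;>
    rw [HahnSeries.coeff_sub, invVar, HahnSeries.C_apply, HahnSeries.coeff_single,
      HahnSeries.coeff_single]
  · rw [if_neg (by omega), if_neg (by omega), sub_zero]
  · simp

theorem isMonicSer_inv_linear (p : K) : IsMonicSer (-1) (invVar K - HahnSeries.C p)⁻¹ := by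
  refine ⟨fun n hn => ?_, ?_⟩ <;> rw [coeff_inv_linear]
  · rw [if_neg (by omega)]
  · simp

theorem IsMonicSer.prod {ι : Type*} (s : Finset ι) (d : ι → ℤ) (F : ι → LaurentSeries K)
    (h : ∀ k ∈ s, IsMonicSer (d k) (F k)) : IsMonicSer (∑ k ∈ s, d k) (∏ k ∈ s, F k) := by
  induction s using Finset.induction_on with
  | empty => simpa using isMonicSer_one
  | insert a s ha ih =>
    rw [Finset.sum_insert ha, Finset.prod_insert ha]
    exact (h a (by simp)).mul (ih fun k hk => h k (by simp [hk]))

theorem IsMonicSer.pow {d : ℤ} {F : LaurentSeries K} (h : IsMonicSer d F) (n : ℕ) :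
    IsMonicSer (n * d) (F ^ n) := by
  have := IsMonicSer.prod (Finset.range n) (fun _ => d) (fun _ => F) fun _ _ => h
  simpa using this

/-- The series with coefficients in a subring. -/
def serSubring (A : Subring K) : Subring (LaurentSeries K) where
  carrier := {F | ∀ n, F.coeff n ∈ A}
  mul_mem' {F G} hF hG n := by
    rw [HahnSeries.coeff_mul]
    exact Subring.sum_mem _ fun ij _ => A.mul_mem (hF _) (hG _)
  one_mem' n := by
    rw [HahnSeries.coeff_one]; split_ifs
    exacts [A.one_mem, A.zero_mem]
  add_mem' {F G} hF hG n := by rw [HahnSeries.coeff_add]; exact A.add_mem (hF n) (hG n)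
  zero_mem' n := by simp
  neg_mem' {F} hF n := by rw [HahnSeries.coeff_neg]; exact A.neg_mem (hF n)

theorem C_mem_serSubring {A : Subring K} {c : K} (hc : c ∈ A) : HahnSeries.C c ∈ serSubring A := by
  intro n
  rw [HahnSeries.C_apply, HahnSeries.coeff_single]; split_ifs
  exacts [hc, A.zero_mem]

theorem invVar_mem_serSubring {A : Subring K} : invVar K ∈ serSubring A := by
  intro n
  rw [invVar, HahnSeries.coeff_single]; split_ifs
  exacts [A.one_mem, A.zero_mem]

theorem inv_linear_mem_serSubring {A : Subring K} {p : K} (hp : p ∈ A) :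
    (invVar K - HahnSeries.C p)⁻¹ ∈ serSubring A := by
  intro n
  rw [coeff_inv_linear]; split_ifs
  exacts [A.pow_mem hp _, A.zero_mem]

end Series

end

section

/-! ### Difference operators -/

section DiffOp

variable {ζ ω : Type*}

/-- The action of a shift on rational functions. -/
def shift (n : ω → ℤ) : RatField ζ ω →+* RatField ζ ω :=
  MulSemiringAction.toRingHom (Shifts ω) (RatField ζ ω) (Multiplicative.ofAdd n)

theorem shift_algebraMap (n : ω → ℤ) (p : MvPolynomial (ζ ⊕ ω) ℂ) :
    shift n (algebraMap _ (RatField ζ ω) p) = algebraMap _ (RatField ζ ω) (shiftHom n p) :=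
  shifts_smul_algebraMap _ _

theorem shift_const (n : ω → ℤ) (c : ℂ) :
    shift n (algebraMap ℂ (RatField ζ ω) c) = algebraMap ℂ (RatField ζ ω) c := by
  rw [IsScalarTower.algebraMap_apply ℂ (MvPolynomial (ζ ⊕ ω) ℂ) (RatField ζ ω),
    shift_algebraMap, AlgHom.commutes]

theorem shift_zero (f : RatField ζ ω) : shift 0 f = f := one_smul (Shifts ω) f

theorem op_mul (f g : RatField ζ ω) (m n : ω → ℤ) :
    op f m * op g n = op (f * shift m g) (m + n) :=
  SkewMonoidAlgebra.single_mul_single ..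

theorem smul_op (f g : RatField ζ ω) (m : ω → ℤ) : f • op g m = op (f * g) m :=
  SkewMonoidAlgebra.smul_single ..

theorem scal_eq_smul (f : RatField ζ ω) : scal f = f • (1 : DiffOp ζ ω) := by
  rw [show (1 : DiffOp ζ ω) = op 1 0 from rfl, smul_op, mul_one, scal]

theorem op_zero_left (m : ω → ℤ) : op (0 : RatField ζ ω) m = 0 := SkewMonoidAlgebra.single_zero _

theorem op_add (f g : RatField ζ ω) (m : ω → ℤ) : op (f + g) m = op f m + op g m :=
  SkewMonoidAlgebra.single_add ..

theorem smul_mul_diffOp (f : RatField ζ ω) (r s : DiffOp ζ ω) : (f • r) * s = f • (r * s) := by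
  induction r using SkewMonoidAlgebra.induction_on with
  | zero => simp
  | add r r' hr hr' => rw [smul_add, add_mul, add_mul, smul_add, hr, hr']
  | single a b =>
    induction s using SkewMonoidAlgebra.induction_on with
    | zero => simp
    | add r r' hr hr' => rw [mul_add, mul_add, smul_add, hr, hr']
    | single a' b' =>
      rw [SkewMonoidAlgebra.smul_single, SkewMonoidAlgebra.single_mul_single,
        SkewMonoidAlgebra.single_mul_single, SkewMonoidAlgebra.smul_single, smul_eq_mul,
        smul_eq_mul, mul_assoc]

theorem op_mul_smul (X : RatField ζ ω) (n : ω → ℤ) (f : RatField ζ ω) (r : DiffOp ζ ω) :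
    op X n * (f • r) = shift n f • (op X n * r) := by
  induction r using SkewMonoidAlgebra.induction_on with
  | zero => simp
  | add r r' hr hr' => rw [smul_add, mul_add, mul_add, smul_add, hr, hr']
  | single a b =>
    have h : (SkewMonoidAlgebra.single a b : DiffOp ζ ω) = op b (Multiplicative.toAdd a) := rfl
    rw [h, smul_op, op_mul, op_mul, smul_op, map_mul]; congr 1; ring

variable (ζ ω) in
/-- Multiplication operators, as a ring homomorphism. -/
def scalHom : RatField ζ ω →+* DiffOp ζ ω where
  toFun := scal
  map_one' := rfl
  map_zero' := op_zero_left _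
  map_add' f g := op_add _ _ _
  map_mul' f g := by rw [scal, scal, scal, op_mul, shift_zero, add_zero]

theorem scal_algebraMap (c : ℂ) :
    scal (algebraMap ℂ (RatField ζ ω) c) = algebraMap ℂ (DiffOp ζ ω) c := by
  rw [Algebra.algebraMap_eq_smul_one, Algebra.algebraMap_eq_smul_one, scal_eq_smul, smul_assoc,
    one_smul]

theorem smul_eq_algebraMap_smul (c : ℂ) (r : DiffOp ζ ω) :
    c • r = (algebraMap ℂ (RatField ζ ω) c) • r := by
  rw [algebraMap_smul]

end DiffOp

/-- An element moved by a constant by some endomorphism is nonzero. -/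
theorem ne_zero_of_shift {K : Type*} [Field K] (σ : K →+* K) {f q : K} (h : σ f = f + q)
    (hq : q ≠ 0) : f ≠ 0 := by
  rintro rfl; rw [map_zero, zero_add] at h; exact hq h.symm

/-! ### Admissible data -/

namespace Datum

universe uI
variable {I : Type uI} (D : Datum I)

theorem shift_wVar (n : D.WIdx → ℤ) (k : D.WIdx) : shift n (D.wVar k) = D.wVar k + n k := by
  rw [wVar, shift_algebraMap]
  simp [shiftHom]

theorem shift_zToK (n : D.WIdx → ℤ) (f : D.ZRing) : shift n (D.zToK f) = D.zToK f := by
  simp only [zToK, RingHom.comp_apply, shift_algebraMap]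
  congr 1
  induction f using MvPolynomial.induction_on with
  | C a => simp [shiftHom]
  | add p q hp hq => simp only [map_add, hp, hq]
  | mul_X p k hp => rw [map_mul, map_mul, hp]; congr 1; simp [shiftHom]

/-- The properties of the data which are used to construct the homomorphism. -/
structure Admissible [Fintype I] : Prop where
  ττ : ∀ i, D.τ (D.τ i) = i
  cτ : ∀ i j, D.cartan (D.τ i) (D.τ j) = D.cartan i j
  c_symm : ∀ i j, D.cartan i j = D.cartan j i
  c_self : ∀ i, D.cartan i i = 2
  c_off : ∀ i j, i ≠ j → D.cartan i j = 0 ∨ D.cartan i j = -1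
  reps : D.IsOrbitReps
  orient : D.IsOrientation
  lam_nonneg : ∀ i, 0 ≤ D.lam i
  lamτ : ∀ i, D.lam (D.τ i) = D.lam i
  even : IsEven D.mu
  diff : D.IsDiff
  parity : D.Parity
  zeta : ∀ i, D.τ i ≠ i → D.zeta i + D.zeta (D.τ i) = D.fv i

variable {D} [Fintype I]

end Datum

end

section

namespace Datum

universe uI
variable {I : Type uI} {D : Datum I}

section Comb
variable [Fintype I]

namespace Admissible

variable (hD : D.Admissible)

theorem v_τ (hD : D.Admissible) (i : I) : D.v (D.τ i) = D.v i := by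
  by_cases h : D.τ i = i
  · rw [h]
  · have h' : D.τ (D.τ i) ≠ D.τ i := by rw [hD.ττ]; exact fun e => h e.symm
    have h1 := hD.zeta i h
    have h2 := hD.zeta _ h'
    rw [hD.ττ] at h2
    rw [fv, if_neg h] at h1
    rw [fv, if_neg h'] at h2
    omega

theorem τ_eq_iff (hD : D.Admissible) (i : I) : D.τ (D.τ i) = D.τ i ↔ D.τ i = i := by
  rw [hD.ττ]; exact eq_comm

theorem τ_inj (hD : D.Admissible) {i j : I} : D.τ i = D.τ j ↔ i = j :=
  ⟨fun h => by rw [← hD.ττ i, h, hD.ττ], fun h => by rw [h]⟩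

theorem τ_eq_comm (hD : D.Admissible) {i j : I} : D.τ i = j ↔ i = D.τ j :=
  ⟨fun h => by rw [← h, hD.ττ], fun h => by rw [h, hD.ττ]⟩

theorem fv_τ (hD : D.Admissible) (i : I) : D.fv (D.τ i) = D.fv i := by
  simp only [fv, hD.τ_eq_iff, hD.v_τ]

theorem wt_τ (hD : D.Admissible) (i : I) : D.wt (D.τ i) = D.wt i := by
  rw [wt, hD.lamτ, wt]

theorem fw_τ (hD : D.Admissible) (i : I) : D.fw (D.τ i) = D.fw i := by
  simp only [fw, hD.τ_eq_iff, hD.wt_τ]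

theorem theta_τ (hD : D.Admissible) (i : I) : D.theta (D.τ i) = D.theta i := by
  simp only [theta, hD.τ_eq_iff, hD.v_τ]

theorem mem_τ (hD : D.Admissible) {i : I} (hi : D.τ i ≠ i) : D.mem (D.τ i) ↔ ¬ D.mem i := by
  have h := hD.reps.2 i hi
  simp only [mem, hD.τ_eq_iff, hi, or_false]
  rcases h with ⟨h1, h2⟩ | ⟨h1, h2⟩ <;> simp [h1, h2]

theorem cτ' (hD : D.Admissible) (i j : I) : D.cartan (D.τ i) j = D.cartan i (D.τ j) := by
  rw [← hD.cτ i, hD.ττ]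

theorem adj_iff (hD : D.Admissible) (i j : I) : D.adj i j ↔ D.cartan i j = -1 := by
  constructor
  · rintro (h | h)
    · rw [hD.c_symm]; exact hD.orient.1 _ _ h
    · exact hD.orient.1 _ _ h
  · intro h
    rcases hD.orient.2.1 i j h with h | h
    exacts [Or.inr h.1, Or.inl h.1]

theorem arrow_asymm (hD : D.Admissible) {i j : I} (h : D.arrow i j) : ¬ D.arrow j i := by
  rcases hD.orient.2.1 i j (hD.orient.1 _ _ h) with h' | h'
  exacts [h'.2, fun _ => h'.2 h]

theorem not_adj_self (hD : D.Admissible) (i : I) : ¬ D.adj i i := by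
  rw [hD.adj_iff, hD.c_self]; norm_num

theorem arrow_τ (hD : D.Admissible) {i j : I} (h : D.τ i ≠ i ∨ D.τ j ≠ j) :
    D.arrow (D.τ j) (D.τ i) ↔ D.arrow i j := by
  have key : ∀ i j, (D.τ i ≠ i ∨ D.τ j ≠ j) → D.arrow i j → D.arrow (D.τ j) (D.τ i) := by
    rintro i j (h | h) ha
    · exact hD.orient.2.2.1 _ _ h ha
    · exact hD.orient.2.2.2 _ _ h ha
  refine ⟨fun ha => ?_, key i j h⟩
  have := key _ _ (by rw [Ne, Ne, hD.τ_eq_iff, hD.τ_eq_iff]; exact h.symm) ha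
  rwa [hD.ττ, hD.ττ] at this

end Admissible
end Comb

/-! ### The points of the shift system -/

variable (D) in
/-- The number of variables attached to the node `i` itself. -/
def len (i : I) : ℕ := if D.τ i = i then D.fv i else D.zeta i

variable (D) in
/-- The index set of the variables, in the numbering by all nodes. -/
abbrev T : Type uI := Σ i : I, Fin (D.len i)

variable (D) in
/-- The signed variables `± w_{i,r}`. -/
abbrev NR : Type uI := D.T × Bool

variable (D) in
/-- The signed variables, and one more point for each `i` with `θ_i = 1`. -/
abbrev Root : Type uI := D.NR ⊕ {i : I // D.theta i = 1}

/-- The variable of index `t`. -/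
def om (t : D.T) : D.K := D.w t.1 (t.2 + 1)

/-- The exponent of the shift operator of index `t`. -/
def eT (t : D.T) : D.WIdx → ℤ := D.e t.1 (t.2 + 1)

namespace NR

/-- The value of a signed variable. -/
def w (b : D.NR) : D.K := if b.2 then om b.1 else -om b.1

/-- The node of a signed variable. -/
def node (b : D.NR) : I := if b.2 then b.1.1 else D.τ b.1.1

/-- The opposite signed variable. -/
def flip (b : D.NR) : D.NR := (b.1, !b.2)

/-- The sign of a signed variable. -/
def sgn (b : D.NR) : D.K := if b.2 then 1 else -1

/-- The shift attached to a signed variable. -/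
def sh (b : D.NR) : D.WIdx → ℤ := if b.2 then -eT b.1 else eT b.1

/-- The midpoint between the poles attached to a signed variable and the variable itself. -/
def x (b : D.NR) : D.K := w b - 1 / 2

@[simp] theorem flip_flip (b : D.NR) : flip (flip b) = b := by simp [flip]

theorem flip_ne (b : D.NR) : flip b ≠ b := by
  intro h; have := congrArg Prod.snd h; simp [flip] at this

@[simp] theorem w_flip (b : D.NR) : w (flip b) = -w b := by
  rcases b with ⟨t, _ | _⟩ <;> simp [w, flip]

@[simp] theorem sgn_flip (b : D.NR) : sgn (flip b) = -sgn b := by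
  rcases b with ⟨t, _ | _⟩ <;> simp [sgn, flip]

@[simp] theorem sh_flip (b : D.NR) : sh (flip b) = -sh b := by
  rcases b with ⟨t, _ | _⟩ <;> simp [sh, flip]

theorem sgn_mul_sgn (b : D.NR) : sgn b * sgn b = 1 := by
  rcases b with ⟨t, _ | _⟩ <;> simp [sgn]

theorem sgn_ne_zero (b : D.NR) : sgn b ≠ 0 := by
  rcases b with ⟨t, _ | _⟩ <;> simp [sgn]

theorem node_flip [Fintype I] (hD : D.Admissible) (b : D.NR) : node (flip b) = D.τ (node b) := by
  rcases b with ⟨t, _ | _⟩ <;> simp [node, flip, hD.ττ]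

theorem shift_sgn (n : D.WIdx → ℤ) (b : D.NR) : shift n (sgn b) = sgn b := by
  rcases b with ⟨t, _ | _⟩ <;> simp [sgn]

end NR

section
variable [Fintype I]

theorem exists_index (hD : D.Admissible) : ∃ k : D.T → D.WIdx, Function.Injective k ∧
    (∀ t, ((k t).1 : I) = if D.mem t.1 then t.1 else D.τ t.1) ∧
    ∀ t, (om t = D.wVar (k t) ∧ eT t = Pi.single (k t) 1) ∨
      (om t = -D.wVar (k t) ∧ eT t = -Pi.single (k t) 1) := by
  have hz : ∀ i, D.len i ≤ D.fv i := by
    intro i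
    unfold len; split_ifs with h
    · exact le_rfl
    · have := hD.zeta i h; omega
  have hz' : ∀ i, D.τ i ≠ i → D.len i + D.len (D.τ i) = D.fv i := by
    intro i hi
    rw [len, len, hD.τ_eq_iff, if_neg hi, if_neg hi, hD.zeta i hi]
  have hmem : ∀ i, ¬ D.mem i → D.τ i ≠ i ∧ D.mem (D.τ i) := by
    intro i h
    have h1 : D.τ i ≠ i := fun e => h (Or.inr e)
    exact ⟨h1, (hD.mem_τ h1).2 h⟩
  refine ⟨fun t => if h : D.mem t.1 then ⟨⟨t.1, h⟩, ⟨t.2, lt_of_lt_of_le t.2.2 (hz _)⟩⟩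
    else ⟨⟨D.τ t.1, (hmem _ h).2⟩, ⟨D.fv (D.τ t.1) - 1 - t.2, ?_⟩⟩, ?_, ?_, ?_⟩
  · have := hz' _ (hmem _ h).1
    have := t.2.2
    have := hD.fv_τ t.1
    simp only; omega
  · rintro ⟨i, r⟩ ⟨j, s⟩ hij
    by_cases hi : D.mem i <;> by_cases hj : D.mem j
    · simp only [hi, hj, dite_true] at hij
      obtain ⟨h1, h2⟩ := Sigma.mk.inj_iff.1 hij
      obtain rfl : i = j := congrArg Subtype.val h1
      have := eq_of_heq h2
      simp only [Fin.mk.injEq] at this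
      rw [Fin.ext this]
    · exfalso
      simp only [hi, hj, dite_true, dite_false] at hij
      obtain ⟨h1, h2⟩ := Sigma.mk.inj_iff.1 hij
      obtain rfl : i = D.τ j := congrArg Subtype.val h1
      have := eq_of_heq h2
      simp only [Fin.mk.injEq] at this
      have h3 := hz' _ (hmem _ hj).1
      have := hD.fv_τ j
      have := r.2
      have := s.2
      omega
    · exfalso
      simp only [hi, hj, dite_true, dite_false] at hij
      obtain ⟨h1, h2⟩ := Sigma.mk.inj_iff.1 hij
      obtain rfl : D.τ i = j := congrArg Subtype.val h1
      have := eq_of_heq h2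
      simp only [Fin.mk.injEq] at this
      have h3 := hz' _ (hmem _ hi).1
      have := hD.fv_τ i
      have := r.2
      have := s.2
      omega
    · simp only [hi, hj, dite_false] at hij
      obtain ⟨h1, h2⟩ := Sigma.mk.inj_iff.1 hij
      obtain rfl : i = j := hD.τ_inj.1 (congrArg Subtype.val h1)
      have := eq_of_heq h2
      simp only [Fin.mk.injEq] at this
      have h3 := hz' _ (hmem _ hi).1
      have := hD.fv_τ i
      have := r.2
      have := s.2
      have : (r : ℕ) = s := by omega
      rw [Fin.ext this]
  · intro t
    by_cases h : D.mem t.1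
    · simp only [dif_pos h, if_pos h]
    · simp only [dif_neg h, if_neg h]
  · rintro ⟨i, r⟩
    have h2 := hz i
    have h3 := r.2
    by_cases hi : D.mem i
    · left
      have h4 : D.mem i ∧ 1 ≤ (r : ℕ) + 1 ∧ (r : ℕ) + 1 ≤ D.fv i := ⟨hi, by omega, by omega⟩
      simp only [hi, om, eT, Datum.w, e, w₀, e₀, dite_true, if_true, h4, and_self,
        Nat.add_sub_cancel]
    · right
      have h1 := hmem _ hi
      have h6 := hz' _ h1.1
      have h7 := hD.fv_τ i
      have h4 : D.mem (D.τ i) ∧ 1 ≤ D.fv (D.τ i) + 1 - ((r : ℕ) + 1) ∧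
        D.fv (D.τ i) + 1 - ((r : ℕ) + 1) ≤ D.fv (D.τ i) := ⟨h1.2, by omega, by omega⟩
      have h8 : D.fv (D.τ i) + 1 - ((r : ℕ) + 1) - 1 = D.fv (D.τ i) - 1 - r := by omega
      simp only [om, eT, Datum.w, e, w₀, e₀, if_neg hi, dif_neg hi, dif_pos h4, h8, and_self]

theorem shift_eT (hD : D.Admissible) (s t : D.T) :
    shift (eT s) (om t) = om t + (if s = t then 1 else 0) ∧
    shift (-eT s) (om t) = om t - (if s = t then 1 else 0) := by
  obtain ⟨k, hk, -, h⟩ := exists_index hD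
  by_cases hst : s = t
  · subst hst
    rcases h s with ⟨h1, h2⟩ | ⟨h1, h2⟩ <;> rw [h1, h2] <;>
      (simp [shift_wVar]; constructor <;> ring)
  · have : k t ≠ k s := fun e => hst (hk e.symm)
    rw [if_neg hst]
    rcases h s with ⟨h1, h2⟩ | ⟨h1, h2⟩ <;> rcases h t with ⟨h3, h4⟩ | ⟨h3, h4⟩ <;>
      rw [h2, h3] <;> simp [shift_wVar, this]

namespace NR

theorem shift_w (hD : D.Admissible) {a b : D.NR} (h : b ≠ a) (h' : b ≠ flip a) :
    shift (sh a) (w b) = w b := by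
  have hab : a.1 ≠ b.1 := by
    rcases a with ⟨s, p⟩
    rcases b with ⟨t, q⟩
    rintro (rfl : s = t)
    cases p <;> cases q <;> simp [flip] at h h'
  have := shift_eT hD a.1 b.1
  rw [if_neg hab, add_zero, sub_zero] at this
  rcases a with ⟨s, _ | _⟩ <;> rcases b with ⟨t, _ | _⟩ <;> simp_all [sh, w]

theorem shift_w_self (hD : D.Admissible) (a : D.NR) : shift (sh a) (w a) = w a - 1 := by
  have := shift_eT hD a.1 a.1
  rw [if_pos rfl] at this
  rcases a with ⟨s, _ | _⟩ <;> simp_all [sh, w] <;> ring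

theorem shift_w_flip (hD : D.Admissible) (a : D.NR) :
    shift (sh a) (w (flip a)) = w (flip a) + 1 := by
  rw [w_flip, map_neg, shift_w_self hD]; ring

theorem w_sub_w_ne (hD : D.Admissible) {a b : D.NR} (h : b ≠ a) (q : ℚ) :
    w a - w b + (q : D.K) ≠ 0 := by
  by_cases h' : b = flip a
  · subst h'
    exact ne_zero_of_shift (shift (sh a)) (q := -2)
      (by rw [map_add, map_sub, shift_w_self hD, shift_w_flip hD, map_ratCast]; ring) (by norm_num)
  · exact ne_zero_of_shift (shift (sh a)) (q := -1)
      (by rw [map_add, map_sub, shift_w_self hD, shift_w hD h h', map_ratCast]; ring) (by norm_num)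

theorem w_add_ne (hD : D.Admissible) (a : D.NR) (q : ℚ) : w a + (q : D.K) ≠ 0 :=
  ne_zero_of_shift (shift (sh a)) (q := -1)
      (by rw [map_add, shift_w_self hD, map_ratCast]; ring) (by norm_num)

theorem w_ne_zero (hD : D.Admissible) (a : D.NR) : w a ≠ 0 := by
  simpa using w_add_ne hD a 0

theorem w_ne (hD : D.Admissible) {a b : D.NR} (h : b ≠ a) : w a - w b ≠ 0 := by
  simpa using w_sub_w_ne hD h 0

end NR
end
end Datum

end

section

namespace Datum

universe uI
variable {I : Type uI} {D : Datum I} [Fintype I]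

namespace NR

/-- The exponent with which the factor `x_a - w_b` occurs in the coefficient of `y_a`. -/
def nexp (a b : D.NR) : ℕ :=
  if D.arrow (node b) (node a) then
    (if D.τ (node a) = node a ∧ D.τ (node b) = node b then (if a.2 then 1 else 0) else 1)
  else if D.arrow (node a) (node b) then
    (if D.τ (node a) = node a ∧ D.τ (node b) = node b then (if b.2 then 0 else 1) else 0)
  else 0

theorem nexp_flip (hD : D.Admissible) (a b : D.NR) : nexp a b = nexp (flip b) (flip a) := by
  have h2 : ∀ c : D.NR, (flip c).2 = !c.2 := fun c => rfl
  simp only [nexp, node_flip hD, h2, hD.τ_eq_iff]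
  by_cases hf : D.τ (node a) = node a ∧ D.τ (node b) = node b
  · have hf' := hf.symm
    simp only [hf, and_self, if_true]
    by_cases h1 : D.arrow (node b) (node a)
    · have h3 := hD.arrow_asymm h1
      simp only [h1, h3, if_true, if_false]
      cases a.2 <;> rfl
    · simp only [h1, if_false]
      congr 1
      cases b.2 <;> rfl
  · have hf' : ¬ (D.τ (node b) = node b ∧ D.τ (node a) = node a) := fun h => hf h.symm
    simp only [hf, hf', if_false, ite_self]
    rw [hD.arrow_τ (by tauto)]

theorem nexp_add (hD : D.Admissible) {a b : D.NR} (h : D.cartan (node a) (node b) = -1) :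
    nexp a b + nexp b a = 1 := by
  have hadj : D.arrow (node b) (node a) ∨ D.arrow (node a) (node b) :=
    (hD.adj_iff _ _).2 h
  simp only [nexp, and_comm (a := D.τ (node b) = node b)]
  rcases hadj with h1 | h1 <;> have h2 := hD.arrow_asymm h1 <;> simp only [h1, h2, if_true, if_false]
  · split_ifs <;> simp_all
  · split_ifs <;> simp_all

/-- The contribution of the pair `(a, b)` to the coefficient of `y_a`. -/
def g (a b : D.NR) : D.K :=
  if D.cartan (node a) (node b) = 2 then (sgn a * (w a - w b))⁻¹
  else if D.cartan (node a) (node b) = -1 then (sgn a * (x a - w b)) ^ nexp a b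
  else 1

/-- The exponent of the power of `x_a` in the coefficient of `y_a` coming from the `θ_j`. -/
def zexp (a : D.NR) : ℕ :=
  if D.τ (node a) = node a then
    (if a.2 then ∑ j with D.adj (node a) j, D.theta j else 0)
  else ∑ j with D.arrow j (node a), D.theta j

/-- The factor of `𝐙` in the coefficient of `y_a`. -/
def Zp (Zs : I → Polynomial D.ZRing) (a : D.NR) : Polynomial D.ZRing :=
  if a.2 then D.Z Zs (node a)
  else if D.τ (node a) = node a then D.Zbar Zs (node a) else minus (D.Z Zs (node a))

/-- The part of the coefficient of `y_a` depending only on `w_a`. -/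
def kappa (Zs : I → Polynomial D.ZRing) (a : D.NR) : D.K :=
  (sgn a * x a) ^ zexp a * D.zeval (Zp Zs a) (sgn a * x a) *
    (if D.τ (node a) = node a then
      (D.kap (w a) ^ D.vartheta (node a))⁻¹ * ((sgn a * w a) ^ D.theta (node a))⁻¹ else 1)

/-- The coefficient of `y_a`. -/
def X (Zs : I → Polynomial D.ZRing) (a : D.NR) : D.K :=
  kappa Zs a * ∏ b ∈ Finset.univ.erase a, g a b

theorem x_sub_w_ne (hD : D.Admissible) {a b : D.NR} (h : b ≠ a) : x a - w b ≠ 0 := by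
  have := w_sub_w_ne hD h (-1 / 2)
  rw [x]; convert this using 1; push_cast; ring

theorem g_ne_zero (hD : D.Admissible) {a b : D.NR} (h : b ≠ a) : g a b ≠ 0 := by
  unfold g
  split_ifs
  · exact inv_ne_zero (mul_ne_zero (sgn_ne_zero a) (w_ne hD h))
  · exact pow_ne_zero _ (mul_ne_zero (sgn_ne_zero a) (x_sub_w_ne hD h))
  · exact one_ne_zero

theorem shift_zeval (n : D.WIdx → ℤ) (p : Polynomial D.ZRing) (f : D.K) :
    shift n (D.zeval p f) = D.zeval p (shift n f) := by
  rw [zeval, zeval, Polynomial.hom_eval₂]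
  congr 1
  exact RingHom.ext fun c => shift_zToK D n c

theorem shift_half (n : D.WIdx → ℤ) : shift n (1 / 2 : D.K) = 1 / 2 := by
  rw [map_div₀, map_one, map_ofNat]

theorem shift_x (n : D.WIdx → ℤ) (a : D.NR) : shift n (x a) = shift n (w a) - 1 / 2 := by
  rw [x, map_sub, shift_half]

theorem shift_kap (n : D.WIdx → ℤ) (f : D.K) : shift n (D.kap f) = D.kap (shift n f) := by
  simp only [kap, map_sub, map_div₀, map_mul, map_one, map_ofNat]

theorem shift_kappa (hD : D.Admissible) (Zs : I → Polynomial D.ZRing) {a b : D.NR} (h : b ≠ a)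
    (h' : b ≠ flip a) : shift (sh a) (kappa Zs b) = kappa Zs b := by
  have h1 : shift (sh a) (x b) = x b := by rw [shift_x, shift_w hD h h', x]
  simp only [kappa, map_mul, map_pow, shift_sgn, h1, shift_zeval, apply_ite (shift (sh a)), map_inv₀,
    shift_kap, shift_w hD h h', map_one]

theorem shift_g (hD : D.Admissible) {a b d : D.NR} (h : b ≠ a) (h' : b ≠ flip a) (hd : d ≠ a)
    (hd' : d ≠ flip a) : shift (sh a) (g b d) = g b d := by
  simp only [g, apply_ite (shift (sh a)), map_inv₀, map_mul, map_pow, map_sub, shift_sgn, shift_half,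
    shift_w hD h h', shift_w hD hd hd', map_one, x]

theorem shift_X (hD : D.Admissible) (Zs : I → Polynomial D.ZRing) {a b : D.NR} (h : b ≠ a)
    (h' : b ≠ flip a) :
    X Zs b * (shift (sh a) (g b a) * shift (sh a) (g b (flip a))) =
      shift (sh a) (X Zs b) * (g b a * g b (flip a)) := by
  have h1 : X Zs b = kappa Zs b * (g b a * (g b (flip a) *
      ∏ d ∈ ((Finset.univ.erase b).erase a).erase (flip a), g b d)) := by
    rw [X, Finset.mul_prod_erase _ (g b) (by simp [h'.symm, flip_ne]),
      Finset.mul_prod_erase _ (g b) (by simp [h.symm])]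
  rw [h1, map_mul, map_mul, map_mul, shift_kappa hD Zs h h', map_prod,
    Finset.prod_congr rfl fun d hd => shift_g hD h h' (d := d) (by simp at hd; tauto)
      (by simp at hd; tauto)]
  ring

theorem g_exch (hD : D.Admissible) {a b : D.NR} (h : b ≠ a) (h' : b ≠ flip a) :
    (x a - x b - (D.cartan (node a) (node b) : D.K) / 2) * shift (sh a) (g b a) * g a b =
    (x a - x b + (D.cartan (node a) (node b) : D.K) / 2) * shift (sh b) (g a b) * g b a := by
  have h2 : a ≠ flip b := by rintro rfl; simp at h'
  have e1 := shift_w hD h h'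
  have e2 := shift_w hD h.symm h2
  have hs := sgn_ne_zero a
  have ht := sgn_ne_zero b
  have hc := hD.c_symm (node b) (node a)
  have hd := w_ne hD h
  have hd1 : w a - w b + 1 ≠ 0 := by simpa using w_sub_w_ne hD h 1
  have hd2 : w a - w b - 1 ≠ 0 := by simpa [sub_eq_add_neg] using w_sub_w_ne hD h (-1)
  by_cases c2 : D.cartan (node a) (node b) = 2
  · simp only [g, hc, c2, if_true, map_inv₀, map_mul, map_sub, shift_sgn, e1, e2, shift_w_self hD, x]
    have : ∀ d s t : D.K, s ≠ 0 → t ≠ 0 → d ≠ 0 → d + 1 ≠ 0 → d - 1 ≠ 0 →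
        (d - 1) * (t * (-(d - 1)))⁻¹ * (s * d)⁻¹ = (d + 1) * (s * (d + 1))⁻¹ * (t * (-d))⁻¹ := by
      intro d s t _ _ _ _ _
      field_simp
    have := this _ _ _ hs ht hd hd1 hd2
    push_cast
    convert this using 2 <;> ring_nf
  by_cases c1 : D.cartan (node a) (node b) = -1
  · have hn := nexp_add hD c1
    have e : ¬ (-1 : ℤ) = 2 := by norm_num
    simp only [g, hc, c1, e, if_true, if_false, map_pow, map_mul, map_sub, shift_sgn, shift_half, e1,
      e2, shift_w_self hD, x]
    obtain ⟨n1, n2⟩ | ⟨n1, n2⟩ : (nexp a b = 1 ∧ nexp b a = 0) ∨ (nexp a b = 0 ∧ nexp b a = 1) := by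
      omega
    all_goals rw [n1, n2]; push_cast; ring
  · have c0 : D.cartan (node a) (node b) = 0 := by
      by_cases e : node a = node b
      · rw [e, hD.c_self] at c2; exact absurd rfl c2
      · have := hD.c_off _ _ e; tauto
    have e : ¬ (0 : ℤ) = 2 := by norm_num
    have e' : ¬ (0 : ℤ) = -1 := by norm_num
    simp [g, hc, c0]

theorem g_flip_exch (hD : D.Admissible) {a b : D.NR} (h : b ≠ a) (h' : b ≠ flip a) :
    shift (sh a) (g b (flip a)) * g a (flip b) = shift (sh b) (g a (flip b)) * g b (flip a) := by
  have h2 : a ≠ flip b := by rintro rfl; simp at h'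
  have e1 := shift_w hD h h'
  have e2 := shift_w hD h.symm h2
  have hc : D.cartan (node b) (node (flip a)) = D.cartan (node a) (node (flip b)) := by
    rw [node_flip hD, node_flip hD, hD.c_symm, hD.cτ']
  have hn : nexp b (flip a) = nexp a (flip b) := by
    rw [nexp_flip hD b, flip_flip]
  simp only [g, hc, hn]
  split_ifs
  · simp only [map_inv₀, map_mul, map_sub, shift_sgn, e1, e2, shift_w_self hD, w_flip, map_neg,
      mul_inv]
    rw [show w b - -(w a - 1) = w a - -(w b - 1) by ring, show w a - - w b = w b - -w a by ring]
    ring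
  · simp only [map_pow, map_mul, map_sub, shift_sgn, shift_half, e1, e2, shift_w_self hD, x, w_flip,
      map_neg, mul_pow]
    rw [show w b - 1 / 2 - -(w a - 1) = w a - 1 / 2 - -(w b - 1) by ring,
      show w a - 1 / 2 - - w b = w b - 1 / 2 - -w a by ring]
    ring
  · simp

theorem X_exch (hD : D.Admissible) (Zs : I → Polynomial D.ZRing) {a b : D.NR} (h : b ≠ a)
    (h' : b ≠ flip a) :
    (x a - x b - (D.cartan (node a) (node b) : D.K) / 2) * (X Zs a * shift (sh a) (X Zs b)) =
    (x a - x b + (D.cartan (node a) (node b) : D.K) / 2) * (X Zs b * shift (sh b) (X Zs a)) := by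
  have h2 : a ≠ flip b := by rintro rfl; simp at h'
  have h3 : flip a ≠ b := h'.symm
  have e1 := shift_X hD Zs h h'
  have e2 := shift_X hD Zs h.symm h2
  have e3 := g_exch hD h h'
  have e4 := g_flip_exch hD h h'
  have n1 := g_ne_zero hD h
  have n2 := g_ne_zero hD h.symm
  have n3 := g_ne_zero hD h2.symm
  have n4 := g_ne_zero hD h3
  refine mul_right_cancel₀ (mul_ne_zero (mul_ne_zero n2 n4) (mul_ne_zero n1 n3)) ?_
  generalize x a - x b - (D.cartan (node a) (node b) : D.K) / 2 = A at *
  generalize x a - x b + (D.cartan (node a) (node b) : D.K) / 2 = B at *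
  generalize shift (sh a) (X Zs b) = P at *
  generalize shift (sh b) (X Zs a) = Q at *
  linear_combination (-A * X Zs a * g a b * g a (flip b)) * e1
    + B * X Zs b * g b a * g b (flip a) * e2
    + X Zs a * X Zs b * shift (sh a) (g b (flip a)) * g a (flip b) * e3
    + X Zs a * X Zs b * B * shift (sh b) (g a b) * g b a * e4

end NR

/-- The contribution of `t` to the coefficient of the point attached to a node with `θ_i = 1`. -/
def f₀ (i : I) (t : D.T) : D.K :=
  if D.cartan i t.1 = 2 then (1 / 4 - om t ^ 2)⁻¹ else if D.cartan i t.1 = -1 then -om t else 1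

variable (D) in
/-- The coefficient of the point attached to a node with `θ_i = 1`. -/
def X₀ (Zs : I → Polynomial D.ZRing) (ε : I → ℂ) (i : I) : D.K :=
  -(algebraMap ℂ D.K (ε i) * D.zeval (D.Z Zs i) 0) * ∏ t, f₀ i t

theorem fixed_of_theta {i : I} (h : D.theta i = 1) : D.τ i = i := by
  unfold theta at h; split_ifs at h with h'; exact h'

theorem X₀_exch (hD : D.Admissible) (Zs : I → Polynomial D.ZRing) (ε : I → ℂ) (i : I)
    (hi : D.τ i = i) (a : D.NR) :
    (a.x - (D.cartan a.node i : D.K) / 2) * shift a.sh (D.X₀ Zs ε i) =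
      (a.x + (D.cartan a.node i : D.K) / 2) * D.X₀ Zs ε i := by
  have hc : D.cartan i a.1.1 = D.cartan a.node i := by
    rw [NR.node]; split_ifs
    · rw [hD.c_symm]
    · rw [hD.cτ', hi, hD.c_symm]
  have hs : ∀ t ∈ Finset.univ.erase a.1, shift a.sh (f₀ i t) = f₀ i t := by
    intro t ht
    have ht' : a.1 ≠ t := by simp at ht; exact fun e => ht e.symm
    have h1 : shift a.sh (om t) = om t := by
      have := NR.shift_w hD (a := a) (b := (t, true)) (fun e => ht' (by rw [← e]))
        (fun e => ht' (by have := congrArg Prod.fst e; exact this.symm))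
      simpa [NR.w] using this
    simp only [f₀, apply_ite (shift a.sh), map_inv₀, map_sub, map_pow, map_neg, h1, map_div₀, map_one,
      map_ofNat]
  have hX : D.X₀ Zs ε i = -(algebraMap ℂ D.K (ε i) * D.zeval (D.Z Zs i) 0) *
      (f₀ i a.1 * ∏ t ∈ Finset.univ.erase a.1, f₀ i t) := by
    rw [Finset.mul_prod_erase _ _ (Finset.mem_univ _), X₀]
  rw [hX, map_mul, map_mul, map_neg, map_mul, shift_const, NR.shift_zeval, map_zero, map_prod,
    Finset.prod_congr rfl hs]
  have key : (a.x - (D.cartan a.node i : D.K) / 2) * shift a.sh (f₀ i a.1) =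
      (a.x + (D.cartan a.node i : D.K) / 2) * f₀ i a.1 := by
    have ho : om a.1 = a.sgn * a.w := by
      rcases a with ⟨t, _ | _⟩ <;> simp [NR.sgn, NR.w]
    have hsq := NR.sgn_mul_sgn a
    simp only [f₀, hc]
    split_ifs with c2 c1
    · have h1 : 1 / 4 - a.w ^ 2 ≠ 0 := by
        have h2 := NR.w_add_ne hD a (1 / 2)
        have h3 := NR.w_add_ne hD a (-1 / 2)
        intro h
        apply mul_ne_zero h2 h3
        push_cast
        linear_combination -h
      have h4 : 1 / 4 - (a.w - 1) ^ 2 ≠ 0 := by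
        have h2 := NR.w_add_ne hD a (-1 / 2)
        have h3 := NR.w_add_ne hD a (-3 / 2)
        intro h
        apply mul_ne_zero h2 h3
        push_cast
        linear_combination -h
      rw [c2, ho, map_inv₀, map_sub, map_pow, map_mul, NR.shift_w_self hD, NR.shift_sgn, mul_pow,
        mul_pow, pow_two a.sgn, hsq, one_mul, one_mul, NR.x, map_div₀, map_one, map_ofNat]
      rw [← div_eq_mul_inv, ← div_eq_mul_inv, div_eq_div_iff h4 h1]
      push_cast
      ring
    · rw [c1, ho, map_neg, map_mul, NR.shift_w_self hD, NR.shift_sgn, NR.x]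
      push_cast
      ring
    · have c0 : D.cartan a.node i = 0 := by
        by_cases e : a.node = i
        · rw [e, hD.c_self] at c2; exact absurd rfl c2
        · have := hD.c_off _ _ e; tauto
      rw [c0]; simp
  linear_combination (-(algebraMap ℂ D.K (ε i) * D.zeval (D.Z Zs i) 0) *
    ∏ t ∈ Finset.univ.erase a.1, f₀ i t) * key

/-- The shift system of the homomorphism. -/
def sys (hD : D.Admissible) (Zs : I → Polynomial D.ZRing) (ε : I → ℂ) :
    ShiftSystem I D.Root D.K D.Op where
  σ := Sum.elim (fun a => shift a.sh) (fun _ => shift 0)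
  y := Sum.elim (fun a => op (a.X Zs) a.sh) (fun i => op (D.X₀ Zs ε i) 0)
  x := Sum.elim (fun a => a.x) (fun _ => 0)
  h := Sum.elim (fun a => a.X Zs * shift a.sh (a.flip.X Zs)) (fun i => D.X₀ Zs ε i ^ 2)
  nd := Sum.elim NR.node (fun i => i)
  neg := Sum.map NR.flip id
  τ := D.τ
  c := D.cartan
  smul_mul := smul_mul_diffOp
  neg_neg := by rintro (a | i) <;> simp
  nd_neg := by
    rintro (a | i)
    · simp [NR.node_flip hD]
    · simp [fixed_of_theta i.2]
  y_mul := by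
    rintro (a | i) f r
    · exact op_mul_smul _ _ _ _
    · exact op_mul_smul _ _ _ _
  σ_x := by
    rintro (a | i) (b | j) h h'
    · have h1 : b ≠ a := fun e => h (by rw [e])
      have h2 : b ≠ a.flip := fun e => h' (by rw [e]; rfl)
      simp only [Sum.elim_inl, NR.shift_x, NR.shift_w hD h1 h2]; rfl
    · simp
    · simp [shift_zero]
    · simp
  σ_x_self := by
    rintro (a | i) h
    · simp only [Sum.elim_inl, NR.shift_x, NR.shift_w_self hD]; rw [NR.x]; ring
    · exact absurd rfl h
  σ_x_neg := by
    rintro (a | i)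
    · simp only [Sum.elim_inl, Sum.map_inl, NR.shift_x, NR.w_flip, map_neg, NR.shift_w_self hD]; rw [NR.x]; ring
    · simp
  x_sub_ne := by
    rintro (a | i) (b | j) q hq
    · by_cases h : b = a
      · subst h; simpa using hq
      · simpa [NR.x] using NR.w_sub_w_ne hD h q
    · have := NR.w_add_ne hD a (-1 / 2 + q)
      simp only [Sum.elim_inl, Sum.elim_inr, NR.x]
      convert this using 1; push_cast; ring
    · have := NR.w_add_ne hD b (-1 / 2 - q)
      simp only [Sum.elim_inl, Sum.elim_inr, NR.x]
      intro h; apply this; push_cast; linear_combination -h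
    · simpa using hq
  x_add_ne := by
    rintro (a | i) (b | j) q h hq
    · have h1 : b.flip ≠ a := fun e => h (by rw [← e]; simp)
      have := NR.w_sub_w_ne hD h1 (q - 1)
      simp only [Sum.elim_inl, NR.x]
      convert this using 1; rw [NR.w_flip]; push_cast; ring
    · have := NR.w_add_ne hD a (-1 / 2 + q)
      simp only [Sum.elim_inl, Sum.elim_inr, NR.x]
      convert this using 1; push_cast; ring
    · have := NR.w_add_ne hD b (-1 / 2 + q)
      simp only [Sum.elim_inl, Sum.elim_inr, NR.x]
      convert this using 1; push_cast; ring
    · simpa using hq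
  exch := by
    rintro (a | i) (b | j) h h'
    · have h1 : b ≠ a := fun e => h (by rw [e])
      have h2 : b ≠ a.flip := fun e => h' (by rw [e]; rfl)
      simp only [Sum.elim_inl, op_mul, smul_op]
      rw [NR.X_exch hD Zs h1 h2, add_comm a.sh]
    · simp only [Sum.elim_inl, Sum.elim_inr, op_mul, smul_op, shift_zero, add_zero, zero_add]
      congr 1
      linear_combination a.X Zs * X₀_exch hD Zs ε j (fixed_of_theta j.2) a
    · simp only [Sum.elim_inl, Sum.elim_inr, op_mul, smul_op, shift_zero, add_zero, zero_add]
      congr 1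
      rw [hD.c_symm]
      linear_combination b.X Zs * X₀_exch hD Zs ε i (fixed_of_theta i.2) b
    · have hij : (i : I) ≠ j := fun e => h (by rw [Subtype.ext e])
      have := hD.parity _ _ hij
      rw [i.2, j.2] at this
      have hc : D.cartan i j = 0 := by simpa using this
      simp only [Sum.elim_inr, op_mul, smul_op, shift_zero, hc]
      congr 1
      push_cast
      ring
  exch_zero := by
    rintro (a | i) (b | j) h h' hc
    · have h1 : b ≠ a := fun e => h (by rw [e])
      have h2 : b ≠ a.flip := fun e => h' (by rw [e]; rfl)
      simp only [Sum.elim_inl] at hc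
      have := NR.X_exch hD Zs h1 h2
      rw [hc] at this
      simp only [Int.cast_zero, zero_div, sub_zero, add_zero] at this
      have h3 : a.x - b.x ≠ 0 := by simpa [NR.x] using NR.w_ne hD h1
      simp only [Sum.elim_inl, op_mul]
      rw [mul_left_cancel₀ h3 this, add_comm a.sh]
    · simp only [Sum.elim_inl, Sum.elim_inr] at hc
      simp only [Sum.elim_inl, Sum.elim_inr, op_mul, shift_zero, add_zero, zero_add]
      have := X₀_exch hD Zs ε j (fixed_of_theta j.2) a
      rw [hc] at this
      simp only [Int.cast_zero, zero_div, sub_zero, add_zero] at this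
      have h3 : a.x ≠ 0 := by
        have := NR.w_add_ne hD a (-1 / 2)
        intro h; apply this; rw [← h, NR.x]; push_cast; ring
      rw [mul_left_cancel₀ h3 this, mul_comm]
    · simp only [Sum.elim_inl, Sum.elim_inr] at hc
      rw [hD.c_symm] at hc
      simp only [Sum.elim_inl, Sum.elim_inr, op_mul, shift_zero, add_zero, zero_add]
      have := X₀_exch hD Zs ε i (fixed_of_theta i.2) b
      rw [hc] at this
      simp only [Int.cast_zero, zero_div, sub_zero, add_zero] at this
      have h3 : b.x ≠ 0 := by
        have := NR.w_add_ne hD b (-1 / 2)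
        intro h; apply this; rw [← h, NR.x]; push_cast; ring
      rw [mul_left_cancel₀ h3 this, mul_comm]
    · simp only [Sum.elim_inr, op_mul, shift_zero]; rw [mul_comm]
  y_neg := by
    rintro (a | i)
    · simp only [Sum.elim_inl, Sum.map_inl, op_mul, NR.sh_flip, add_neg_cancel, ← scal_eq_smul, scal]
    · simp only [Sum.elim_inr, Sum.map_inr, id, op_mul, shift_zero, add_zero, ← scal_eq_smul, scal,
        pow_two]
  c_self := hD.c_self
  c_symm := hD.c_symm

end Datum

end

section

open Polynomial in
theorem minus_prod_linear {R ι : Type*} [CommRing R] [Nontrivial R] (s : Finset ι) (f : ι → R) :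
    Datum.minus (∏ k ∈ s, (X - C (f k))) = ∏ k ∈ s, (X + C (f k)) := by
  rw [Datum.minus, natDegree_finsetProd_X_sub_C_eq_card, prod_comp, ← Finset.prod_const, map_prod,
    ← Finset.prod_mul_distrib]
  refine Finset.prod_congr rfl fun k _ => ?_
  simp only [sub_comp, X_comp, C_comp, map_neg, map_one]; ring

namespace Datum

universe uI
variable {I : Type uI} {D : Datum I} [Fintype I]

section Products

variable {M : Type*} [CommMonoid M]

@[to_additive]
theorem prod_T (i : I) (F : D.T → M) (f : ℕ → M) (h : ∀ r, F ⟨i, r⟩ = f (r + 1)) :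
    ∏ t with t.1 = i, F t = ∏ r ∈ Finset.Icc 1 (D.len i), f r := by
  have h1 : ∏ r ∈ Finset.Icc 1 (D.len i), f r = ∏ r : Fin (D.len i), F ⟨i, r⟩ := by
    rw [Finset.prod_congr rfl fun r _ => h r, ← Finset.prod_range (fun r => f (r + 1)),
      Finset.range_eq_Ico, Finset.prod_Ico_add' f 0 _ 1]
    rfl
  rw [h1]
  refine Finset.prod_bij' (fun t ht => (⟨t.2, by
      have := (Finset.mem_filter.1 ht).2; rw [← this]; exact t.2.2⟩ : Fin (D.len i)))
    (fun r _ => ⟨i, r⟩) ?_ ?_ ?_ ?_ ?_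
  · intro t _; simp
  · intro r _; simp
  · rintro ⟨j, r⟩ ht; obtain rfl : j = i := by simpa using ht
    rfl
  · intro r _; rfl
  · rintro ⟨j, r⟩ ht; obtain rfl : j = i := by simpa using ht
    rfl

@[to_additive]
theorem prod_NR (hD : D.Admissible) (i : I) (F : D.NR → M) :
    ∏ b : D.NR with b.node = i, F b =
      (∏ t with t.1 = i, F (t, true)) * ∏ t with t.1 = D.τ i, F (t, false) := by
  rw [Finset.prod_filter, Fintype.prod_prod_type]
  simp only [Fintype.prod_bool, NR.node, if_true, Finset.prod_mul_distrib, Finset.prod_filter]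
  congr 1
  refine Finset.prod_congr rfl fun t _ => ?_
  simp only [Bool.false_eq_true, if_false, hD.τ_eq_comm]

@[to_additive]
theorem prod_flip (hD : D.Admissible) (i : I) (F : D.NR → M) :
    ∏ b : D.NR with b.node = D.τ i, F b = ∏ b : D.NR with b.node = i, F b.flip := by
  refine Finset.prod_nbij' NR.flip NR.flip ?_ ?_ ?_ ?_ ?_ <;>
    simp only [Finset.mem_filter, Finset.mem_univ, true_and, NR.node_flip hD, NR.flip_flip,
      implies_true]
  · intro a h; rw [h, hD.ττ]
  · intro a h; rw [h]

@[to_additive]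
theorem prod_by_node (P : I → Prop) (F : D.NR → M) :
    ∏ b : D.NR with P b.node, F b = ∏ j with P j, ∏ b : D.NR with b.node = j, F b := by
  rw [← Finset.prod_fiberwise_of_maps_to (s := Finset.univ.filter fun b : D.NR => P b.node)
    (t := Finset.univ.filter P) (g := NR.node) (by simp)]
  refine Finset.prod_congr rfl fun j hj => Finset.prod_congr ?_ fun _ _ => rfl
  ext b
  simp only [Finset.mem_filter, Finset.mem_univ, true_and] at hj ⊢
  exact ⟨fun h => h.2, fun h => ⟨h ▸ hj, h⟩⟩

end Products

/-- The number of a signed variable among the variables of its node. -/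
def NR.num (b : D.NR) : ℕ := if b.2 then b.1.2 + 1 else D.fv (D.τ b.1.1) - b.1.2

theorem len_add (hD : D.Admissible) {i : I} (hi : D.τ i ≠ i) : D.len i + D.len (D.τ i) = D.fv i := by
  rw [len, len, hD.τ_eq_iff, if_neg hi, if_neg hi, hD.zeta i hi]

theorem prod_nonfixed {M : Type*} [CommMonoid M] (hD : D.Admissible) {i : I} (hi : D.τ i ≠ i)
    (f : ℕ → M) : ∏ r ∈ Finset.Icc 1 (D.fv i), f r = ∏ b : D.NR with b.node = i, f b.num := by
  rw [prod_NR hD, prod_T i _ f (fun r => by simp [NR.num]),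
    prod_T (D.τ i) _ (fun r => f (D.fv i + 1 - r)) (fun r => by
      simp [NR.num, hD.ττ])]
  have h := len_add hD hi
  have h1 : ∏ r ∈ Finset.Icc 1 (D.len (D.τ i)), f (D.fv i + 1 - r) =
      ∏ r ∈ Finset.Ico (D.len i + 1) (D.fv i + 1), f r := by
    refine Finset.prod_nbij' (fun r => D.fv i + 1 - r) (fun r => D.fv i + 1 - r) ?_ ?_ ?_ ?_ ?_
    all_goals simp
    all_goals intros
    all_goals omega
  rw [h1, show Finset.Icc 1 (D.fv i) = Finset.Ico 1 (D.fv i + 1) from rfl,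
    show Finset.Icc 1 (D.len i) = Finset.Ico 1 (D.len i + 1) from rfl,
    Finset.prod_Ico_consecutive _ (by omega) (by omega)]

theorem w_num (hD : D.Admissible) (b : D.NR) (hb : D.τ b.node ≠ b.node) :
    b.w = D.w b.node b.num := by
  rcases b with ⟨⟨i, r⟩, _ | _⟩
  · simp only [NR.w, NR.node, NR.num, Bool.false_eq_true, if_false] at hb ⊢
    have hi : D.τ i ≠ i := by rwa [Ne, hD.τ_eq_iff] at hb
    have h1 := len_add hD hi
    have h2 : (r : ℕ) < D.len i := r.2
    have h3 := hD.fv_τ i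
    have hm := hD.mem_τ hi
    by_cases h : D.mem i
    · have h' : ¬ D.mem (D.τ i) := by rw [hm]; exact not_not.2 h
      rw [om, Datum.w, Datum.w, if_pos h, if_neg h', hD.ττ]
      congr 2
      dsimp only
      omega
    · have h' : D.mem (D.τ i) := by rwa [hm]
      rw [om, Datum.w, Datum.w, if_neg h, if_pos h', neg_neg]
      congr 1
      dsimp only
      omega
  · simp [NR.w, NR.node, NR.num, om]

theorem num_injOn (hD : D.Admissible) {a b : D.NR} (h : a.node = b.node) (hn : a.num = b.num)
    (hf : D.τ a.node ≠ a.node) : a = b := by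
  rcases a with ⟨⟨i, r⟩, p⟩
  rcases b with ⟨⟨j, s⟩, q⟩
  have hr : (r : ℕ) < D.len i := r.2
  have hs : (s : ℕ) < D.len j := s.2
  cases p <;> cases q <;>
    simp only [NR.node, NR.num, if_true, if_false, Bool.false_eq_true] at h hn hf
  · obtain rfl := hD.τ_inj.1 h
    have h1 := len_add hD (i := i) (by rwa [Ne, hD.τ_eq_iff] at hf)
    have := hD.fv_τ i
    have : r = s := Fin.ext (by omega)
    rw [this]
  · subst h
    have h1 := len_add hD (i := i) (by rwa [Ne, hD.τ_eq_iff] at hf)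
    have := hD.fv_τ i
    exfalso; omega
  · subst h
    have h1 := len_add hD (i := j) (by rwa [hD.ττ, ne_comm] at hf)
    have := hD.fv_τ j
    exfalso; omega
  · subst h
    have : r = s := Fin.ext (by omega)
    rw [this]

open Polynomial

theorem theta_eq_zero {i : I} (hi : D.τ i ≠ i) : D.theta i = 0 := by rw [theta, if_neg hi]

theorem bW_eq (hD : D.Admissible) (i : I) :
    D.bW i = X ^ D.theta i * ∏ b : D.NR with b.node = i, (X - C b.w) := by
  rw [bW]
  split_ifs with hi
  · rw [prod_NR hD, hi, ← Finset.prod_mul_distrib,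
      prod_T i _ (fun r => X ^ 2 - C (D.w i r) ^ 2)]
    · rw [len, if_pos hi]
    · intro r
      simp only [NR.w, om, Bool.false_eq_true, if_true, if_false, map_neg]
      ring
  · rw [theta_eq_zero hi, pow_zero, one_mul, prod_nonfixed hD hi]
    refine Finset.prod_congr rfl fun b hb => ?_
    have hb' : b.node = i := by simpa using hb
    rw [w_num hD b (by rwa [hb']), hb']

theorem W_eq (i : I) : D.W i = ∏ t with t.1 = i, (X - C (om t)) := by
  rw [prod_T i _ (fun r => X - C (D.w i r)) (fun r => rfl), W, len]
  split_ifs <;> rfl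

theorem bWr_eval (hD : D.Admissible) (t : D.T) :
    (D.bWr t.1 (t.2 + 1)).eval (om t) =
      om t ^ D.theta t.1 * ∏ b ∈ (Finset.univ.filter fun b : D.NR => b.node = t.1).erase (t, true),
        (om t - b.w) := by
  have hn : NR.node (t, true) = t.1 := rfl
  have h0 : ∏ b ∈ (Finset.univ.filter fun b : D.NR => b.node = t.1).erase (t, true),
      (om t - b.w) = ∏ b : D.NR with b.node = t.1, if b = (t, true) then 1 else om t - b.w := by
    rw [← Finset.mul_prod_erase (Finset.univ.filter fun b : D.NR => b.node = t.1) _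
      (a := (t, true)) (by simp [hn]), if_pos rfl, one_mul]
    refine Finset.prod_congr rfl fun b hb => ?_
    rw [if_neg (Finset.ne_of_mem_erase hb)]
  have h1 : ∀ f : ℕ → D.K, ∏ r ∈ (Finset.Icc 1 (D.fv t.1)).erase (t.2 + 1), f r =
      ∏ r ∈ Finset.Icc 1 (D.fv t.1), if r = t.2 + 1 then 1 else f r := by
    intro f
    by_cases hm : (t.2 : ℕ) + 1 ∈ Finset.Icc 1 (D.fv t.1)
    · rw [← Finset.mul_prod_erase _ _ hm, if_pos rfl, one_mul]
      refine Finset.prod_congr rfl fun b hb => ?_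
      rw [if_neg (Finset.ne_of_mem_erase hb)]
    · rw [Finset.erase_eq_of_notMem hm]
      refine Finset.prod_congr rfl fun b hb => ?_
      rw [if_neg (by rintro rfl; exact hm hb)]
  rw [h0, bWr]
  split_ifs with hi
  · simp only [eval_mul, eval_pow, eval_X, eval_add, eval_C, eval_prod, eval_sub]
    rw [h1, prod_NR hD, hi, mul_assoc]
    congr 1
    have e1 : ∏ s with s.1 = t.1, (if ((s, true) : D.NR) = (t, true) then 1 else
        om t - NR.w (s, true)) = ∏ r ∈ Finset.Icc 1 (D.fv t.1),
        if r = t.2 + 1 then 1 else om t - D.w t.1 r := by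
      have hlen : D.len t.1 = D.fv t.1 := by rw [len, if_pos hi]
      rw [prod_T t.1 _ (fun r => if r = t.2 + 1 then 1 else om t - D.w t.1 r), ← hlen]
      intro r
      have : ((⟨t.1, r⟩, true) : D.NR) = (t, true) ↔ (r : ℕ) + 1 = t.2 + 1 := by
        rcases t with ⟨i, s⟩
        simp [Fin.ext_iff]
      simp only [this, NR.w, om, if_true]
    have e2 : ∏ s with s.1 = t.1, (if ((s, false) : D.NR) = (t, true) then 1 else
        om t - NR.w (s, false)) = 2 * om t * ∏ r ∈ Finset.Icc 1 (D.fv t.1),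
        if r = t.2 + 1 then 1 else om t + D.w t.1 r := by
      have hf : ∀ s : D.T, ¬ ((s, false) : D.NR) = (t, true) := by simp
      simp only [hf, if_false]
      have hlen : D.len t.1 = D.fv t.1 := by rw [len, if_pos hi]
      rw [prod_T t.1 _ (fun r => om t + D.w t.1 r), ← hlen,
        ← Finset.mul_prod_erase (Finset.Icc 1 (D.len t.1)) (fun r => om t + D.w t.1 r)
          (a := t.2 + 1) (by simp), ← Finset.mul_prod_erase (Finset.Icc 1 (D.len t.1))
          (fun r => if r = (t.2 : ℕ) + 1 then 1 else om t + D.w t.1 r)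
          (a := t.2 + 1) (by simp), if_pos rfl, one_mul]
      · congr 1
        · rw [om]; ring
        · refine Finset.prod_congr rfl fun b hb => ?_
          rw [if_neg (Finset.ne_of_mem_erase hb)]
      · intro r
        simp only [NR.w, om, Bool.false_eq_true, if_false]; ring
    rw [e1, e2, mul_left_comm, ← Finset.prod_mul_distrib, show D.w t.1 (t.2 + 1) = om t from rfl,
      two_mul]
    congr 1
    refine Finset.prod_congr rfl fun r _ => ?_
    split_ifs
    · rw [one_mul]
    · ring
  · simp only [eval_prod, eval_sub, eval_X, eval_C]
    rw [theta_eq_zero hi, pow_zero, one_mul, h1, prod_nonfixed hD hi]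
    refine Finset.prod_congr rfl fun b hb => ?_
    have hb' : b.node = t.1 := by simpa using hb
    have h2 : b.num = t.2 + 1 ↔ b = (t, true) := by
      refine ⟨fun h => num_injOn hD (by rw [hb']; rfl) (h.trans (by simp [NR.num])) (by rwa [hb']), ?_⟩
      rintro rfl; simp [NR.num]
    simp only [h2]
    rw [w_num hD b (by rwa [hb']), hb']

theorem bWr_eval' (hD : D.Admissible) (a : D.NR) :
    (D.bWr a.1.1 (a.1.2 + 1)).eval (om a.1) =
      (a.sgn * a.w) ^ D.theta a.node *
        ∏ b ∈ (Finset.univ.filter fun b : D.NR => b.node = a.node).erase a,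
        (a.sgn * (a.w - b.w)) := by
  rw [bWr_eval hD]
  rcases a with ⟨t, _ | _⟩
  · have hs : NR.sgn ((t, false) : D.NR) = -1 := by simp [NR.sgn]
    have hw : NR.w ((t, false) : D.NR) = -om t := by simp [NR.w]
    have hn : NR.node ((t, false) : D.NR) = D.τ t.1 := by simp [NR.node]
    rw [hs, hw, hn, hD.theta_τ]
    congr 1
    · ring
    · refine Finset.prod_nbij' NR.flip NR.flip ?_ ?_ ?_ ?_ ?_ <;>
        simp only [Finset.mem_erase, Finset.mem_filter, Finset.mem_univ, true_and,
        NR.flip_flip, implies_true]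
      · rintro b ⟨h1, h2⟩
        refine ⟨fun h => h1 ?_, by rw [NR.node_flip hD, h2]⟩
        rw [← NR.flip_flip b, h]; rfl
      · rintro b ⟨h1, h2⟩
        refine ⟨fun h => h1 ?_, by rw [NR.node_flip hD, h2, hD.ττ]⟩
        rw [← NR.flip_flip b, h]; rfl
      · intro b _
        rw [NR.w_flip]; ring
  · have hs : NR.sgn ((t, true) : D.NR) = 1 := by simp [NR.sgn]
    have hw : NR.w ((t, true) : D.NR) = om t := by simp [NR.w]
    have hn : NR.node ((t, true) : D.NR) = t.1 := by simp [NR.node]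
    rw [hs, hw, hn]
    simp only [one_mul]

theorem bW_eval (hD : D.Admissible) (i : I) (v : D.K) :
    (D.bW i).eval v = v ^ D.theta i * ∏ b : D.NR with b.node = i, (v - b.w) := by
  rw [bW_eq hD]; simp [eval_prod]

theorem bW_τ_eval (hD : D.Admissible) (i : I) (v : D.K) :
    (D.bW (D.τ i)).eval v = v ^ D.theta i * ∏ b : D.NR with b.node = i, (v + b.w) := by
  rw [bW_eval hD, hD.theta_τ, prod_flip hD]; simp

theorem prod_g (hD : D.Admissible) (a : D.NR) :
    ∏ b ∈ Finset.univ.erase a, a.g b =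
      (∏ b ∈ (Finset.univ.filter fun b : D.NR => b.node = a.node).erase a,
        (a.sgn * (a.w - b.w)))⁻¹ *
      ∏ j with D.adj a.node j, ∏ b : D.NR with b.node = j, (a.sgn * (a.x - b.w)) ^ a.nexp b := by
  have h1 : ∀ b : D.NR, a.g b = (if b.node = a.node then (a.sgn * (a.w - b.w))⁻¹ else 1) *
      (if D.adj a.node b.node then (a.sgn * (a.x - b.w)) ^ a.nexp b else 1) := by
    intro b
    rw [NR.g, hD.adj_iff]
    by_cases h : b.node = a.node
    · rw [h, hD.c_self]; simp
    · have := hD.c_off _ _ (fun e => h e.symm : ¬ a.node = b.node)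
      rw [if_neg h, one_mul, if_neg (by rcases this with h' | h' <;> rw [h'] <;> norm_num)]
      congr 1
  rw [Finset.prod_congr rfl fun b _ => h1 b, Finset.prod_mul_distrib, ← prod_by_node,
    ← Finset.prod_inv_distrib]
  congr 1
  · rw [← Finset.prod_filter]
    refine Finset.prod_congr ?_ fun _ _ => rfl
    ext b; simp [and_comm]
  · rw [Finset.prod_filter]
    refine Finset.prod_subset (Finset.erase_subset _ _) fun b _ hb => ?_
    have : b = a := by simpa using hb
    rw [this, if_neg (hD.not_adj_self _)]

@[to_additive]
theorem prod_adj_split {M : Type*} [CommMonoid M] (hD : D.Admissible) (i : I) (F : I → M) :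
    ∏ j with D.adj i j, F j = (∏ j with D.arrow j i, F j) * ∏ j with D.arrow i j, F j := by
  rw [← Finset.prod_union]
  · congr 1
    ext j; simp only [Finset.mem_filter, Finset.mem_univ, true_and, Finset.mem_union]; rfl
  · rw [Finset.disjoint_filter]
    intro j _ h h'
    exact hD.arrow_asymm h h'

end Datum

end

section

namespace Datum

universe uI
variable {I : Type uI} {D : Datum I} [Fintype I]

open Polynomial

theorem kap_eq (hD : D.Admissible) (a : D.NR) : D.kap a.w = a.x / a.w := by
  have := NR.w_ne_zero hD a
  rw [kap, NR.x]; field_simp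

theorem sgn_x (a : D.NR) : a.sgn * a.x = (if a.2 then om a.1 - 1 / 2 else om a.1 + 1 / 2) := by
  rcases a with ⟨t, _ | _⟩ <;> simp [NR.sgn, NR.x, NR.w, add_comm]

theorem X_of_nonfixed (hD : D.Admissible) (Zs : I → D.ZRing[X]) (a : D.NR)
    (ha : D.τ a.node ≠ a.node) :
    a.X Zs = D.zeval (a.Zp Zs) (a.sgn * a.x) / (D.bWr a.1.1 (a.1.2 + 1)).eval (om a.1) *
      ∏ j with D.arrow j a.node, ((a.sgn * a.x) ^ D.theta j *
        ∏ b : D.NR with b.node = j, (a.sgn * (a.x - b.w))) := by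
  rw [NR.X, NR.kappa, prod_g hD, bWr_eval' hD, if_neg ha, theta_eq_zero ha, pow_zero, one_mul, NR.zexp,
    if_neg ha, prod_adj_split hD, Finset.prod_mul_distrib (f := fun j => (a.sgn * a.x) ^ D.theta j),
    ← Finset.prod_pow_eq_pow_sum]
  have h1 : ∏ j with D.arrow j a.node, ∏ b : D.NR with b.node = j, (a.sgn * (a.x - b.w)) ^ a.nexp b =
      ∏ j with D.arrow j a.node, ∏ b : D.NR with b.node = j, (a.sgn * (a.x - b.w)) := by
    refine Finset.prod_congr rfl fun j hj => Finset.prod_congr rfl fun b hb => ?_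
    simp only [Finset.mem_filter, Finset.mem_univ, true_and] at hj hb
    subst hb
    rw [NR.nexp, if_pos hj, if_neg (fun h => ha h.1), pow_one]
  have h2 : ∏ j with D.arrow a.node j, ∏ b : D.NR with b.node = j, (a.sgn * (a.x - b.w)) ^ a.nexp b =
      1 := by
    refine Finset.prod_eq_one fun j hj => Finset.prod_eq_one fun b hb => ?_
    simp only [Finset.mem_filter, Finset.mem_univ, true_and] at hj hb
    subst hb
    rw [NR.nexp, if_neg (hD.arrow_asymm hj), if_pos hj, if_neg (fun h => ha h.1), pow_zero]
  rw [h1, h2]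
  ring

theorem X_of_fixed (hD : D.Admissible) (Zs : I → D.ZRing[X]) (a : D.NR)
    (ha : D.τ a.node = a.node) :
    a.X Zs = (D.kap a.w ^ D.vartheta a.node)⁻¹ * D.zeval (a.Zp Zs) (a.sgn * a.x)
      / (D.bWr a.1.1 (a.1.2 + 1)).eval (om a.1) *
      ((if a.2 then ∏ j with D.adj a.node j, (a.sgn * a.x) ^ D.theta j else 1) *
      ∏ j with D.adj a.node j,
        ∏ b : D.NR with b.node = j, (a.sgn * (a.x - b.w)) ^ a.nexp b) := by
  rw [NR.X, NR.kappa, prod_g hD, bWr_eval' hD, if_pos ha, NR.zexp, if_pos ha,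
    Finset.prod_pow_eq_pow_sum, div_eq_mul_inv _ (_ * _), mul_inv]
  split_ifs
  · ring
  · rw [pow_zero]; ring

theorem X_nonfixed_true (hD : D.Admissible) (Zs : I → D.ZRing[X]) (t : D.T) (ht : D.τ t.1 ≠ t.1) :
    NR.X Zs (t, true) = D.zeval (D.Z Zs t.1) (om t - 1 / 2)
      / (D.bWr t.1 (t.2 + 1)).eval (om t) *
        (∏ j with D.arrow j t.1, (D.bW j).eval (om t - 1 / 2)) := by
  have hn : NR.node ((t, true) : D.NR) = t.1 := by simp [NR.node]
  rw [X_of_nonfixed hD Zs _ (by rwa [hn]), sgn_x, hn, NR.Zp, if_pos rfl, if_pos rfl, hn]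
  refine congrArg₂ _ rfl (Finset.prod_congr rfl fun j _ => ?_)
  rw [bW_eval hD]
  refine congrArg₂ _ rfl (Finset.prod_congr rfl fun b _ => ?_)
  rw [mul_sub, sgn_x, if_pos rfl]
  simp [NR.sgn]

theorem X_nonfixed_false (hD : D.Admissible) (Zs : I → D.ZRing[X]) (i : I) (t : D.T) (hi : D.τ i ≠ i)
    (ht : t.1 = D.τ i) :
    NR.X Zs (t, false) = D.zeval (minus (D.Z Zs i)) (om t + 1 / 2)
      / (D.bWr t.1 (t.2 + 1)).eval (om t) *
        (∏ j with D.arrow (D.τ i) (D.τ j), (D.bW (D.τ j)).eval (om t + 1 / 2)) := by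
  have hn : NR.node ((t, false) : D.NR) = i := by simp [NR.node, ht, hD.ττ]
  rw [X_of_nonfixed hD Zs _ (by rwa [hn]), sgn_x, hn, NR.Zp, if_neg Bool.false_ne_true, if_neg Bool.false_ne_true, hn,
    if_neg hi]
  refine congrArg₂ _ rfl ?_
  have hset : (Finset.univ.filter fun j => D.arrow (D.τ i) (D.τ j)) =
      Finset.univ.filter fun j => D.arrow j i := by
    ext j
    simp only [Finset.mem_filter, Finset.mem_univ, true_and]
    exact hD.arrow_τ (Or.inr hi)
  rw [hset]
  refine Finset.prod_congr rfl fun j _ => ?_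
  rw [bW_τ_eval hD]
  refine congrArg₂ _ rfl (Finset.prod_congr rfl fun b _ => ?_)
  rw [mul_sub, sgn_x, if_neg Bool.false_ne_true]
  simp [NR.sgn]

theorem Wbar_eval (i : I) (v : D.K) :
    (D.Wbar i).eval v = v ^ D.theta i * ∏ t with t.1 = i, (v + om t) := by
  rw [Wbar, W_eq, minus_prod_linear]; simp [eval_prod]

theorem W_eval (i : I) (v : D.K) : (D.W i).eval v = ∏ t with t.1 = i, (v - om t) := by
  rw [W_eq]; simp [eval_prod]

theorem X_fixed_true (hD : D.Admissible) (Zs : I → D.ZRing[X]) (t : D.T) (ht : D.τ t.1 = t.1) :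
    NR.X Zs (t, true) = (D.kap (om t) ^ D.vartheta t.1)⁻¹
            * D.zeval (D.Z Zs t.1) (om t - 1 / 2) / (D.bWr t.1 (t.2 + 1)).eval (om t)
          * (∏ j with D.arrow j t.1, (D.bW j).eval (om t - 1 / 2))
          * (∏ j with D.arrow t.1 j ∧ D.τ j = j, (D.Wbar j).eval (om t - 1 / 2)) := by
  have hn : NR.node ((t, true) : D.NR) = t.1 := by simp [NR.node]
  have hw : NR.w ((t, true) : D.NR) = om t := by simp [NR.w]
  have hs : NR.sgn ((t, true) : D.NR) = 1 := by simp [NR.sgn]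
  have hx : NR.x ((t, true) : D.NR) = om t - 1 / 2 := by rw [NR.x, hw]
  rw [X_of_fixed hD Zs _ (by rwa [hn]), hn, NR.Zp, if_pos rfl, if_pos rfl, hn, hw, hs, hx, one_mul,
    mul_assoc (_ / _), ← Finset.prod_mul_distrib, prod_adj_split hD]
  refine congrArg₂ _ rfl (congrArg₂ _ ?_ ?_)
  · refine Finset.prod_congr rfl fun j hj => ?_
    rw [bW_eval hD]
    refine congrArg₂ _ rfl (Finset.prod_congr rfl fun b hb => ?_)
    simp only [Finset.mem_filter, Finset.mem_univ, true_and] at hj hb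
    subst hb
    rw [NR.nexp, hn, if_pos hj]
    simp
  · rw [← Finset.filter_filter, Finset.prod_filter (p := fun j => D.τ j = j)]
    refine Finset.prod_congr rfl fun j hj => ?_
    simp only [Finset.mem_filter, Finset.mem_univ, true_and] at hj
    have hb : ∀ b : D.NR, b.node = j →
        NR.nexp (t, true) b = if D.τ j = j ∧ b.2 = false then 1 else 0 := by
      rintro b rfl
      rw [NR.nexp, hn, if_neg (hD.arrow_asymm hj), if_pos hj]
      by_cases h : D.τ b.node = b.node
      · simp only [h, ht, and_self, if_true, true_and]
        cases b.2 <;> simp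
      · simp [h]
    rw [Finset.prod_congr rfl fun b hb' => by
      rw [hb b (by simpa using hb')]]
    split_ifs with hj'
    · rw [Wbar_eval, prod_NR hD, hj']
      simp [NR.w]
    · simp [hj', theta_eq_zero hj']

theorem X_fixed_false (hD : D.Admissible) (Zs : I → D.ZRing[X]) (t : D.T) (ht : D.τ t.1 = t.1) :
    NR.X Zs (t, false) = (D.kap (-om t) ^ D.vartheta t.1)⁻¹
            * D.zeval (D.Zbar Zs t.1) (om t + 1 / 2) / (D.bWr t.1 (t.2 + 1)).eval (om t)
          * (∏ j with D.arrow t.1 j ∧ D.τ j ≠ j, (D.bW j).eval (om t + 1 / 2))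
          * (∏ j with D.arrow t.1 j ∧ D.τ j = j, (D.W j).eval (om t + 1 / 2)) := by
  have hn : NR.node ((t, false) : D.NR) = t.1 := by simp [NR.node, ht]
  have hw : NR.w ((t, false) : D.NR) = -om t := by simp [NR.w]
  have hs : NR.sgn ((t, false) : D.NR) = -1 := by simp [NR.sgn]
  have hx : -1 * NR.x ((t, false) : D.NR) = om t + 1 / 2 := by rw [NR.x, hw]; ring
  rw [X_of_fixed hD Zs _ (by rwa [hn]), hn, NR.Zp, if_neg Bool.false_ne_true, if_neg Bool.false_ne_true, hn, if_pos ht,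
    hw, hs, hx, one_mul, mul_assoc (_ / _), prod_adj_split hD]
  refine congrArg₂ _ rfl (congrArg₂ _ ?_ ?_)
  · have h1 : ∏ j with D.arrow t.1 j ∧ D.τ j ≠ j, (D.bW j).eval (om t + 1 / 2) =
        ∏ j with D.arrow j t.1 ∧ D.τ j ≠ j, (D.bW (D.τ j)).eval (om t + 1 / 2) := by
      refine Finset.prod_nbij' D.τ D.τ ?_ ?_ ?_ ?_ ?_ <;>
        simp only [Finset.mem_filter, Finset.mem_univ, true_and, hD.ττ, implies_true]
      · rintro j ⟨h1, h2⟩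
        refine ⟨?_, fun e => h2 e.symm⟩
        have := (hD.arrow_τ (Or.inr h2)).2 h1
        rwa [ht] at this
      · rintro j ⟨h1, h2⟩
        refine ⟨?_, fun e => h2 e.symm⟩
        have := (hD.arrow_τ (Or.inl h2)).2 h1
        rwa [ht] at this
    rw [h1, ← Finset.filter_filter, Finset.prod_filter (p := fun j => D.τ j ≠ j)]
    refine Finset.prod_congr rfl fun j hj => ?_
    simp only [Finset.mem_filter, Finset.mem_univ, true_and] at hj
    have hb : ∀ b : D.NR, b.node = j →
        NR.nexp (t, false) b = if D.τ j ≠ j then 1 else 0 := by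
      rintro b rfl
      rw [NR.nexp, hn, if_pos hj]
      simp only [ht, true_and, Bool.false_eq_true, if_false]
      split_ifs <;> simp_all
    rw [Finset.prod_congr rfl fun b hb' => by
      rw [hb b (by simpa using hb'), mul_sub, hx]]
    split_ifs with hj'
    · rw [bW_τ_eval hD, theta_eq_zero hj', pow_zero, one_mul]
      refine Finset.prod_congr rfl fun b _ => ?_
      ring
    · simp
  · rw [← Finset.filter_filter, Finset.prod_filter (p := fun j => D.τ j = j)]
    refine Finset.prod_congr rfl fun j hj => ?_
    simp only [Finset.mem_filter, Finset.mem_univ, true_and] at hj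
    have hb : ∀ b : D.NR, b.node = j →
        NR.nexp (t, false) b = if D.τ j = j ∧ b.2 = false then 1 else 0 := by
      rintro b rfl
      rw [NR.nexp, hn, if_neg (hD.arrow_asymm hj), if_pos hj]
      by_cases h : D.τ b.node = b.node
      · simp only [h, ht, and_self, if_true, true_and]
        cases b.2 <;> simp
      · simp [h]
    rw [Finset.prod_congr rfl fun b hb' => by
      rw [hb b (by simpa using hb'), mul_sub, hx]]
    split_ifs with hj'
    · rw [W_eval, prod_NR hD, hj']
      simp only [NR.w, true_and, Bool.true_eq_false, if_false, pow_zero, Finset.prod_const_one,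
        one_mul, if_true, Bool.false_eq_true, pow_one]
      refine Finset.prod_congr rfl fun s _ => ?_
      ring
    · simp [hj']

theorem prod_f₀ (hD : D.Admissible) (i : I) : ∏ t : D.T, f₀ i t =
    (∏ t with t.1 = i, (1 / 4 - om t ^ 2))⁻¹ * ∏ t : D.T with D.adj i t.1, -om t := by
  have h3 : ∀ t : D.T, f₀ i t = (if t.1 = i then (1 / 4 - om t ^ 2)⁻¹ else 1) *
      (if D.adj i t.1 then -om t else 1) := by
    intro t
    rw [f₀, hD.adj_iff]
    by_cases h : t.1 = i
    · rw [h, hD.c_self]; simp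
    · have := hD.c_off i t.1 (fun e => h e.symm)
      rw [if_neg h, one_mul, if_neg (by rcases this with h' | h' <;> rw [h'] <;> norm_num)]
      congr 1
  rw [Finset.prod_congr rfl fun t _ => h3 t, Finset.prod_mul_distrib, ← Finset.prod_filter,
    ← Finset.prod_filter, Finset.prod_inv_distrib]

theorem X₀_eq (hD : D.Admissible) (Zs : I → D.ZRing[X]) (ε : I → ℂ) {i : I} (hi : D.theta i = 1) :
    D.X₀ Zs ε i = -(algebraMap ℂ D.K (ε i)
      * ((D.theta i : D.K) * D.zeval (D.Z Zs i) 0 / (D.Wcirc i).eval (1 / 2))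
      * (∏ j with D.adj i j, (D.W j).eval 0)) := by
  have hfix := fixed_of_theta hi
  have h1 : (D.Wcirc i).eval (1 / 2) = ∏ t with t.1 = i, (1 / 4 - om t ^ 2) := by
    rw [prod_T i _ (fun r => 1 / 4 - D.w i r ^ 2) (fun r => rfl), Wcirc, eval_prod, len, if_pos hfix]
    refine Finset.prod_congr rfl fun r _ => ?_
    simp; ring
  have h2 : ∏ j with D.adj i j, (D.W j).eval 0 = ∏ t : D.T with D.adj i t.1, -om t := by
    rw [← Finset.prod_fiberwise_of_maps_to (s := Finset.univ.filter fun t : D.T => D.adj i t.1)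
      (t := Finset.univ.filter fun j => D.adj i j) (g := Sigma.fst) (by simp)]
    refine Finset.prod_congr rfl fun j hj => ?_
    rw [W_eval]
    refine Finset.prod_congr ?_ fun _ _ => zero_sub _
    ext t
    simp only [Finset.mem_filter, Finset.mem_univ, true_and] at hj ⊢
    exact ⟨fun h => ⟨h ▸ hj, h⟩, fun h => h.2⟩
  rw [X₀, prod_f₀ hD, h1, h2, hi]
  push_cast
  ring

theorem sys_B (hD : D.Admissible) (Zs : I → D.ZRing[X]) (ε : I → ℂ) (i : I) (p : ℕ) :
    (sys hD Zs ε).B i p = -(∑ t with t.1 = i, op (NR.X Zs (t, true) * (om t - 1 / 2) ^ p) (-eT t))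
      - (∑ t with t.1 = D.τ i, op (NR.X Zs (t, false) * (-om t - 1 / 2) ^ p) (eT t))
      - (if D.theta i = 1 then scal (D.X₀ Zs ε i * 0 ^ p) else 0) := by
  have h : ∑ a with (sys hD Zs ε).nd a = i, (sys hD Zs ε).t a p =
      ∑ b : D.NR with b.node = i, op (b.X Zs * b.x ^ p) b.sh +
      (if D.theta i = 1 then scal (D.X₀ Zs ε i * 0 ^ p) else 0) := by
    rw [Finset.sum_filter, Fintype.sum_sum_type, Finset.sum_filter]
    congr 1
    · refine Finset.sum_congr rfl fun b _ => ?_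
      have : (sys hD Zs ε).t (Sum.inl b) p = op (b.X Zs * b.x ^ p) b.sh := by
        rw [mul_comm]; exact smul_op _ _ _
      rw [this]; rfl
    · have h1 : ∀ k : {i : I // D.theta i = 1}, (sys hD Zs ε).t (Sum.inr k) p =
          scal (D.X₀ Zs ε k * 0 ^ p) := by
        intro k; rw [mul_comm]; exact smul_op _ _ _
      split_ifs with hi
      · rw [Finset.sum_eq_single ⟨i, hi⟩]
        · rw [h1]; exact if_pos rfl
        · intro k _ hk
          exact if_neg fun e => hk (Subtype.ext e)
        · simp
      · refine Finset.sum_eq_zero fun k _ => if_neg ?_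
        rintro rfl
        exact hi k.2
  rw [ShiftSystem.B, h, sum_NR hD, neg_add, neg_add, sub_eq_add_neg, sub_eq_add_neg]
  rfl

theorem coeff_neg_linear (c : D.K) (s : ℕ+) :
    ((D.u + 1 / 2 - D.const c)⁻¹).coeff (s : ℤ) = (c - 1 / 2) ^ ((s : ℕ) - 1) := by
  have h : D.u + 1 / 2 - D.const c = invVar D.K - HahnSeries.C (c - 1 / 2) := by
    rw [map_sub, map_div₀, map_one, map_ofNat]
    change D.u + _ - D.const c = D.u - (D.const c - _)
    ring
  have hs := s.pos
  rw [h, coeff_inv_linear, if_pos (by omega)]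
  congr 1; omega

theorem coeff_pos_linear (c : D.K) (s : ℕ+) :
    ((D.u + 1 / 2 + D.const c)⁻¹).coeff (s : ℤ) = (-c - 1 / 2) ^ ((s : ℕ) - 1) := by
  rw [← coeff_neg_linear, map_neg, sub_neg_eq_add]

theorem coeff_inv_u (s : ℕ+) : ((D.u)⁻¹).coeff (s : ℤ) = 0 ^ ((s : ℕ) - 1) := by
  have h : D.u = invVar D.K - HahnSeries.C 0 := by rw [map_zero, sub_zero]; rfl
  have hs := s.pos
  rw [h, coeff_inv_linear, if_pos (by omega)]
  congr 1; omega

theorem sys_B_nonfixed (hD : D.Admissible) (Zs : I → D.ZRing[X]) (ε : I → ℂ) (i : I)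
    (hi : D.τ i ≠ i) (s : ℕ+) : (sys hD Zs ε).B i ((s : ℕ) - 1) = D.BNonfixed Zs i s := by
  have hl : D.len i = D.zeta i := by rw [len, if_neg hi]
  have hl' : D.len (D.τ i) = D.zeta (D.τ i) := by rw [len, hD.τ_eq_iff, if_neg hi]
  rw [sys_B, if_neg (by rw [theta_eq_zero hi]; norm_num), sub_zero, BNonfixed, ← hl, ← hl']
  congr 1
  · congr 1
    refine sum_T i _ _ fun r => ?_
    rw [X_nonfixed_true hD Zs _ hi, coeff_neg_linear]
    rfl
  · refine sum_T _ _ _ fun r => ?_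
    rw [X_nonfixed_false hD Zs i _ hi rfl, coeff_pos_linear]
    rfl

theorem sys_B_fixed (hD : D.Admissible) (Zs : I → D.ZRing[X]) (ε : I → ℂ) (i : I)
    (hi : D.τ i = i) (s : ℕ+) : (sys hD Zs ε).B i ((s : ℕ) - 1) = D.BFixed Zs ε i s := by
  have hl : D.len i = D.fv i := by rw [len, if_pos hi]
  rw [sys_B, BFixed, ← hl, hi, sub_eq_add_neg _ (ite _ _ _)]
  congr 1
  · congr 1
    · congr 1
      refine sum_T i _ _ fun r => ?_
      rw [X_fixed_true hD Zs _ hi, coeff_neg_linear]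
      rfl
    · refine sum_T i _ _ fun r => ?_
      rw [X_fixed_false hD Zs _ hi, coeff_pos_linear]
      rfl
  · split_ifs with h
    · rw [X₀_eq hD Zs ε h, coeff_inv_u, scal_eq_smul, scal_eq_smul, ← neg_smul]
      congr 1; ring
    · have : D.theta i = 0 := by
        rw [theta, if_pos hi] at h ⊢; omega
      rw [this]
      simp [scal, op_zero_left]

end Datum

end

section

section SeriesMap

open Polynomial

variable {K : Type*} [Field K]

/-- `u - p`. -/
def lin (p : K) : LaurentSeries K := invVar K - HahnSeries.C p

theorem lin_ne_zero (p : K) : lin p ≠ 0 := linear_ne_zero p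

theorem mapSer_lin (σ : K →+* K) (p : K) : mapSer σ (lin p) = lin (σ p) := by
  rw [lin, map_sub, mapSer_invVar, mapSer_C, lin]

theorem evalU_X_sub_C (p : K) : evalU K (X - C p) = lin p := by simp [lin]

theorem mapSer_evalU (σ : K →+* K) (p : K[X]) : mapSer σ (evalU K p) = evalU K (p.map σ) := by
  induction p using Polynomial.induction_on' with
  | add p q hp hq => rw [map_add, map_add, Polynomial.map_add, map_add, hp, hq]
  | monomial n c =>
    rw [← C_mul_X_pow_eq_monomial]
    simp only [Polynomial.map_mul, Polynomial.map_pow, map_C, map_X, map_mul, map_pow, evalU_C,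
      evalU_X, mapSer_C, mapSer_invVar]

theorem coeff_lin_mul (p : K) (F : LaurentSeries K) (n : ℤ) :
    (lin p * F).coeff n = F.coeff (n + 1) - p * F.coeff n := by
  rw [lin, sub_mul, HahnSeries.coeff_sub, coeff_invVar_mul, coeff_C_mul']

theorem coeff_lin_lin (p q p' q' : K) (F G : LaurentSeries K)
    (h : lin p * lin q * F = lin p' * lin q' * G) (n : ℤ) :
    F.coeff (n + 2) - (p + q) * F.coeff (n + 1) + p * q * F.coeff n =
      G.coeff (n + 2) - (p' + q') * G.coeff (n + 1) + p' * q' * G.coeff n := by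
  have := congrArg (fun H => HahnSeries.coeff H n) h
  simp only [mul_assoc, coeff_lin_mul] at this
  rw [show n + 1 + 1 = n + 2 by ring] at this
  linear_combination this

end SeriesMap

namespace Datum

universe uI
variable {I : Type uI} {D : Datum I} [Fintype I]

open Polynomial

/-- The factor of `H_i(u)` contributed by a signed variable with value `w`. -/
def phi {K : Type*} [Field K] (c : ℤ) (w : K) : LaurentSeries K :=
  if c = 2 then (lin (w + 1 / 2) * lin (w - 1 / 2))⁻¹ else if c = -1 then lin w else 1

theorem mapSer_phi {K : Type*} [Field K] (σ : K →+* K) (c : ℤ) (w : K) :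
    mapSer σ (phi c w) = phi c (σ w) := by
  have h : σ (1 / 2) = 1 / 2 := by rw [map_div₀, map_one, map_ofNat]
  unfold phi
  split_ifs
  · rw [map_inv₀, map_mul, mapSer_lin, mapSer_lin, map_add, map_sub, h]
  · rw [mapSer_lin]
  · rw [map_one]

theorem phi_shift {K : Type*} [Field K] [CharZero K] (c : ℤ) (hc : c = 2 ∨ c = -1 ∨ c = 0) (w : K) :
    lin (w - 1 / 2 + c / 2) * phi c w = lin (w - 1 / 2 - c / 2) * phi c (w - 1) := by
  have h1 := lin_ne_zero (w + 1 / 2)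
  have h2 := lin_ne_zero (w - 1 / 2)
  have h3 := lin_ne_zero (w - 3 / 2)
  rcases hc with rfl | rfl | rfl
  · have e1 : w - 1 / 2 + ((2 : ℤ) : K) / 2 = w + 1 / 2 := by push_cast; ring
    have e2 : w - 1 / 2 - ((2 : ℤ) : K) / 2 = w - 3 / 2 := by push_cast; ring
    have e3 : w - 1 + 1 / 2 = w - 1 / 2 := by ring
    have e4 : w - 1 - 1 / 2 = w - 3 / 2 := by ring
    rw [phi, phi, if_pos rfl, if_pos rfl, e1, e2, e3, e4]
    generalize lin (w + 1 / 2) = A at *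
    generalize lin (w - 1 / 2) = B at *
    generalize lin (w - 3 / 2) = E at *
    field_simp
  · have e1 : w - 1 / 2 + ((-1 : ℤ) : K) / 2 = w - 1 := by push_cast; ring
    have e2 : w - 1 / 2 - ((-1 : ℤ) : K) / 2 = w := by push_cast; ring
    have e : ¬ (-1 : ℤ) = 2 := by norm_num
    rw [phi, phi, if_neg e, if_neg e, if_pos rfl, if_pos rfl, e1, e2]
    ring
  · simp [phi]

variable (D) in
/-- The factor of `H_i(u)` which does not involve the variables `w`. -/
def base (i : I) : D.Ser :=
  (1 + (D.wp i : D.Ser) / (4 * D.u)) *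
    ((1 - 1 / (4 * D.u ^ 2)) ^ D.vartheta i * evalU D.K ((D.bZ i).map D.zToK) /
      (lin (1 / 2) * lin (-1 / 2)) ^ D.theta i) *
    D.u ^ (∑ j with D.adj i j, D.theta j)

theorem seval_bW (hD : D.Admissible) (i : I) (q : D.K) :
    D.seval (D.bW i) (lin q) = lin q ^ D.theta i * ∏ b : D.NR with b.node = i, lin (b.w + q) := by
  have h : ∀ b : D.NR, lin q - D.const b.w = lin (b.w + q) := by
    intro b
    rw [lin, lin, map_add]
    change _ - _ - HahnSeries.C b.w = _
    ring
  rw [seval, bW_eq hD]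
  simp only [eval₂_mul, eval₂_pow, eval₂_X, eval₂_finsetProd, eval₂_sub, eval₂_C, h]

theorem neg_half : (-1 / 2 : D.K) = -(1 / 2) := by ring

theorem u_eq : D.u = lin (0 : D.K) := by rw [lin, map_zero, sub_zero]; rfl

theorem u_ne_zero : D.u ≠ 0 := invVar_ne_zero

theorem HSer_eq (hD : D.Admissible) (i : I) :
    D.HSer i = D.base i * ∏ b : D.NR, phi (D.cartan i b.node) b.w := by
  have e1 : D.u - 1 / 2 = lin (1 / 2 : D.K) := by
    rw [lin, map_div₀, map_one, map_ofNat]; rfl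
  have e2 : D.u + 1 / 2 = lin (-1 / 2 : D.K) := by
    rw [lin, neg_half, map_neg, map_div₀, map_one, map_ofNat, sub_neg_eq_add]; rfl
  have e3 : ∏ j with D.adj i j, D.seval (D.bW j) D.u =
      D.u ^ (∑ j with D.adj i j, D.theta j) *
        ∏ b : D.NR, if D.cartan i b.node = -1 then lin b.w else 1 := by
    rw [← Finset.prod_pow_eq_pow_sum, ← Finset.prod_filter, u_eq]
    have : (Finset.univ.filter fun b : D.NR => D.cartan i b.node = -1) =
        Finset.univ.filter fun b : D.NR => D.adj i b.node := by
      ext b; simp only [Finset.mem_filter, hD.adj_iff]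
    rw [this, prod_by_node (fun j => D.adj i j), ← Finset.prod_mul_distrib]
    refine Finset.prod_congr rfl fun j _ => ?_
    rw [seval_bW hD]
    simp
  have e4 : ∏ b : D.NR, phi (D.cartan i b.node) b.w =
      (∏ b : D.NR with b.node = i, (lin (b.w + 1 / 2) * lin (b.w - 1 / 2)))⁻¹ *
        ∏ b : D.NR, if D.cartan i b.node = -1 then lin b.w else 1 := by
    rw [← Finset.prod_inv_distrib, Finset.prod_filter, ← Finset.prod_mul_distrib]
    refine Finset.prod_congr rfl fun b _ => ?_
    rw [phi]
    by_cases h : b.node = i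
    · rw [h, hD.c_self, if_pos rfl, if_pos rfl, if_neg (by norm_num), mul_one]
    · have := hD.c_off i b.node (fun e => h e.symm)
      rw [if_neg (by rcases this with h' | h' <;> rw [h'] <;> norm_num), if_neg h, one_mul]
  rw [HSer, base, e1, e2, e3, e4, seval_bW hD, seval_bW hD, Finset.prod_mul_distrib]
  have e5 : ∏ b : D.NR with b.node = i, lin (b.w + -1 / 2) =
      ∏ b : D.NR with b.node = i, lin (b.w - 1 / 2) :=
    Finset.prod_congr rfl fun b _ => by rw [neg_half, sub_eq_add_neg]
  rw [e5]
  change _ * (_ * evalU D.K _ / _) * _ = _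
  simp only [div_eq_mul_inv, mul_inv, mul_pow]
  ring

theorem map_bZ (n : D.WIdx → ℤ) (i : I) :
    ((D.bZ i).map D.zToK).map (shift n) = (D.bZ i).map D.zToK := by
  rw [Polynomial.map_map]
  congr 1
  exact RingHom.ext fun c => shift_zToK D n c

theorem mapSer_u (σ : D.K →+* D.K) : mapSer σ D.u = D.u := mapSer_invVar σ

theorem mapSer_base (n : D.WIdx → ℤ) (i : I) : mapSer (shift n) (D.base i) = D.base i := by
  have h1 : shift n (1 / 2 : D.K) = 1 / 2 := NR.shift_half n
  have h2 : shift n (-1 / 2 : D.K) = -1 / 2 := by rw [neg_half, map_neg, h1]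
  simp only [base, map_mul, map_add, map_sub, map_one, map_div₀, map_pow, map_intCast, map_ofNat,
    mapSer_u, mapSer_evalU, map_bZ, mapSer_lin, h1, h2]

theorem c_cases (hD : D.Admissible) (i j : I) :
    D.cartan i j = 2 ∨ D.cartan i j = -1 ∨ D.cartan i j = 0 := by
  by_cases h : i = j
  · left; rw [h, hD.c_self]
  · right; exact (hD.c_off _ _ h).symm

theorem HSer_shift (hD : D.Admissible) (i : I) (a : D.NR) :
    lin (a.x + (D.cartan i a.node : D.K) / 2) * lin (-a.x - (D.cartan (D.τ i) a.node : D.K) / 2) *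
      D.HSer i =
    lin (a.x - (D.cartan i a.node : D.K) / 2) * lin (-a.x + (D.cartan (D.τ i) a.node : D.K) / 2) *
      mapSer (shift a.sh) (D.HSer i) := by
  have hs : ∏ b : D.NR, phi (D.cartan i b.node) b.w =
      phi (D.cartan i a.node) a.w * (phi (D.cartan i a.flip.node) a.flip.w *
        ∏ b ∈ (Finset.univ.erase a).erase a.flip, phi (D.cartan i b.node) b.w) := by
    rw [Finset.mul_prod_erase _ (fun b : D.NR => phi (D.cartan i b.node) b.w)
      (by simp [NR.flip_ne]), Finset.mul_prod_erase _ (fun b : D.NR => phi (D.cartan i b.node) b.w)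
      (by simp)]
  have hp : ∏ b ∈ (Finset.univ.erase a).erase a.flip,
      mapSer (shift a.sh) (phi (D.cartan i b.node) b.w) =
      ∏ b ∈ (Finset.univ.erase a).erase a.flip, phi (D.cartan i b.node) b.w := by
    refine Finset.prod_congr rfl fun b hb => ?_
    simp only [Finset.mem_erase, Finset.mem_univ, and_true] at hb
    rw [mapSer_phi, NR.shift_w hD hb.2 hb.1]
  rw [HSer_eq hD, map_mul, mapSer_base, hs, map_mul, map_mul, map_prod, hp, mapSer_phi, mapSer_phi,
    NR.shift_w_self hD, NR.shift_w_flip hD]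
  have h1 := phi_shift (D.cartan i a.node) (c_cases hD _ _) a.w
  have h2 := phi_shift (D.cartan i a.flip.node) (c_cases hD _ _) (a.flip.w + 1)
  rw [add_sub_cancel_right] at h2
  have hc : D.cartan (D.τ i) a.node = D.cartan i a.flip.node := by
    rw [NR.node_flip hD, hD.cτ']
  rw [hc]
  have e1 : -a.x - (D.cartan i a.flip.node : D.K) / 2 =
      a.flip.w + 1 - 1 / 2 - (D.cartan i a.flip.node : D.K) / 2 := by
    rw [NR.w_flip, NR.x]; ring
  have e2 : -a.x + (D.cartan i a.flip.node : D.K) / 2 =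
      a.flip.w + 1 - 1 / 2 + (D.cartan i a.flip.node : D.K) / 2 := by
    rw [NR.w_flip, NR.x]; ring
  rw [e1, e2, show a.x = a.w - 1 / 2 from rfl]
  set A := lin (a.w - 1 / 2 + (D.cartan i a.node : D.K) / 2)
  set B := lin (a.w - 1 / 2 - (D.cartan i a.node : D.K) / 2)
  generalize (∏ b ∈ (Finset.univ.erase a).erase a.flip, phi (D.cartan i b.node) b.w) = R
  generalize phi (D.cartan i a.node) a.w = p1 at *
  generalize phi (D.cartan i a.node) (a.w - 1) = p2 at *
  generalize phi (D.cartan i a.flip.node) a.flip.w = q1 at *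
  generalize phi (D.cartan i a.flip.node) (a.flip.w + 1) = q2 at *
  linear_combination (D.base i * R * lin (a.flip.w + 1 - 1 / 2 - (D.cartan i a.flip.node : D.K) / 2)
    * q1) * h1 - (D.base i * R * B * p2) * h2

theorem sys_hb (hD : D.Admissible) (Zs : I → D.ZRing[X]) (ε : I → ℂ) (i : I) (a : D.Root) (r : ℤ) :
    (D.HSer i).coeff (r + 2) - (sys hD Zs ε).σ a ((D.HSer i).coeff (r + 2))
      - (sys hD Zs ε).x a ^ 2 * ((D.HSer i).coeff r - (sys hD Zs ε).σ a ((D.HSer i).coeff r)) =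
    (((D.cartan i ((sys hD Zs ε).nd a) : D.K) - D.cartan (D.τ i) ((sys hD Zs ε).nd a)) / 2) *
      ((D.HSer i).coeff (r + 1) + (sys hD Zs ε).σ a ((D.HSer i).coeff (r + 1)))
    + (((D.cartan i ((sys hD Zs ε).nd a) : D.K) + D.cartan (D.τ i) ((sys hD Zs ε).nd a)) / 2)
      * (sys hD Zs ε).x a * ((D.HSer i).coeff r + (sys hD Zs ε).σ a ((D.HSer i).coeff r))
    + ((D.cartan i ((sys hD Zs ε).nd a) : D.K) * D.cartan (D.τ i) ((sys hD Zs ε).nd a) / 4)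
      * ((D.HSer i).coeff r - (sys hD Zs ε).σ a ((D.HSer i).coeff r)) := by
  rcases a with a | k
  · have h := coeff_lin_lin _ _ _ _ _ _ (HSer_shift hD i a) r
    simp only [mapSer_coeff] at h
    simp only [sys, Sum.elim_inl]
    linear_combination h
  · have hc : D.cartan (D.τ i) k = D.cartan i k := by
      rw [hD.cτ', fixed_of_theta k.2]
    simp only [sys, Sum.elim_inr, shift_zero, hc]
    ring

end Datum

end

section

namespace Datum

universe uI
variable {I : Type uI} {D : Datum I} [Fintype I]

open Polynomial

/-! ### Parity -/

variable (D) in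
/-- The number of signed variables at nodes joined to `i`. -/
def nadj (i : I) : ℕ := (Finset.univ.filter fun b : D.NR => D.adj i b.node).card

variable (D) in
/-- The sum of the `θ_j` over the nodes `j` joined to `i`. -/
def sth (i : I) : ℕ := ∑ j with D.adj i j, D.theta j

theorem card_node (hD : D.Admissible) (j : I) :
    (Finset.univ.filter fun b : D.NR => b.node = j).card + D.theta j = D.v j := by
  have h : (Finset.univ.filter fun b : D.NR => b.node = j).card = D.len j + D.len (D.τ j) := by
    rw [Finset.card_eq_sum_ones, sum_NR hD, sum_T j _ (fun _ => 1) (fun _ => rfl),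
      sum_T (D.τ j) _ (fun _ => 1) (fun _ => rfl)]
    simp
  rw [h]
  by_cases hj : D.τ j = j
  · rw [hj, len, if_pos hj, fv, if_pos hj, theta, if_pos hj]; omega
  · rw [len_add hD hj, theta_eq_zero hj, fv, if_neg hj, add_zero]

theorem nadj_add_sth (hD : D.Admissible) (i : I) :
    D.nadj i + D.sth i = ∑ j with D.adj i j, D.v j := by
  rw [nadj, sth, Finset.card_eq_sum_ones, sum_by_node (fun j => D.adj i j),
    ← Finset.sum_add_distrib]
  refine Finset.sum_congr rfl fun j _ => ?_
  rw [← Finset.card_eq_sum_ones, card_node hD]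

theorem even_parity (hD : D.Admissible) (i : I) : Even (D.nadj i + D.sth i + D.wt i) := by
  rw [nadj_add_sth hD]
  have h := hD.diff i
  obtain ⟨m, hm⟩ := hD.even
  have h1 : D.mu i = 2 * m i := by rw [hm]; simp
  have h2 : ∑ j, (D.v j : ℤ) * D.cartan j i = 2 * D.v i - ∑ j with D.adj i j, (D.v j : ℤ) := by
    rw [Finset.sum_filter, ← Finset.add_sum_erase _ _ (Finset.mem_univ i), hD.c_self,
      ← Finset.add_sum_erase _ (fun j => if D.adj i j then (D.v j : ℤ) else 0) (Finset.mem_univ i),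
      if_neg (hD.not_adj_self i), zero_add, mul_comm, sub_eq_add_neg, ← Finset.sum_neg_distrib]
    congr 1
    refine Finset.sum_congr rfl fun j hj => ?_
    have hne : i ≠ j := fun e => by simp [e] at hj
    rw [hD.adj_iff, hD.c_symm j i]
    rcases hD.c_off i j hne with h' | h' <;> rw [h'] <;> simp
  have h3 : (D.wt i : ℤ) = D.lam i := Int.toNat_of_nonneg (hD.lam_nonneg i)
  have h4 : ((∑ j with D.adj i j, D.v j + D.wt i : ℕ) : ℤ) = 2 * (D.v i + m i) + 2 * (D.wt i -
      D.v i - m i) + (∑ j with D.adj i j, (D.v j : ℤ) - D.wt i) := by push_cast; ring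
  rw [← Int.even_coe_nat, h4, h3]
  rw [h1, h2] at h
  have h5 : ∑ j with D.adj i j, (D.v j : ℤ) - D.lam i = 2 * (D.v i + m i) - 2 * D.lam i := by
    linarith
  rw [h5]
  exact (((even_two_mul _).add (even_two_mul _)).add ((even_two_mul _).sub (even_two_mul _)))

theorem adj_τ_iff (hD : D.Admissible) (i j : I) : D.adj (D.τ i) j ↔ D.adj i (D.τ j) := by
  rw [hD.adj_iff, hD.adj_iff, hD.cτ']

theorem sth_τ (hD : D.Admissible) (i : I) : D.sth (D.τ i) = D.sth i := by
  rw [sth, sth]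
  refine Finset.sum_nbij' D.τ D.τ ?_ ?_ ?_ ?_ ?_ <;>
    simp [hD.ττ, hD.theta_τ, adj_τ_iff hD]

theorem theta_le_one (i : I) : D.theta i ≤ 1 := by
  unfold theta; split_ifs
  · have := Nat.mod_lt (D.v i) two_pos; omega
  · omega

theorem sth_eq_zero (hD : D.Admissible) {i : I} (hi : D.theta i = 1) : D.sth i = 0 := by
  refine Finset.sum_eq_zero fun j hj => ?_
  simp only [Finset.mem_filter, Finset.mem_univ, true_and] at hj
  have hc := (hD.adj_iff i j).1 hj
  have := hD.parity i j (by rintro rfl; exact hD.not_adj_self _ hj)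
  rw [hi, hc] at this
  simpa using this

theorem vartheta_le_one {i : I} (hi : D.τ i = i) : D.vartheta i ≤ 1 := by
  rw [vartheta, if_pos hi, Finset.sup_le_iff]
  exact fun j _ => theta_le_one j

theorem vartheta_eq_one {i j : I} (hi : D.τ i = i) (hij : D.cartan i j ≠ 0)
    (hj : D.theta j = 1) : D.vartheta i = 1 := by
  refine le_antisymm (vartheta_le_one hi) ?_
  rw [vartheta, if_pos hi, ← hj]
  exact Finset.le_sup (f := D.theta) (by simpa using hij)

theorem one_le_sth (hD : D.Admissible) {i : I} (hi : D.τ i = i) (h : D.vartheta i = 1)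
    (h0 : D.theta i = 0) : 1 ≤ D.sth i := by
  by_contra hlt
  have hz : D.sth i = 0 := by omega
  rw [sth, Finset.sum_eq_zero_iff] at hz
  have : D.vartheta i ≤ 0 := by
    rw [vartheta, if_pos hi, Finset.sup_le_iff]
    intro j hj
    simp only [Finset.mem_filter, Finset.mem_univ, true_and] at hj
    by_cases hij : i = j
    · rw [← hij, h0]
    · have hc := (hD.c_off i j hij).resolve_left hj
      rw [hz j (by simpa using (hD.adj_iff i j).2 hc)]
  omega

/-! ### The rational function `u H_i(u)` -/

variable (D) in
/-- The factor of the numerator of `u H_i(u)` involving no variables. -/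
def num₀ (i : I) : D.K[X] :=
  if D.τ i = i then
    (if D.theta i = 1 then 1
      else X ^ (1 + D.sth i - 2 * D.vartheta i) * (X ^ 2 - C (1 / 4)) ^ D.vartheta i)
  else (X + C ((D.wp i : D.K) / 4)) * X ^ D.sth i

variable (D) in
/-- The numerator of `u H_i(u)`. -/
def numer (i : I) : D.K[X] :=
  D.num₀ i * (D.bZ i).map D.zToK * ∏ b : D.NR with D.adj i b.node, (X - C b.w)

/-- The node of a pole. -/
def pnode : D.Root ⊕ D.NR → I := Sum.elim (Sum.elim NR.node Subtype.val) NR.node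

/-- The location of a pole. -/
def pole : D.Root ⊕ D.NR → D.K := Sum.elim (Sum.elim NR.x fun _ => 0) fun b => b.w + 1 / 2

variable (D) in
/-- The poles of `u H_i(u)`. -/
def poles (i : I) : Finset (D.Root ⊕ D.NR) := Finset.univ.filter fun k => pnode k = i

theorem prod_poles {M : Type*} [CommMonoid M] (i : I) (F : D.Root ⊕ D.NR → M) (c : M)
    (hc : ∀ k : {i : I // D.theta i = 1}, (k : I) = i → F (Sum.inl (Sum.inr k)) = c) :
    ∏ k ∈ D.poles i, F k = c ^ D.theta i *
      ∏ b : D.NR with b.node = i, (F (Sum.inl (Sum.inl b)) * F (Sum.inr b)) := by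
  have h0 : ∏ k : {i : I // D.theta i = 1}, (if (k : I) = i then F (Sum.inl (Sum.inr k)) else 1) =
      c ^ D.theta i := by
    by_cases hi : D.theta i = 1
    · rw [Finset.prod_eq_single ⟨i, hi⟩, if_pos rfl, hc _ rfl, hi, pow_one]
      · intro k _ hk
        exact if_neg fun e => hk (Subtype.ext e)
      · simp
    · have : D.theta i = 0 := by have := D.theta_le_one i; omega
      rw [this, pow_zero]
      refine Finset.prod_eq_one fun k _ => if_neg ?_
      rintro rfl
      exact hi k.2
  rw [poles, Finset.prod_filter, Fintype.prod_sum_type, Fintype.prod_sum_type, ← h0,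
    Finset.prod_mul_distrib, Finset.prod_filter, Finset.prod_filter, mul_assoc, mul_left_comm]
  rfl

theorem pole_injOn (hD : D.Admissible) (i : I) : Set.InjOn pole (D.poles i : Set (D.Root ⊕ D.NR)) := by
  have h1 : ∀ a : D.NR, a.x ≠ 0 := fun a h => by
    apply NR.w_add_ne hD a (-1 / 2); rw [← h, NR.x]; push_cast; ring
  have h2 : ∀ a : D.NR, a.w + 1 / 2 ≠ 0 := fun a h => by
    apply NR.w_add_ne hD a (1 / 2); rw [← h]; push_cast; ring
  have h3 : ∀ a b : D.NR, a.x ≠ b.w + 1 / 2 := fun a b h => by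
    by_cases hab : b = a
    · subst hab
      rw [NR.x] at h
      have : (1 : D.K) = 0 := by linear_combination -h
      exact one_ne_zero this
    · apply NR.w_sub_w_ne hD hab (-1); rw [NR.x] at h; push_cast; linear_combination h
  intro k hk l hl h
  simp only [poles, Finset.coe_filter, Finset.mem_univ, true_and, Set.mem_ofPred_eq] at hk hl
  rcases k with (a | k) | a <;> rcases l with (b | l) | b <;> simp only [pole, Sum.elim_inl,
    Sum.elim_inr] at h
  · by_contra hab
    exact NR.w_ne hD (a := a) (b := b) (fun e => hab (by rw [e])) (by
      rw [NR.x, NR.x] at h; linear_combination h)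
  · exact absurd h (h1 a)
  · exact absurd h (h3 a b)
  · exact absurd h.symm (h1 b)
  · have : (k : I) = l := hk.trans hl.symm
    rw [Subtype.ext this]
  · exact absurd h.symm (h2 b)
  · exact absurd h.symm (h3 b a)
  · exact absurd h (h2 a)
  · by_contra hab
    exact NR.w_ne hD (a := a) (b := b) (fun e => hab (by rw [e])) (by linear_combination h)

theorem num₀_eq (hD : D.Admissible) (i : I) :
    D.u * (D.base i) * D.u ^ D.theta i = evalU D.K (D.num₀ i * (D.bZ i).map D.zToK) := by
  have hu : D.u ≠ 0 := u_ne_zero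
  have hw : D.τ i = i → D.wp i = 0 := by
    intro h
    have h' : ¬ D.arrow i i := fun h' => hD.not_adj_self i (Or.inl h')
    simp [wp, h, h']
  have hl : lin (1 / 2 : D.K) * lin (-1 / 2) = D.u ^ 2 - 1 / 4 := by
    rw [lin, lin, neg_half, map_neg, show (1 / 4 : D.Ser) = HahnSeries.C (1 / 2 : D.K) * HahnSeries.C (1 / 2 : D.K) by
      rw [← map_mul, show (1 / 2 * (1 / 2) : D.K) = 1 / 4 by norm_num, map_div₀, map_one, map_ofNat]]
    change (D.u - _) * (D.u - _) = _
    ring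
  have hl0 : D.u ^ 2 - 1 / 4 ≠ 0 := by
    rw [← hl]; exact mul_ne_zero (lin_ne_zero _) (lin_ne_zero _)
  have h4 : evalU D.K (X ^ 2 - C (1 / 4)) = D.u ^ 2 - 1 / 4 := by
    rw [map_sub, map_pow, evalU_X, evalU_C, map_div₀, map_one, map_ofNat]; rfl
  have hX : evalU D.K X = D.u := evalU_X
  have hz : ∀ F : D.Ser, 0 / F = 0 := fun F => zero_div F
  have ho : ∀ F : D.Ser, F / 1 = F := fun F => div_one F
  have hq : (1 : D.Ser) - 1 / (4 * D.u ^ 2) = (D.u ^ 2 - 1 / 4) / D.u ^ 2 := by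
    field_simp
  rw [base, hl, map_mul, hq, ← sth]
  generalize evalU D.K ((D.bZ i).map D.zToK) = Zi
  by_cases hi : D.τ i = i
  · rw [hw hi, num₀, if_pos hi, show 1 + ((0 : ℤ) : D.Ser) / (4 * D.u) = 1 by rw [Int.cast_zero, hz, add_zero], one_mul]
    split_ifs with ht
    · rw [ht, sth_eq_zero hD ht, vartheta_eq_one hi (by rw [hD.c_self]; norm_num) ht, map_one]
      field_simp
    · have ht0 : D.theta i = 0 := by have := D.theta_le_one i; omega
      rw [ht0, pow_zero, pow_zero, mul_one, ho, map_mul, map_pow, map_pow, hX, h4]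
      have hv := vartheta_le_one hi
      obtain hv0 | hv1 : D.vartheta i = 0 ∨ D.vartheta i = 1 := by omega
      · rw [hv0, mul_zero, pow_zero, pow_zero, tsub_zero, pow_add]; ring
      · have hs := one_le_sth hD hi hv1 ht0
        obtain ⟨m, hm⟩ : ∃ m, D.sth i = m + 1 := ⟨D.sth i - 1, by omega⟩
        rw [hv1, hm, show 1 + (m + 1) - 2 * 1 = m by omega, pow_one, pow_one]
        field_simp
        ring
  · have hv : D.vartheta i = 0 := by rw [vartheta, if_neg hi, theta_eq_zero hi]
    rw [num₀, if_neg hi, hv, theta_eq_zero hi, map_mul, map_pow, map_add, hX, evalU_C, map_div₀,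
      map_intCast, map_ofNat]
    simp only [pow_zero, one_mul, mul_one]
    field_simp

theorem u_mul_HSer (hD : D.Admissible) (i : I) :
    D.u * D.HSer i = evalU D.K (D.numer i) / evalU D.K (∏ k ∈ D.poles i, (X - C (pole k))) := by
  rw [eq_div_iff (evalU_prod_ne_zero _ _), HSer_eq hD, numer, map_mul, ← num₀_eq hD,
    prod_poles i _ X (fun k _ => by simp [pole]), map_mul, map_pow, map_prod, map_prod, evalU_X]
  have h1 : (∏ b : D.NR, phi (D.cartan i b.node) b.w) * ∏ b : D.NR with b.node = i,
      evalU D.K ((X - C (pole (Sum.inl (Sum.inl b)))) * (X - C (pole (Sum.inr b)))) =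
      ∏ b : D.NR with D.adj i b.node, evalU D.K (X - C b.w) := by
    rw [Finset.prod_filter, Finset.prod_filter, ← Finset.prod_mul_distrib]
    refine Finset.prod_congr rfl fun b _ => ?_
    rw [map_mul, evalU_X_sub_C, evalU_X_sub_C, evalU_X_sub_C, hD.adj_iff, phi]
    by_cases h : b.node = i
    · rw [h, hD.c_self, if_pos rfl, if_pos rfl, if_neg (by norm_num)]
      have e1 := lin_ne_zero (b.w + 1 / 2)
      have e2 := lin_ne_zero (b.w - 1 / 2)
      simp only [pole, Sum.elim_inl, Sum.elim_inr, NR.x]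
      generalize lin (b.w + 1 / 2) = A at *
      generalize lin (b.w - 1 / 2) = B at *
      field_simp
    · have := hD.c_off i b.node (fun e => h e.symm)
      rw [if_neg (by rcases this with h' | h' <;> rw [h'] <;> norm_num), if_neg h, mul_one]
      congr 1
  rw [← h1]
  change D.u * _ * (D.u ^ _ * _) = _
  ring

end Datum

end

section

namespace Datum

universe uI
variable {I : Type uI} {D : Datum I} [Fintype I]

open Polynomial

/-! ### Residues -/

namespace NR

/-- The generic contribution of `b` to the residue of `u H_i(u)` at `x_a`. -/
def gen (a b : D.NR) : D.K :=
  if D.cartan (node a) (node b) = 2 then ((w a - w b) * (w a - w b - 1))⁻¹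
  else if D.cartan (node a) (node b) = -1 then x a - w b else 1

/-- The factor of the residue coming from the pair of opposite points. -/
def cfac (a : D.NR) : D.K :=
  if D.τ (node a) = node a then x a else x a + (D.wp (node a) : D.K) / 4

theorem x_ne_zero (hD : D.Admissible) (a : D.NR) : x a ≠ 0 := fun h => by
  apply NR.w_add_ne hD a (-1 / 2); rw [← h, NR.x]; push_cast; ring

theorem g_mul_shift (hD : D.Admissible) {a b : D.NR} (h : b ≠ a) (h' : b ≠ flip a) :
    g a b * shift (sh a) (g (flip a) (flip b)) =
      (if D.adj (node a) (node b) then sgn a else 1) * gen a b := by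
  have hc : D.cartan (node (flip a)) (node (flip b)) = D.cartan (node a) (node b) := by
    rw [node_flip hD, node_flip hD, hD.cτ]
  have e1 := shift_w hD h h'
  have hs := sgn_ne_zero a
  have hss := sgn_mul_sgn a
  simp only [g, gen, hc, hD.adj_iff]
  split_ifs with c2 c1 c1
  · rw [c2] at c1; norm_num at c1
  · simp only [map_inv₀, map_mul, map_sub, shift_sgn, w_flip, map_neg, e1, shift_w_self hD, sgn_flip]
    rw [← mul_inv, one_mul, inv_inj]
    linear_combination ((w a - w b) * (w a - w b - 1)) * hss
  · have hn := nexp_add hD c1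
    rw [nexp_flip hD b a] at hn
    simp only [map_pow, map_mul, map_sub, shift_sgn, shift_x, w_flip, map_neg, e1, shift_w_self hD,
      sgn_flip]
    rw [show -sgn a * (-(w a - 1) - 1 / 2 - -w b) = sgn a * (x a - w b) by rw [x]; ring, ← pow_add, hn,
      pow_one]
  · simp

theorem wp_eq_zero (hD : D.Admissible) {i : I} (h : D.cartan i (D.τ i) ≠ -1) : D.wp i = 0 := by
  have h1 : ¬ D.arrow i (D.τ i) := fun e => h (hD.orient.1 _ _ e)
  have h2 : ¬ D.arrow (D.τ i) i := fun e => h (by rw [hD.c_symm]; exact hD.orient.1 _ _ e)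
  simp [wp, h1, h2]

theorem g_mul_shift_flip (hD : D.Admissible) (a : D.NR) :
    (x a - (D.cartan (node a) (D.τ (node a)) : D.K) / 4) *
      (g a (flip a) * shift (sh a) (g (flip a) a)) =
      cfac a * ((if D.adj (node a) (node (flip a)) then sgn a else 1) * gen a (flip a)) := by
  have hc : D.cartan (D.τ (node a)) (node a) = D.cartan (node a) (D.τ (node a)) := by
    rw [hD.c_symm]
  have hs := sgn_ne_zero a
  have hss := sgn_mul_sgn a
  have hw := w_ne_zero hD a
  have hx := x_ne_zero hD a
  have hw1 : w a - 1 ≠ 0 := by simpa [sub_eq_add_neg] using w_add_ne hD a (-1)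
  simp only [g, gen, hc, node_flip hD, hD.adj_iff]
  split_ifs with c2 c1 c1
  · rw [c2] at c1; norm_num at c1
  · have hf : D.τ (node a) = node a := by
      by_contra hne
      have := hD.c_off (node a) (D.τ (node a)) (fun e => hne e.symm)
      rw [c2] at this; norm_num at this
    rw [cfac, if_pos hf, c2]
    simp only [map_inv₀, map_mul, map_sub, shift_sgn, w_flip, map_neg, shift_w_self hD, sgn_flip]
    have hx' : w a * 2 - 1 ≠ 0 := by rw [x] at hx; intro e; apply hx; linear_combination e / 2
    rw [← mul_inv, one_mul, ← div_eq_mul_inv, ← div_eq_mul_inv, div_eq_div_iff, x]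
    · push_cast
      linear_combination (-2 * w a * (w a - 1) * (2 * w a - 1)) * hss
    · have h2 : (2 : D.K) ≠ 0 := two_ne_zero
      rw [show sgn a * (w a - -w a) * (-sgn a * (-(w a - 1) - (w a - 1))) =
        (sgn a * sgn a) * (2 * w a) * (2 * (w a - 1)) by ring, hss]
      simp [hw, hw1]
    · have : (w a - -w a) * (w a - -w a - 1) = 2 * w a * (w a * 2 - 1) := by ring
      rw [this]; simp [hw, hx']
  · have hf : ¬ D.τ (node a) = node a := by
      intro e; rw [e, hD.c_self] at c2; exact c2 rfl
    have hff : ¬ D.τ (D.τ (node a)) = D.τ (node a) := by rwa [hD.τ_eq_iff]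
    rw [cfac, if_neg hf, c1]
    simp only [map_pow, map_mul, map_sub, shift_sgn, shift_x, w_flip, map_neg, shift_w_self hD, sgn_flip]
    rcases (hD.adj_iff _ _).2 c1 with h1 | h1
    · have h2 := hD.arrow_asymm h1
      simp only [nexp, node_flip hD, wp, hf, hff, h1, h2, if_true, if_false, and_false]
      rw [x]; push_cast; ring
    · have h2 := hD.arrow_asymm h1
      simp only [nexp, node_flip hD, wp, hf, hff, h1, h2, if_true, if_false, and_false]
      rw [x]; push_cast; ring
  · have hf : ¬ D.τ (node a) = node a := by
      intro e; rw [e, hD.c_self] at c2; exact c2 rfl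
    have h0 := (hD.c_off (node a) (D.τ (node a)) (fun e => hf e.symm)).resolve_right c1
    rw [cfac, if_neg hf, h0, wp_eq_zero hD c1]
    simp

theorem prod_g_shift (hD : D.Admissible) (a : D.NR) :
    (x a - (D.cartan (node a) (D.τ (node a)) : D.K) / 4) *
      ((∏ b ∈ Finset.univ.erase a, g a b) *
        shift (sh a) (∏ b ∈ Finset.univ.erase (flip a), g (flip a) b)) =
      cfac a * (sgn a ^ D.nadj (node a) * ∏ b ∈ Finset.univ.erase a, gen a b) := by
  have h1 : shift (sh a) (∏ b ∈ Finset.univ.erase (flip a), g (flip a) b) =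
      ∏ b ∈ Finset.univ.erase a, shift (sh a) (g (flip a) (flip b)) := by
    rw [map_prod]
    refine Finset.prod_nbij' flip flip ?_ ?_ ?_ ?_ ?_ <;>
      simp only [Finset.mem_erase, Finset.mem_univ, and_true, flip_flip, implies_true]
    · intro b hb e; apply hb; rw [← e, flip_flip]
    · intro b hb e; apply hb; rw [← flip_flip b, e, flip_flip]
  have h2 : sgn a ^ D.nadj (node a) =
      ∏ b ∈ Finset.univ.erase a, if D.adj (node a) (node b) then sgn a else 1 := by
    rw [nadj, ← Finset.prod_const, Finset.prod_filter,
      ← Finset.mul_prod_erase _ _ (Finset.mem_univ a), if_neg (hD.not_adj_self _), one_mul]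
  have hm : flip a ∈ Finset.univ.erase a := by simp [flip_ne]
  rw [h1, h2, ← Finset.prod_mul_distrib, ← Finset.prod_mul_distrib, ← Finset.mul_prod_erase _ _ hm,
    ← Finset.mul_prod_erase _ (fun b => (if D.adj (node a) (node b) then sgn a else 1) * gen a b) hm,
    flip_flip, Finset.prod_congr rfl fun b hb => g_mul_shift hD (a := a) (b := b)
      (by simp only [Finset.mem_erase] at hb; exact hb.2.1)
      (by simp only [Finset.mem_erase] at hb; exact hb.1)]
  linear_combination (∏ b ∈ (Finset.univ.erase a).erase (flip a),
    (if D.adj (node a) (node b) then sgn a else 1) * gen a b) * g_mul_shift_flip hD a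

end NR

theorem z_τ (hD : D.Admissible) {i : I} (hi : D.τ i ≠ i) (s : ℕ) : D.z (D.τ i) s = -D.z i s := by
  have h := hD.mem_τ hi
  by_cases hm : D.mem i
  · have : ¬ D.mem (D.τ i) := fun e => h.1 e hm
    rw [z, z, if_neg this, if_pos hm, hD.ττ]
  · rw [z, z, if_pos (h.2 hm), if_neg hm, neg_neg]

theorem neg_one_pow_fw {i : I} : (-1 : D.K) ^ D.wt i =
    if D.τ i = i then (-1) ^ D.sigma i else (-1) ^ D.fw i := by
  rw [sigma, fw]
  split_ifs
  · rw [neg_one_pow_eq_pow_mod_two]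
  · rfl

theorem bZ_eval (i : I) (v : D.K) : D.zeval (D.bZ i) v =
    if D.τ i = i then v ^ D.sigma i * ∏ s ∈ Finset.Icc 1 (D.fw i), (v ^ 2 - D.zToK (D.z i s) ^ 2)
    else ∏ s ∈ Finset.Icc 1 (D.fw i), (v - D.zToK (D.z i s)) := by
  rw [zeval, bZ]
  split_ifs <;> simp [eval₂_finsetProd, eval₂_mul, eval₂_pow]

theorem bZ_neg (hD : D.Admissible) (i : I) (v : D.K) :
    D.zeval (D.bZ i) (-v) = (-1) ^ D.wt i * D.zeval (D.bZ (D.τ i)) v := by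
  rw [bZ_eval, bZ_eval, neg_one_pow_fw, hD.fw_τ]
  by_cases hi : D.τ i = i
  · simp only [hi, if_true, neg_sq]
    rw [neg_pow, mul_assoc]
  · have hi' : ¬ D.τ (D.τ i) = D.τ i := by rwa [hD.τ_eq_iff]
    simp only [hi, hi', if_false, z_τ hD hi, map_neg]
    rw [Finset.prod_congr rfl fun s _ => show -v - D.zToK (D.z i s) =
      -1 * (v - -D.zToK (D.z i s)) by ring, Finset.prod_mul_distrib, Finset.prod_const, Nat.card_Icc,
      Nat.add_sub_cancel]

theorem zeval_mul (p q : D.ZRing[X]) (v : D.K) : D.zeval (p * q) v = D.zeval p v * D.zeval q v :=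
  eval₂_mul _ _

theorem Z_mul_Zbar (Zs : I → D.ZRing[X]) {i : I} (hi : D.τ i = i) :
    D.Z Zs i * D.Zbar Zs i = D.bZ i := by
  rw [Zbar, Z, if_pos hi, minus_prod_linear, bZ, if_pos hi, mul_left_comm, ← Finset.prod_mul_distrib]
  congr 1
  exact Finset.prod_congr rfl fun s _ => by ring

theorem zeval_Zp (hD : D.Admissible) (Zs : I → D.ZRing[X]) (hZ : D.IsZSplitting Zs) (a : D.NR) :
    D.zeval (a.Zp Zs) (a.sgn * a.x) * D.zeval (a.flip.Zp Zs) (a.sgn * a.x) =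
      a.sgn ^ D.wt a.node * D.zeval (D.bZ a.node) a.x := by
  have hn : a.flip.node = D.τ a.node := NR.node_flip hD a
  by_cases hf : D.τ a.node = a.node
  · have h1 : D.zeval (a.Zp Zs) (a.sgn * a.x) * D.zeval (a.flip.Zp Zs) (a.sgn * a.x) =
        D.zeval (D.bZ a.node) (a.sgn * a.x) := by
      rw [← zeval_mul, ← Z_mul_Zbar Zs hf, NR.Zp, NR.Zp, hn, hf, if_pos hf]
      rcases h2 : a.2 with _ | _
      · simp [NR.flip, h2, mul_comm]
      · simp [NR.flip, h2]
    rw [h1]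
    rcases h2 : a.2 with _ | _
    · have : a.sgn = -1 := by simp [NR.sgn, h2]
      rw [this, neg_one_mul, bZ_neg hD, hf]
    · have : a.sgn = 1 := by simp [NR.sgn, h2]
      rw [this, one_mul, one_pow, one_mul]
  · have hf' : ¬ D.τ (D.τ a.node) = D.τ a.node := by rwa [hD.τ_eq_iff]
    rw [← zeval_mul, NR.Zp, NR.Zp, hn, if_neg hf, if_neg hf']
    have hZ1 : ∀ j, D.τ j ≠ j → D.bZ j = D.Z Zs j * minus (D.Z Zs (D.τ j)) := by
      intro j hj
      have hj' : ¬ D.τ (D.τ j) = D.τ j := by rwa [hD.τ_eq_iff]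
      rw [Z, Z, if_neg hj, if_neg hj']; exact (hZ j hj).2
    rcases h2 : a.2 with _ | _
    · have : a.sgn = -1 := by simp [NR.sgn, h2]
      have h3 := hZ1 _ hf'
      rw [hD.ττ] at h3
      simp only [NR.flip, h2, Bool.not_false, if_true, Bool.false_eq_true, if_false]
      rw [this, mul_comm (minus _), ← h3, neg_one_mul, bZ_neg hD, hD.ττ, hD.wt_τ]
    · have : a.sgn = 1 := by simp [NR.sgn, h2]
      simp only [NR.flip, h2, Bool.not_true, if_true, Bool.false_eq_true, if_false]
      rw [this, ← hZ1 _ hf, one_mul, one_pow, one_mul]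

theorem zexp_add (hD : D.Admissible) (a : D.NR) : a.zexp + a.flip.zexp = D.sth a.node := by
  have hn : a.flip.node = D.τ a.node := NR.node_flip hD a
  rw [NR.zexp, NR.zexp, hn, hD.ττ]
  by_cases hf : D.τ a.node = a.node
  · rw [hf, if_pos rfl]
    rcases h2 : a.2 with _ | _ <;> simp [NR.flip, h2, sth]
  · rw [if_neg hf, if_neg (fun e => hf e.symm), sth, sum_adj_split hD]
    congr 1
    refine Finset.sum_nbij' D.τ D.τ ?_ ?_ ?_ ?_ ?_ <;>
      simp only [Finset.mem_filter, Finset.mem_univ, true_and, hD.ττ, hD.theta_τ, implies_true]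
    · intro j hj
      exact (hD.arrow_τ (j := D.τ j) (Or.inl hf)).1 (by rwa [hD.ττ])
    · intro j hj
      exact (hD.arrow_τ (Or.inl hf)).2 hj

end Datum

end

section

namespace Datum

universe uI
variable {I : Type uI} {D : Datum I} [Fintype I]

open Polynomial

theorem kappa_mul (hD : D.Admissible) (Zs : I → D.ZRing[X]) (hZ : D.IsZSplitting Zs) (a : D.NR) :
    a.cfac * (NR.kappa Zs a * shift a.sh (NR.kappa Zs a.flip)) * a.sgn ^ D.nadj a.node *
      a.x ^ D.theta a.node =
      (D.num₀ a.node).eval a.x * D.zeval (D.bZ a.node) a.x := by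
  have hn : a.flip.node = D.τ a.node := NR.node_flip hD a
  have hx := NR.x_ne_zero hD a
  have hw := NR.w_ne_zero hD a
  have hw1 : a.w - 1 ≠ 0 := by simpa [sub_eq_add_neg] using NR.w_add_ne hD a (-1)
  have e1 : shift a.sh a.flip.x = -a.x := by
    rw [NR.shift_x, NR.w_flip, map_neg, NR.shift_w_self hD, NR.x]; ring
  have e2 : shift a.sh (NR.kappa Zs a.flip) =
      (a.sgn * a.x) ^ a.flip.zexp * D.zeval (a.flip.Zp Zs) (a.sgn * a.x) *
        (if D.τ a.node = a.node then
          ((a.x / (a.w - 1)) ^ D.vartheta a.node)⁻¹ *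
            ((a.sgn * (a.w - 1)) ^ D.theta a.node)⁻¹ else 1) := by
    have e3 : -a.sgn * -a.x = a.sgn * a.x := by ring
    have e4 : D.kap (-(a.w - 1)) = a.x / (a.w - 1) := by
      have : -(a.w - 1) ≠ 0 := neg_ne_zero.2 hw1
      rw [kap, NR.x]; field_simp; ring
    simp only [NR.kappa, map_mul, map_pow, NR.shift_sgn, NR.sgn_flip, map_neg, NR.shift_zeval, e1, e3,
      apply_ite (shift a.sh), map_inv₀, NR.shift_kap, NR.w_flip, NR.shift_w_self hD, e4, map_one, hn,
      hD.τ_eq_iff]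
    split_ifs with hf
    · rw [hf, show -a.sgn * -(a.w - 1) = a.sgn * (a.w - 1) by ring]
    · rfl
  have hss : a.sgn ^ (D.nadj a.node + D.sth a.node + D.wt a.node) = 1 := by
    obtain ⟨m, hm⟩ := even_parity hD a.node
    rw [hm, pow_add, ← mul_pow, NR.sgn_mul_sgn, one_pow]
  have hZp := zeval_Zp hD Zs hZ a
  have e5 : NR.kappa Zs a * shift a.sh (NR.kappa Zs a.flip) * a.sgn ^ D.nadj a.node =
      a.x ^ D.sth a.node * D.zeval (D.bZ a.node) a.x *
      (if D.τ a.node = a.node then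
        ((a.x / a.w) ^ D.vartheta a.node)⁻¹ * ((a.sgn * a.w) ^ D.theta a.node)⁻¹ *
          (((a.x / (a.w - 1)) ^ D.vartheta a.node)⁻¹ *
            ((a.sgn * (a.w - 1)) ^ D.theta a.node)⁻¹) else 1) := by
    rw [e2, NR.kappa, kap_eq hD]
    have : (a.sgn * a.x) ^ a.zexp * (a.sgn * a.x) ^ a.flip.zexp =
        a.sgn ^ D.sth a.node * a.x ^ D.sth a.node := by
      rw [← pow_add, zexp_add hD, mul_pow]
    rw [pow_add, pow_add] at hss
    split_ifs
    all_goals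
      generalize D.zeval (NR.Zp Zs a) (a.sgn * a.x) = z1 at *
      generalize D.zeval (NR.Zp Zs a.flip) (a.sgn * a.x) = z2 at *
      generalize D.zeval (D.bZ a.node) a.x = z3 at *
      generalize (a.sgn * a.x) ^ a.zexp = y1 at *
      generalize (a.sgn * a.x) ^ a.flip.zexp = y2 at *
    · generalize ((a.x / a.w) ^ D.vartheta a.node)⁻¹ * ((a.sgn * a.w) ^ D.theta a.node)⁻¹ = q1
      generalize ((a.x / (a.w - 1)) ^ D.vartheta a.node)⁻¹ *
            ((a.sgn * (a.w - 1)) ^ D.theta a.node)⁻¹ = q2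
      linear_combination (z1 * z2 * q1 * q2 * a.sgn ^ D.nadj a.node) * this +
        (a.sgn ^ D.sth a.node * a.x ^ D.sth a.node * q1 * q2 * a.sgn ^ D.nadj a.node) * hZp +
        (a.x ^ D.sth a.node * q1 * q2 * z3) * hss
    · linear_combination (z1 * z2 * a.sgn ^ D.nadj a.node) * this +
        (a.sgn ^ D.sth a.node * a.x ^ D.sth a.node * a.sgn ^ D.nadj a.node) * hZp +
        (a.x ^ D.sth a.node * z3) * hss
  rw [mul_assoc a.cfac, e5]
  generalize D.zeval (D.bZ a.node) a.x = z3
  by_cases hf : D.τ a.node = a.node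
  · rw [if_pos hf, NR.cfac, if_pos hf, num₀, if_pos hf]
    have hs := NR.sgn_ne_zero a
    have hs2 : a.sgn ^ 2 = 1 := by rw [pow_two, NR.sgn_mul_sgn]
    by_cases ht : D.theta a.node = 1
    · rw [if_pos ht, ht, vartheta_eq_one hf (by rw [hD.c_self]; norm_num) ht, sth_eq_zero hD ht,
        eval_one]
      field_simp
      rw [hs2, mul_one]
    · have ht0 : D.theta a.node = 0 := by have := D.theta_le_one a.node; omega
      rw [if_neg ht, ht0]
      have hv := vartheta_le_one hf
      obtain hv0 | hv1 : D.vartheta a.node = 0 ∨ D.vartheta a.node = 1 := by omega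
      · rw [hv0]
        simp [pow_add]
        ring
      · have h1 := one_le_sth hD hf hv1 ht0
        obtain ⟨m, hm⟩ : ∃ m, D.sth a.node = m + 1 := ⟨D.sth a.node - 1, by omega⟩
        rw [hv1, hm, show 1 + (m + 1) - 2 * 1 = m by omega]
        simp only [pow_zero, pow_one, eval_mul, eval_pow, eval_X, eval_sub, eval_C, inv_one, mul_one,
          inv_div]
        have : a.w * (a.w - 1) = a.x ^ 2 - 1 / 4 := by rw [NR.x]; ring
        rw [← this, pow_succ]
        field_simp
  · rw [if_neg hf, NR.cfac, if_neg hf, num₀, if_neg hf, theta_eq_zero hf]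
    simp only [pow_zero, eval_mul, eval_add, eval_X, eval_C, eval_pow]
    ring

theorem num₀_neg (hD : D.Admissible) (i : I) (v : D.K) :
    (D.num₀ i).eval (-v) * D.zeval (D.bZ i) (-v) * (-1) ^ D.nadj i =
      -((-1) ^ D.theta i * ((D.num₀ (D.τ i)).eval v * D.zeval (D.bZ (D.τ i)) v)) := by
  have hss : (-1 : D.K) ^ (D.nadj i + D.sth i + D.wt i) = 1 := (even_parity hD i).neg_one_pow
  rw [pow_add, pow_add] at hss
  rw [bZ_neg hD]
  generalize D.zeval (D.bZ (D.τ i)) v = z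
  by_cases hi : D.τ i = i
  · rw [hi, num₀, if_pos hi]
    by_cases ht : D.theta i = 1
    · rw [if_pos ht, ht, eval_one, eval_one]
      rw [sth_eq_zero hD ht] at hss
      linear_combination z * hss
    · have ht0 : D.theta i = 0 := by have := D.theta_le_one i; omega
      have h1 : (-v) ^ (1 + D.sth i - 2 * D.vartheta i) = -((-1) ^ D.sth i * v ^ (1 + D.sth i - 2 * D.vartheta i)) := by
        have hv' := vartheta_le_one hi
        rw [neg_pow v]
        obtain hv0 | hv1 : D.vartheta i = 0 ∨ D.vartheta i = 1 := by omega
        · rw [hv0, mul_zero, tsub_zero, pow_add]; ring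
        · have hs1 := one_le_sth hD hi hv1 ht0
          obtain ⟨m, hm⟩ : ∃ m, D.sth i = m + 1 := ⟨D.sth i - 1, by omega⟩
          rw [hv1, hm, show 1 + (m + 1) - 2 * 1 = m by omega]
          ring
      rw [if_neg ht, ht0]
      simp only [eval_mul, eval_pow, eval_X, eval_sub, eval_C, h1, neg_sq]
      linear_combination (-v ^ (1 + D.sth i - 2 * D.vartheta i) * (v ^ 2 - 1 / 4) ^ D.vartheta i * z) *
        hss
  · have hi' : ¬ D.τ (D.τ i) = D.τ i := by rwa [hD.τ_eq_iff]
    have hwp : D.wp (D.τ i) = -D.wp i := by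
      rw [wp, wp, hD.ττ]
      by_cases h1 : D.arrow i (D.τ i)
      · simp [h1, hD.arrow_asymm h1]
      · by_cases h2 : D.arrow (D.τ i) i <;> simp [h1, h2]
    rw [num₀, num₀, if_neg hi, if_neg hi', hwp, sth_τ hD, theta_eq_zero hi]
    simp only [eval_mul, eval_pow, eval_X, eval_add, eval_C, neg_pow v]
    push_cast
    linear_combination (-(v - (D.wp i : D.K) / 4) * v ^ D.sth i * z) * hss

/-- The residue at a pole, as given by partial fractions. -/
def pfRes (N : D.K[X]) (i : I) (k : D.Root ⊕ D.NR) : D.K :=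
  N.eval (pole k) / ∏ l ∈ (D.poles i).erase k, (pole k - pole l)

theorem prod_erase_eq {ι M : Type*} [DecidableEq ι] [CommMonoid M] (s : Finset ι) (k : ι) (F : ι → M) :
    ∏ l ∈ s.erase k, F l = ∏ l ∈ s, if l = k then 1 else F l := by
  rw [← Finset.filter_ne' s k, Finset.prod_filter]
  exact Finset.prod_congr rfl fun l _ => by by_cases h : l = k <;> simp [h]

theorem prod_gen (hD : D.Admissible) (a : D.NR) :
    ∏ b ∈ Finset.univ.erase a, a.gen b =
      (∏ b : D.NR with b.node = a.node, if b = a then 1 else (a.w - b.w) * (a.w - b.w - 1))⁻¹ *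
        ∏ b : D.NR with D.adj a.node b.node, (a.x - b.w) := by
  rw [prod_erase_eq, ← Finset.prod_inv_distrib, Finset.prod_filter, Finset.prod_filter,
    ← Finset.prod_mul_distrib]
  refine Finset.prod_congr rfl fun b _ => ?_
  by_cases hba : b = a
  · subst hba; simp [hD.not_adj_self]
  · rw [if_neg hba, if_neg hba, NR.gen, hD.adj_iff]
    by_cases h : b.node = a.node
    · rw [h, hD.c_self]; simp
    · have := hD.c_off _ _ (fun e => h e.symm : ¬ a.node = b.node)
      rw [if_neg h, one_mul, if_neg (by rcases this with h' | h' <;> rw [h'] <;> norm_num)]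
      congr 1

theorem numer_eval (i : I) (v : D.K) : (D.numer i).eval v =
    (D.num₀ i).eval v * D.zeval (D.bZ i) v * ∏ b : D.NR with D.adj i b.node, (v - b.w) := by
  rw [numer, eval_mul, eval_mul, eval_prod, eval_map, zeval]; simp


theorem prod_adj_neg (hD : D.Admissible) (i : I) (v : D.K) :
    ∏ b : D.NR with D.adj i b.node, (-v - b.w) =
      (-1) ^ D.nadj i * ∏ b : D.NR with D.adj (D.τ i) b.node, (v - b.w) := by
  have h : ∏ b : D.NR with D.adj (D.τ i) b.node, (v - b.w) =
      ∏ b : D.NR with D.adj i b.node, (v + b.w) := by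
    refine Finset.prod_nbij' NR.flip NR.flip ?_ ?_ ?_ ?_ ?_ <;>
      simp [NR.node_flip hD, adj_τ_iff hD, hD.ττ, sub_eq_add_neg]
  rw [h, nadj, ← Finset.prod_const, ← Finset.prod_mul_distrib]
  exact Finset.prod_congr rfl fun b _ => by ring

theorem pole_prod (a : D.NR) :
    ∏ l ∈ (D.poles a.node).erase (Sum.inl (Sum.inl a)), (a.x - pole l) =
      -(a.x ^ D.theta a.node *
        ∏ b : D.NR with b.node = a.node, if b = a then 1 else (a.w - b.w) * (a.w - b.w - 1)) := by
  have hm : a ∈ Finset.univ.filter fun b : D.NR => b.node = a.node := by simp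
  rw [prod_erase_eq, prod_poles a.node _ a.x (fun k _ => by simp [pole]), ← mul_neg]
  congr 1
  rw [← Finset.mul_prod_erase _ _ hm, ← Finset.mul_prod_erase _ (fun b =>
    if b = a then 1 else (a.w - b.w) * (a.w - b.w - 1)) hm, if_pos rfl, if_pos rfl]
  have : ∀ b ∈ (Finset.univ.filter fun b : D.NR => b.node = a.node).erase a,
      ((if (Sum.inl (Sum.inl b) : D.Root ⊕ D.NR) = Sum.inl (Sum.inl a) then 1
        else a.x - pole (Sum.inl (Sum.inl b))) *
       (if (Sum.inr b : D.Root ⊕ D.NR) = Sum.inl (Sum.inl a) then 1 else a.x - pole (Sum.inr b))) =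
      if b = a then 1 else (a.w - b.w) * (a.w - b.w - 1) := by
    intro b hb
    have hba := Finset.ne_of_mem_erase hb
    rw [if_neg (by simpa using hba), if_neg (by simp), if_neg hba]
    simp only [pole, Sum.elim_inl, Sum.elim_inr, NR.x]; ring
  rw [Finset.prod_congr rfl this, if_neg (by simp)]
  simp only [pole, Sum.elim_inr, NR.x]; ring

theorem pole_prod_flip (hD : D.Admissible) (a : D.NR) :
    ∏ l ∈ (D.poles (D.τ a.node)).erase (Sum.inr a.flip), (-a.x - pole l) =
      (-a.x) ^ D.theta a.node *
        ∏ b : D.NR with b.node = a.node, if b = a then 1 else (a.w - b.w) * (a.w - b.w - 1) := by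
  have hm : a ∈ Finset.univ.filter fun b : D.NR => b.node = a.node := by simp
  rw [prod_erase_eq, prod_poles (D.τ a.node) _ (-a.x) (fun k _ => by simp [pole]), hD.theta_τ]
  congr 1
  rw [prod_flip hD, ← Finset.mul_prod_erase _ _ hm, ← Finset.mul_prod_erase _ (fun b =>
    if b = a then 1 else (a.w - b.w) * (a.w - b.w - 1)) hm, if_pos rfl, if_pos rfl]
  have : ∀ b ∈ (Finset.univ.filter fun b : D.NR => b.node = a.node).erase a,
      ((if (Sum.inl (Sum.inl b.flip) : D.Root ⊕ D.NR) = Sum.inr a.flip then 1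
        else -a.x - pole (Sum.inl (Sum.inl b.flip))) *
       (if (Sum.inr b.flip : D.Root ⊕ D.NR) = Sum.inr a.flip then 1
         else -a.x - pole (Sum.inr b.flip))) =
      if b = a then 1 else (a.w - b.w) * (a.w - b.w - 1) := by
    intro b hb
    have hba := Finset.ne_of_mem_erase hb
    have hba' : b.flip ≠ a.flip := fun e => hba (by rw [← b.flip_flip, e, a.flip_flip])
    rw [if_neg (by simp), if_neg (by simpa using hba'), if_neg hba]
    simp only [pole, Sum.elim_inl, Sum.elim_inr, NR.x, NR.w_flip]; ring
  rw [Finset.prod_congr rfl this, if_neg (by simp)]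
  simp only [pole, Sum.elim_inl, NR.x, NR.w_flip]; ring

theorem res_eq (hD : D.Admissible) (Zs : I → D.ZRing[X]) (hZ : D.IsZSplitting Zs) (ε : I → ℂ)
    (a : D.NR) : (sys hD Zs ε).res (Sum.inl a) * a.x ^ D.theta a.node =
      -((D.num₀ a.node).eval a.x * D.zeval (D.bZ a.node) a.x * ∏ b ∈ Finset.univ.erase a, a.gen b) := by
  have h : (sys hD Zs ε).res (Sum.inl a) = -((a.x - (D.cartan a.node (D.τ a.node) : D.K) / 4) *
      (NR.X Zs a * shift a.sh (NR.X Zs a.flip))) := rfl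
  have h1 := kappa_mul hD Zs hZ a
  have h2 := NR.prod_g_shift hD a
  rw [h, ← h1, NR.X, NR.X, map_mul]
  linear_combination (-NR.kappa Zs a * shift a.sh (NR.kappa Zs a.flip) * a.x ^ D.theta a.node) * h2

theorem pfRes_inl (hD : D.Admissible) (Zs : I → D.ZRing[X]) (hZ : D.IsZSplitting Zs) (ε : I → ℂ)
    (a : D.NR) : pfRes (D.numer a.node) a.node (Sum.inl (Sum.inl a)) =
      (sys hD Zs ε).res (Sum.inl a) := by
  have hx : a.x ^ D.theta a.node ≠ 0 := pow_ne_zero _ (NR.x_ne_zero hD a)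
  refine mul_right_cancel₀ hx ?_
  rw [res_eq hD Zs hZ, prod_gen hD, pfRes]
  change (D.numer a.node).eval a.x / (∏ l ∈ (D.poles a.node).erase (Sum.inl (Sum.inl a)),
    (a.x - pole l)) * _ = _
  have h2 : (a.x ^ D.theta a.node)⁻¹ * a.x ^ D.theta a.node = 1 := inv_mul_cancel₀ hx
  have h3 : ∀ F : D.K, (-F)⁻¹ = -F⁻¹ := fun F => inv_neg
  rw [pole_prod, numer_eval, div_eq_mul_inv, h3, mul_inv]
  generalize (a.x ^ D.theta a.node)⁻¹ = q at *
  generalize (∏ b : D.NR with b.node = a.node, if b = a then 1 else (a.w - b.w) * (a.w - b.w - 1))⁻¹ = p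
  generalize ∏ b : D.NR with D.adj a.node b.node, (a.x - b.w) = r
  generalize (D.num₀ a.node).eval a.x * D.zeval (D.bZ a.node) a.x = s
  linear_combination (-s * r * p) * h2

theorem pfRes_inr (hD : D.Admissible) (Zs : I → D.ZRing[X]) (hZ : D.IsZSplitting Zs) (ε : I → ℂ)
    (a : D.NR) : pfRes (D.numer (D.τ a.node)) (D.τ a.node) (Sum.inr a.flip) =
      (sys hD Zs ε).res (Sum.inl a) := by
  have hx : a.x ^ D.theta a.node ≠ 0 := pow_ne_zero _ (NR.x_ne_zero hD a)
  refine mul_right_cancel₀ hx ?_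
  rw [res_eq hD Zs hZ, prod_gen hD, pfRes]
  have hp : pole (Sum.inr a.flip) = -a.x := by
    simp only [pole, Sum.elim_inr, NR.w_flip, NR.x]; ring
  rw [hp, pole_prod_flip hD, numer_eval, prod_adj_neg hD, hD.ττ, neg_pow a.x]
  have h := num₀_neg hD (D.τ a.node) a.x
  rw [hD.ττ, hD.theta_τ] at h
  have h1 : (-1 : D.K) ^ D.theta a.node * (-1) ^ D.theta a.node = 1 := by
    rw [← mul_pow]; simp
  rw [← mul_assoc ((D.num₀ (D.τ a.node)).eval (-a.x) * _), h, div_eq_mul_inv, mul_inv, mul_inv,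
    inv_eq_of_mul_eq_one_right h1]
  have h2 : (a.x ^ D.theta a.node)⁻¹ * a.x ^ D.theta a.node = 1 := inv_mul_cancel₀ hx
  generalize (a.x ^ D.theta a.node)⁻¹ = q at *
  generalize (∏ b : D.NR with b.node = a.node, if b = a then 1 else (a.w - b.w) * (a.w - b.w - 1))⁻¹ = p
  generalize ∏ b : D.NR with D.adj a.node b.node, (a.x - b.w) = r
  generalize (D.num₀ a.node).eval a.x * D.zeval (D.bZ a.node) a.x = s
  linear_combination (-s * r * p * q * a.x ^ D.theta a.node) * h1 - s * r * p * h2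

end Datum

end

section

namespace Datum

universe uI
variable {I : Type uI} {D : Datum I} [Fintype I]

open Polynomial

theorem prod_adj_zero (hD : D.Admissible) {i : I} (hi : D.τ i = i) :
    ∏ b : D.NR with D.adj i b.node, (0 - b.w) =
      (-1) ^ (Finset.univ.filter fun t : D.T => D.adj i t.1).card *
        (∏ t : D.T with D.adj i t.1, -om t) ^ 2 := by
  rw [Finset.prod_filter, Fintype.prod_prod_type, ← Finset.prod_const, ← Finset.prod_pow,
    ← Finset.prod_mul_distrib, Finset.prod_filter]
  refine Finset.prod_congr rfl fun t _ => ?_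
  have : D.adj i (D.τ t.1) ↔ D.adj i t.1 := by rw [← adj_τ_iff hD, hi]
  simp only [Fintype.prod_bool, NR.node, NR.w, if_true, Bool.false_eq_true, if_false, this]
  split_ifs
  · ring
  · ring

theorem card_adj (hD : D.Admissible) {i : I} (hi : D.τ i = i) :
    (Finset.univ.filter fun t : D.T => D.adj i t.1).card = ∑ j with D.adj i j ∧ D.mem j, D.fv j := by
  have hτ : ∀ F : I → ℕ, ∑ j with D.adj i j, F (D.τ j) = ∑ j with D.adj i j, F j := by
    intro F
    refine Finset.sum_nbij' D.τ D.τ ?_ ?_ ?_ ?_ ?_ <;>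
      simp [hD.ττ, ← adj_τ_iff hD, hi]
  have h1 : (Finset.univ.filter fun t : D.T => D.adj i t.1).card = ∑ j with D.adj i j, D.len j := by
    rw [Finset.card_eq_sum_ones, Finset.sum_filter, Fintype.sum_sigma, Finset.sum_filter]
    refine Finset.sum_congr rfl fun j _ => ?_
    split_ifs <;> simp
  have h2 : ∑ j with D.adj i j ∧ D.mem j, D.fv j =
      ∑ j with D.adj i j, if D.mem j then D.fv j else 0 := by
    rw [← Finset.filter_filter, Finset.sum_filter (p := fun j => D.mem j)]
  have h3 : ∑ j with D.adj i j, (D.len j + D.len (D.τ j)) =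
      ∑ j with D.adj i j, ((if D.mem j then D.fv j else 0) +
        (if D.mem (D.τ j) then D.fv (D.τ j) else 0)) := by
    refine Finset.sum_congr rfl fun j _ => ?_
    by_cases hj : D.τ j = j
    · have : D.mem j := Or.inr hj
      rw [hj, if_pos this, len, if_pos hj]
    · rw [len_add hD hj, hD.fv_τ]
      by_cases hm : D.mem j
      · have : ¬ D.mem (D.τ j) := fun e => (hD.mem_τ hj).1 e hm
        rw [if_pos hm, if_neg this, add_zero]
      · rw [if_neg hm, if_pos ((hD.mem_τ hj).2 hm), zero_add]
  rw [Finset.sum_add_distrib, Finset.sum_add_distrib, hτ D.len,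
    hτ (fun j => if D.mem j then D.fv j else 0)] at h3
  omega

theorem pfRes_zero (hD : D.Admissible) (Zs : I → D.ZRing[X]) (ε : I → ℂ) (hε : D.IsRootChoice ε)
    (k : {i : I // D.theta i = 1}) : pfRes (D.numer k) k (Sum.inl (Sum.inr k)) =
      2 * (sys hD Zs ε).res (Sum.inr k) := by
  obtain ⟨i, hi⟩ := k
  have hf := fixed_of_theta hi
  have h0 : (2 : D.K) * (sys hD Zs ε).res (Sum.inr ⟨i, hi⟩) = D.X₀ Zs ε i ^ 2 := by
    change (2 : D.K) * -((0 - (D.cartan i (D.τ i) : D.K) / 4) * D.X₀ Zs ε i ^ 2) = _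
    rw [hf, hD.c_self]; push_cast; ring
  have h1 : ∏ l ∈ (D.poles i).erase (Sum.inl (Sum.inr ⟨i, hi⟩)), (0 - pole l) =
      (∏ t : D.T with t.1 = i, (1 / 4 - om t ^ 2)) ^ 2 := by
    have h2 : (∏ t : D.T with t.1 = i, (1 / 4 - om t ^ 2)) ^ 2 =
        (∏ t : D.T with t.1 = i, (om t ^ 2 - 1 / 4)) ^ 2 := by
      rw [← Finset.prod_pow, ← Finset.prod_pow]
      exact Finset.prod_congr rfl fun t _ => by ring
    rw [h2]
    rw [prod_erase_eq, prod_poles i _ 1 (fun k hk => by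
      rw [if_pos]; subst hk; rfl), one_pow, one_mul, prod_NR hD, hf, pow_two]
    congr 1 <;>
    · refine Finset.prod_congr rfl fun t _ => ?_
      rw [if_neg (by simp), if_neg (by simp)]
      simp [pole, NR.x, NR.w]
      ring
  have hev : D.sigma i = 0 := by
    have h2 := even_parity hD i
    have h3 : D.nadj i = 2 * (Finset.univ.filter fun t : D.T => D.adj i t.1).card := by
      rw [nadj, Finset.card_filter, Fintype.sum_prod_type, Finset.card_filter, Finset.mul_sum]
      refine Finset.sum_congr rfl fun t _ => ?_
      have : D.adj i (D.τ t.1) ↔ D.adj i t.1 := by rw [← adj_τ_iff hD, hf]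
      simp only [Fintype.sum_bool, NR.node, if_true, Bool.false_eq_true, if_false, this]
      ring
    rw [sth_eq_zero hD hi, h3] at h2
    rw [sigma, if_pos hf]
    obtain ⟨m, hm⟩ := h2
    omega
  have h4 : D.zeval (D.bZ i) 0 = (-1) ^ D.fw i * D.zeval (D.Z Zs i) 0 ^ 2 := by
    have h5 : D.zeval (D.Z Zs i) 0 = ∏ s ∈ Finset.Icc 1 (D.fw i), (0 - D.zToK (D.z i s)) := by
      rw [zeval, Z, if_pos hf, eval₂_finsetProd]; simp
    rw [bZ_eval, if_pos hf, hev, pow_zero, one_mul, h5, ← Finset.prod_pow,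
      Finset.prod_congr rfl fun s _ => show (0 : D.K) ^ 2 - D.zToK (D.z i s) ^ 2 =
        -1 * (0 - D.zToK (D.z i s)) ^ 2 by ring, Finset.prod_mul_distrib, Finset.prod_const,
      Nat.card_Icc, Nat.add_sub_cancel]
  have h6 : algebraMap ℂ D.K (ε i) ^ 2 = (-1) ^ D.fw i *
      (-1) ^ (Finset.univ.filter fun t : D.T => D.adj i t.1).card := by
    rw [← map_pow, hε i hf, card_adj hD hf, ← pow_add, map_pow, map_neg, map_one]
  rw [h0, pfRes]
  change (D.numer i).eval 0 / (∏ l ∈ (D.poles i).erase (Sum.inl (Sum.inr ⟨i, hi⟩)), (0 - pole l)) = _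
  rw [h1, numer_eval, prod_adj_zero hD hf, num₀, if_pos hf, if_pos hi, eval_one, h4, X₀, prod_f₀ hD,
    neg_mul, neg_sq, mul_pow, mul_pow, h6, mul_pow, inv_pow, div_eq_mul_inv]
  ring

variable (D) in
/-- The location of a point. -/
def rx : D.Root → D.K := Sum.elim NR.x fun _ => 0

variable (D) in
/-- The node of a point. -/
def rnd : D.Root → I := Sum.elim NR.node Subtype.val

/-- A sum of residues over the poles of `u H_i(u)`. -/
theorem sum_poles (hD : D.Admissible) (Zs : I → D.ZRing[X]) (hZ : D.IsZSplitting Zs) (ε : I → ℂ)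
    (hε : D.IsRootChoice ε) (i : I) (F : D.K → D.K) :
    ∑ k ∈ D.poles i, pfRes (D.numer i) i k * F (pole k) =
      ∑ a with D.rnd a = i, (sys hD Zs ε).res a * F (D.rx a) +
      ∑ a with D.rnd a = D.τ i, (sys hD Zs ε).res a * F (-D.rx a) := by
  rw [poles, Finset.sum_filter, Finset.sum_filter, Finset.sum_filter]
  simp only [Fintype.sum_sum_type, pnode, rnd, rx, Sum.elim_inl, Sum.elim_inr, pole]
  have h1 : ∀ b : D.NR, (if b.node = i then pfRes (D.numer i) i (Sum.inl (Sum.inl b)) * F b.x else 0) =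
      if b.node = i then (sys hD Zs ε).res (Sum.inl b) * F b.x else 0 := by
    intro b
    split_ifs with h
    · subst h; rw [pfRes_inl hD Zs hZ]
    · rfl
  have h2 : ∀ k : {i : I // D.theta i = 1},
      (if (k : I) = i then pfRes (D.numer i) i (Sum.inl (Sum.inr k)) * F 0 else 0) =
      (if (k : I) = i then (sys hD Zs ε).res (Sum.inr k) * F 0 else 0) +
      if (k : I) = D.τ i then (sys hD Zs ε).res (Sum.inr k) * F (-0) else 0 := by
    intro k
    have : (k : I) = D.τ i ↔ (k : I) = i := by
      rw [← hD.τ_inj, hD.ττ, fixed_of_theta k.2]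
    rw [neg_zero]
    simp only [this]
    split_ifs with h
    · subst h; rw [pfRes_zero hD Zs ε hε]; ring
    · rw [add_zero]
  have h3 : ∑ b : D.NR, (if b.node = i then pfRes (D.numer i) i (Sum.inr b) * F (b.w + 1 / 2) else 0) =
      ∑ b : D.NR, if b.node = D.τ i then (sys hD Zs ε).res (Sum.inl b) * F (-b.x) else 0 := by
    rw [← Finset.sum_filter, ← Finset.sum_filter, ← hD.ττ i, sum_flip hD (D.τ i), hD.ττ]
    refine Finset.sum_congr rfl fun b hb => ?_
    have hb' : b.node = D.τ i := by simpa using hb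
    have := pfRes_inr hD Zs hZ ε b
    rw [hb', hD.ττ] at this
    rw [this, NR.w_flip, NR.x]
    congr 2; ring
  have e2 := Finset.sum_congr (rfl : (Finset.univ : Finset {i : I // D.theta i = 1}) = _)
    fun k _ => h2 k
  rw [Finset.sum_add_distrib] at e2
  have h4 : ∀ p q r t : D.K, p + (q + r) + t = p + q + (t + r) := fun p q r t => by ring
  exact (congrArg₂ (· + ·) (congrArg₂ (· + ·) (Finset.sum_congr rfl fun b _ => h1 b) e2) h3).trans
    (h4 _ _ _ _)

theorem coeff_HSer_div (hD : D.Admissible) (Zs : I → D.ZRing[X]) (hZ : D.IsZSplitting Zs) (ε : I → ℂ)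
    (hε : D.IsRootChoice ε) (i : I) (Q M : D.K[X]) (hQ : D.numer i = Q * M)
    (hQne : evalU D.K Q ≠ 0) (hQ0 : ∀ k ∈ D.poles i, Q.eval (pole k) ≠ 0) (n : ℕ) :
    (D.u * D.HSer i / evalU D.K Q).coeff ((n : ℤ) + 1) =
      ∑ a with D.rnd a = i, (sys hD Zs ε).res a * (D.rx a ^ n / Q.eval (D.rx a)) +
      ∑ a with D.rnd a = D.τ i, (sys hD Zs ε).res a * ((-D.rx a) ^ n / Q.eval (-D.rx a)) := by
  have h : D.u * D.HSer i / evalU D.K Q =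
      evalU D.K M / evalU D.K (∏ k ∈ D.poles i, (X - C (pole k))) := by
    have hd : ∀ q m d : D.Ser, q ≠ 0 → q * m / d / q = m / d := fun q m d h => by field_simp
    rw [u_mul_HSer hD, hQ, map_mul]
    exact hd _ _ _ hQne
  rw [h, coeff_partial_fractions _ _ (pole_injOn hD i), ← sum_poles hD Zs hZ ε hε i
    fun v => v ^ n / Q.eval v]
  refine Finset.sum_congr rfl fun k hk => ?_
  have h1 := hQ0 k hk
  have hd : ∀ q m d x : D.K, q ≠ 0 → m / d * x = q * m / d * (x / q) :=
    fun q m d x h => by field_simp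
  rw [pfRes, hQ, eval_mul]
  have h2 := hd (Q.eval (pole k)) (M.eval (pole k)) (∏ l ∈ (D.poles i).erase k, (pole k - pole l))
    (pole k ^ n) h1
  convert h2

end Datum

end

section

namespace Datum

universe uI
variable {I : Type uI} {D : Datum I} [Fintype I]

open Polynomial

/-! ### The order of `H_i(u)` -/

theorem isMonicSer_lin {K : Type*} [Field K] (p : K) : IsMonicSer 1 (lin p) := isMonicSer_linear p

theorem isMonicSer_inv_lin {K : Type*} [Field K] (p : K) : IsMonicSer (-1) (lin p)⁻¹ :=
  isMonicSer_inv_linear p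

theorem evalU_bZ (i : I) : evalU D.K ((D.bZ i).map D.zToK) =
    if D.τ i = i then lin 0 ^ D.sigma i * ∏ s ∈ Finset.Icc 1 (D.fw i),
      (lin (D.zToK (D.z i s)) * lin (-D.zToK (D.z i s)))
    else ∏ s ∈ Finset.Icc 1 (D.fw i), lin (D.zToK (D.z i s)) := by
  rw [bZ]
  split_ifs
  · rw [Polynomial.map_mul, map_mul, Polynomial.map_pow, map_X, map_pow, evalU_X,
      Polynomial.map_prod, map_prod, lin, map_zero, sub_zero]
    congr 1
    refine Finset.prod_congr rfl fun s _ => ?_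
    rw [Polynomial.map_sub, Polynomial.map_pow, Polynomial.map_pow, map_X, map_C, map_sub, map_pow,
      map_pow, evalU_X, evalU_C, lin, lin, map_neg]
    ring
  · rw [Polynomial.map_prod, map_prod]
    exact Finset.prod_congr rfl fun s _ => by simp [lin]

theorem inv_mul_pow {F : Type*} [Field F] (a b : F) (n : ℕ) : ((a * b) ^ n)⁻¹ = (a⁻¹ * b⁻¹) ^ n := by
  rw [← mul_inv, inv_pow]

theorem base_eq (i : I) : D.base i =
    lin (-((D.wp i : D.K) / 4)) * (lin 0)⁻¹ *
      (lin (1 / 2) * lin (-1 / 2) * ((lin 0)⁻¹ * (lin 0)⁻¹)) ^ D.vartheta i *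
      evalU D.K ((D.bZ i).map D.zToK) * ((lin (1 / 2))⁻¹ * (lin (-1 / 2))⁻¹) ^ D.theta i *
      lin 0 ^ D.sth i := by
  have hu : D.u ≠ 0 := u_ne_zero
  have e0 : (lin (0 : D.K)) = D.u := u_eq.symm
  have e1 : (lin (-((D.wp i : D.K) / 4)) : D.Ser) = D.u + (D.wp i : D.Ser) / 4 := by
    rw [lin, map_neg, sub_neg_eq_add, map_div₀, map_intCast, map_ofNat]; rfl
  have e2 : (lin (1 / 2 : D.K)) = D.u - 1 / 2 := by rw [lin, map_div₀, map_one, map_ofNat]; rfl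
  have e3 : (lin (-1 / 2 : D.K)) = D.u + 1 / 2 := by
    rw [lin, neg_half, map_neg, map_div₀, map_one, map_ofNat, sub_neg_eq_add]; rfl
  have e4 : (1 : D.Ser) - 1 / (4 * D.u ^ 2) =
      (D.u - 1 / 2) * (D.u + 1 / 2) * (D.u⁻¹ * D.u⁻¹) := by
    have h2 : (2 : D.Ser) ≠ 0 := by
      have h := (map_ne_zero (HahnSeries.C : D.K →+* D.Ser)).2 (two_ne_zero' D.K)
      rwa [map_ofNat] at h
    have h4 : (4 : D.Ser) = 2 * 2 := by norm_num
    rw [h4]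
    generalize D.u = U at *
    field_simp
    ring
  have e5 : (1 : D.Ser) + (D.wp i : D.Ser) / (4 * D.u) = (D.u + (D.wp i : D.Ser) / 4) * D.u⁻¹ := by
    field_simp
  have e6 : ∀ (F G : D.Ser) (n : ℕ), ((F * G) ^ n)⁻¹ = (F⁻¹ * G⁻¹) ^ n :=
    fun F G n => inv_mul_pow F G n
  rw [base, e4, e5, e1, e2, e3, e0, sth, div_eq_mul_inv ((_ : D.Ser) * _), e6]
  ring

theorem isMonicSer_phi {K : Type*} [Field K] {c : ℤ} (hc : c = 2 ∨ c = -1 ∨ c = 0) (w : K) :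
    IsMonicSer (-c) (phi c w) := by
  unfold phi
  rcases hc with rfl | rfl | rfl
  · rw [if_pos rfl, mul_inv]; exact (isMonicSer_inv_lin _).mul (isMonicSer_inv_lin _)
  · rw [if_neg (by norm_num), if_pos rfl]; exact isMonicSer_lin _
  · rw [if_neg (by norm_num), if_neg (by norm_num)]; exact isMonicSer_one

theorem isMonicSer_bZ (i : I) : IsMonicSer (D.wt i) (evalU D.K ((D.bZ i).map D.zToK)) := by
  rw [evalU_bZ]
  split_ifs with hi
  · have h := ((isMonicSer_lin (0 : D.K)).pow (D.sigma i)).mul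
      (IsMonicSer.prod (Finset.Icc 1 (D.fw i)) _ _ fun s _ =>
        (isMonicSer_lin (D.zToK (D.z i s))).mul (isMonicSer_lin (-D.zToK (D.z i s))))
    convert h using 1
    rw [Finset.sum_const, Nat.card_Icc, sigma, fw, if_pos hi, if_pos hi]
    simp; omega
  · have h := IsMonicSer.prod (Finset.Icc 1 (D.fw i)) _ _ fun s _ =>
      (isMonicSer_lin (D.zToK (D.z i s)))
    convert h using 1
    rw [Finset.sum_const, Nat.card_Icc, fw, if_neg hi]
    simp

/-- `H_i(u)` has leading term `u^{⟨μ, α_i⟩}`. -/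
theorem isMonicSer_HSer (hD : D.Admissible) (i : I) : IsMonicSer (D.mu i) (D.HSer i) := by
  have h := ((((((isMonicSer_lin (-((D.wp i : D.K) / 4))).mul (isMonicSer_inv_lin 0)).mul
    (IsMonicSer.pow (((isMonicSer_lin (1 / 2 : D.K)).mul (isMonicSer_lin (-1 / 2))).mul
      ((isMonicSer_inv_lin 0).mul (isMonicSer_inv_lin 0))) (D.vartheta i))).mul
    (isMonicSer_bZ i)).mul (IsMonicSer.pow ((isMonicSer_inv_lin (1 / 2 : D.K)).mul
      (isMonicSer_inv_lin (-1 / 2))) (D.theta i))).mul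
    (IsMonicSer.pow (isMonicSer_lin (0 : D.K)) (D.sth i))).mul
    (IsMonicSer.prod Finset.univ _ _ fun (b : D.NR) _ =>
      isMonicSer_phi (c_cases hD i b.node) b.w)
  rw [← base_eq, ← HSer_eq hD] at h
  convert h using 1
  have h1 : ∑ b : D.NR, -D.cartan i b.node = ∑ j, -D.cartan i j * ((D.v j : ℤ) - D.theta j) := by
    have h2 := sum_by_node (D := D) (fun _ => True) (fun b : D.NR => -D.cartan i b.node)
    simp only [Finset.filter_true] at h2
    rw [h2]
    refine Finset.sum_congr rfl fun j _ => ?_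
    have h3 := card_node hD j
    rw [Finset.sum_congr rfl fun b hb => show -D.cartan i (NR.node b) = -D.cartan i j by
      rw [show NR.node b = j by simpa using hb], Finset.sum_const, nsmul_eq_mul, ← h3]
    push_cast; ring
  have h4 : (D.sth i : ℤ) = 2 * D.theta i + ∑ j, -D.cartan i j * (D.theta j : ℤ) := by
    rw [sth, Nat.cast_sum, Finset.sum_filter, ← Finset.add_sum_erase _ _ (Finset.mem_univ i),
      ← Finset.add_sum_erase _ (fun j => -D.cartan i j * (D.theta j : ℤ)) (Finset.mem_univ i),
      hD.c_self, if_neg (hD.not_adj_self i)]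
    have : ∑ j ∈ Finset.univ.erase i, (if D.adj i j then (D.theta j : ℤ) else 0) =
        ∑ j ∈ Finset.univ.erase i, -D.cartan i j * (D.theta j : ℤ) := by
      refine Finset.sum_congr rfl fun j hj => ?_
      have hne : i ≠ j := fun e => by simp [e] at hj
      rw [hD.adj_iff]
      rcases hD.c_off i j hne with h' | h' <;> rw [h'] <;> simp
    rw [this]; ring
  have h5 := hD.diff i
  have h6 : (D.wt i : ℤ) = D.lam i := Int.toNat_of_nonneg (hD.lam_nonneg i)
  rw [h1, h4, h6]
  simp only [mul_sub, Finset.sum_sub_distrib]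
  have h7 : ∑ j, -D.cartan i j * (D.v j : ℤ) = -∑ j, (D.v j : ℤ) * D.cartan j i := by
    rw [← Finset.sum_neg_distrib]
    exact Finset.sum_congr rfl fun j _ => by rw [hD.c_symm j i]; ring
  rw [h7, ← h5]
  ring

/-! ### The relations between the `B_i` -/

theorem sys_quad (hD : D.Admissible) (Zs : I → D.ZRing[X]) (hZ : D.IsZSplitting Zs) (ε : I → ℂ)
    (hε : D.IsRootChoice ε) (i j : I) (p q : ℕ) :
    ⁅(sys hD Zs ε).B i (p + 1), (sys hD Zs ε).B j q⁆
      - ⁅(sys hD Zs ε).B i p, (sys hD Zs ε).B j (q + 1)⁆ =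
      ((D.cartan i j : D.K) / 2) • acomm ((sys hD Zs ε).B i p) ((sys hD Zs ε).B j q)
      + (if D.τ i = j then (2 * (-1) ^ (p + 1) * (D.HSer j).coeff ((p + q : ℕ) + 2)) • (1 : D.Op)
        else 0) := by
  refine (sys hD Zs ε).quad_rel hD.ττ i j p q _ fun (h : D.τ i = j) => ?_
  have h1 := coeff_HSer_div hD Zs hZ ε hε j 1 (D.numer j) (by rw [one_mul]) (by rw [map_one]; exact one_ne_zero)
    (fun k _ => by rw [eval_one]; exact one_ne_zero) (p + q)
  have hd : ∀ F : D.Ser, F / 1 = F := fun F => div_one F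
  have hk : ∀ F : D.K, F / 1 = F := fun F => div_one F
  have h2 : (D.u * D.HSer j).coeff (((p + q : ℕ) : ℤ) + 1) = (D.HSer j).coeff ((p + q : ℕ) + 2) := by
    rw [u, show (HahnSeries.single (-1 : ℤ) (1 : D.K)) = invVar D.K from rfl, coeff_invVar_mul]
    congr 1
  rw [map_one, hd, h2] at h1
  simp only [eval_one, hk] at h1
  have : D.τ j = i := by rw [← h, hD.ττ]
  rw [this] at h1
  exact h1

theorem sys_comm (hD : D.Admissible) (Zs : I → D.ZRing[X]) (hZ : D.IsZSplitting Zs) (ε : I → ℂ)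
    (hε : D.IsRootChoice ε) (i j : I) (p q : ℕ) (hc : D.cartan i j = 0) :
    ⁅(sys hD Zs ε).B i p, (sys hD Zs ε).B j q⁆ =
      if D.τ i = j then ((-1) ^ p * (D.HSer j).coeff ((p + q : ℕ) + 1)) • (1 : D.Op) else 0 := by
  refine (sys hD Zs ε).comm_rel hD.ττ i j p q _ hc fun (h : D.τ i = j) => ?_
  have hi : D.τ j = i := by rw [← h, hD.ττ]
  have hf : D.τ j ≠ j := fun e => by
    rw [e] at hi; rw [hi, hD.c_self] at hc; norm_num at hc
  have hw : D.wp j = 0 := NR.wp_eq_zero hD (by rw [hi, hD.c_symm, hc]; norm_num)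
  have hfix : ∀ k : {i : I // D.theta i = 1}, (k : I) ≠ j ∧ (k : I) ≠ D.τ j := fun k =>
    ⟨fun e => hf (by rw [← e, fixed_of_theta k.2]),
      fun e => by
      have h1 := fixed_of_theta k.2
      rw [e, hD.ττ] at h1
      exact hf h1.symm⟩
  have h0 : ∀ b : D.NR, b.w + 1 / 2 ≠ 0 := fun b => by
    have := NR.w_add_ne hD b (1 / 2); push_cast at this; exact this
  have h1 := coeff_HSer_div hD Zs hZ ε hε j X (X ^ D.sth j * (D.bZ j).map D.zToK *
    ∏ b : D.NR with D.adj j b.node, (X - C b.w)) (by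
      rw [numer, num₀, if_neg hf, hw]; simp only [Int.cast_zero, zero_div, map_zero, add_zero]; ring)
    (by rw [evalU_X]; exact invVar_ne_zero)
    (fun k hk => by
      rw [eval_X]
      simp only [poles, Finset.mem_filter, Finset.mem_univ, true_and] at hk
      rcases k with (b | k) | b
      · exact NR.x_ne_zero hD b
      · exact absurd hk (hfix k).1
      · exact h0 b) (p + q)
  have hd : ∀ F G : D.Ser, F ≠ 0 → F * G / F = G := fun F G h => by
    field_simp
  rw [evalU_X, u, show (HahnSeries.single (-1 : ℤ) (1 : D.K)) = invVar D.K from rfl,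
    hd _ _ invVar_ne_zero, hi] at h1
  simp only [eval_X] at h1
  rw [h1, ← Finset.sum_neg_distrib]
  congr 1
  · refine Finset.sum_congr rfl fun a ha => ?_
    have ha : D.rnd a = j := (Finset.mem_filter.1 ha).2
    rcases a with a | k
    · have hx := NR.x_ne_zero hD a
      have hr : (sys hD Zs ε).res (Sum.inl a) = -(a.x * (sys hD Zs ε).h (Sum.inl a)) := by
        change -((a.x - (D.cartan a.node (D.τ a.node) : D.K) / 4) * _) = _
        rw [show a.node = j from ha, hi, hD.c_symm, hc]; push_cast; ring
      rw [hr]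
      change -(a.x * _) * (a.x ^ _ / a.x) = -(_ * a.x ^ _)
      generalize (sys hD Zs ε).h (Sum.inl a) = h at *
      field_simp
    · exact absurd ha (hfix k).1
  · refine Finset.sum_congr rfl fun a ha => ?_
    have ha : D.rnd a = i := (Finset.mem_filter.1 ha).2
    rcases a with a | k
    · have hx := NR.x_ne_zero hD a
      have hr : (sys hD Zs ε).res (Sum.inl a) = -(a.x * (sys hD Zs ε).h (Sum.inl a)) := by
        change -((a.x - (D.cartan a.node (D.τ a.node) : D.K) / 4) * _) = _
        rw [show a.node = i from ha, h, hc]; push_cast; ring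
      rw [hr]
      change -(a.x * _) * ((-a.x) ^ _ / -a.x) = _ * (-a.x) ^ _
      generalize (sys hD Zs ε).h (Sum.inl a) = h at *
      generalize (-a.x) ^ (p + q) = t
      field_simp
    · exact absurd (ha.trans hi.symm) (hfix k).2

end Datum

end

section

namespace Datum

universe uI
variable {I : Type uI} {D : Datum I} [Fintype I]

open Polynomial

/-! ### The Serre relation at a fixed node -/

theorem coeff_lin_neg_mul {K : Type*} [Field K] (p : K) (F : LaurentSeries K) (n : ℤ) :
    (lin p * lin (-p) * F).coeff n = F.coeff (n + 2) - p ^ 2 * F.coeff n := by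
  rw [mul_assoc, coeff_lin_mul, coeff_lin_mul, coeff_lin_mul, show n + 1 + 1 = n + 2 by ring]
  ring

variable (D) in
/-- `H_i(u) / (u² - w²)`. -/
def splitSer (i : I) (w : D.K) : D.Ser := D.HSer i * ((lin w)⁻¹ * (lin (-w))⁻¹)

theorem lin_mul_splitSer (i : I) (w : D.K) : lin w * lin (-w) * D.splitSer i w = D.HSer i := by
  have h1 := lin_ne_zero w
  have h2 := lin_ne_zero (-w)
  rw [splitSer]
  generalize lin w = A at *
  generalize lin (-w) = B at *
  field_simp

theorem isMonicSer_splitSer (hD : D.Admissible) (i : I) (w : D.K) :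
    IsMonicSer (D.mu i - 2) (D.splitSer i w) :=
  (isMonicSer_HSer hD i).mul ((isMonicSer_inv_lin w).mul (isMonicSer_inv_lin (-w)))

theorem HSer_coeff_eq (i : I) (w : D.K) (n : ℤ) : (D.HSer i).coeff n =
    (D.splitSer i w).coeff (n + 2) - w ^ 2 * (D.splitSer i w).coeff n := by
  rw [← coeff_lin_neg_mul, lin_mul_splitSer]

theorem shift_HSer_coeff_eq (hD : D.Admissible) (Zs : I → D.ZRing[X]) (ε : I → ℂ) {i : I}
    (hi : D.τ i = i) (b : D.Root) (hb : D.cartan i (D.rnd b) = -1) (n : ℤ) :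
    (sys hD Zs ε).σ b ((D.HSer i).coeff n) =
      (D.splitSer i (D.rx b + 1 / 2)).coeff (n + 2)
        - (D.rx b - 1 / 2) ^ 2 * (D.splitSer i (D.rx b + 1 / 2)).coeff n := by
  rcases b with a | k
  · have hb : D.cartan i a.node = -1 := hb
    have h := HSer_shift hD i a
    have e1 : a.x + ((-1 : ℤ) : D.K) / 2 = a.x - 1 / 2 := by push_cast; ring
    have e2 : -a.x - ((-1 : ℤ) : D.K) / 2 = -(a.x - 1 / 2) := by push_cast; ring
    have e3 : a.x - ((-1 : ℤ) : D.K) / 2 = a.x + 1 / 2 := by push_cast; ring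
    have e4 : -a.x + ((-1 : ℤ) : D.K) / 2 = -(a.x + 1 / 2) := by push_cast; ring
    rw [hi, hb, e1, e2, e3, e4, ← lin_mul_splitSer i (a.x + 1 / 2), mul_left_comm] at h
    have h1 := mul_left_cancel₀ (mul_ne_zero (lin_ne_zero _) (lin_ne_zero _)) h
    rw [lin_mul_splitSer] at h1
    change shift a.sh _ = (D.splitSer i (a.x + 1 / 2)).coeff (n + 2)
        - (a.x - 1 / 2) ^ 2 * (D.splitSer i (a.x + 1 / 2)).coeff n
    rw [← coeff_lin_neg_mul, h1, mapSer_coeff]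
  · change shift 0 _ = (D.splitSer i (0 + 1 / 2)).coeff (n + 2)
        - (0 - 1 / 2) ^ 2 * (D.splitSer i (0 + 1 / 2)).coeff n
    rw [shift_zero, HSer_coeff_eq i (0 + 1 / 2)]
    simp

theorem numer_dvd (hD : D.Admissible) {i : I} (hi : D.τ i = i) (b : D.Root)
    (hb : D.cartan i (D.rnd b) = -1) :
    (X - C (D.rx b + 1 / 2)) * (X - C (-(D.rx b + 1 / 2))) ∣ D.numer i := by
  rcases b with a | k
  · have hb : D.adj i a.node := (hD.adj_iff _ _).2 hb
    have hx : D.rx (Sum.inl a) + 1 / 2 = a.w := by change a.w - 1 / 2 + 1 / 2 = _; ring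
    rw [hx, ← NR.w_flip]
    refine Dvd.dvd.mul_left ?_ _
    have hb' : D.adj i a.flip.node := by rw [NR.node_flip hD, ← adj_τ_iff hD, hi]; exact hb
    rw [← Finset.mul_prod_erase _ _ (show a ∈ Finset.univ.filter fun b : D.NR => D.adj i b.node by
      simpa using hb), ← Finset.mul_prod_erase _ _ (show a.flip ∈
      (Finset.univ.filter fun b : D.NR => D.adj i b.node).erase a by
        simpa [NR.flip_ne] using hb'), ← mul_assoc]
    exact dvd_mul_right _ _
  · have hb : D.cartan i k = -1 := hb
    have hx : D.rx (Sum.inr k) + 1 / 2 = 1 / 2 := by change (0 : D.K) + 1 / 2 = _; ring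
    have hv := vartheta_eq_one hi (by rw [hb]; norm_num) k.2
    have hθ : D.theta i ≠ 1 := fun e => by
      have := sth_eq_zero hD e
      rw [sth, Finset.sum_eq_zero_iff] at this
      have h := this k (by simpa using (hD.adj_iff _ _).2 hb)
      rw [k.2] at h; exact one_ne_zero h
    rw [hx, numer, num₀, if_pos hi, if_neg hθ, hv, pow_one, mul_assoc]
    refine Dvd.dvd.mul_right ?_ _
    refine Dvd.dvd.mul_left (dvd_of_eq ?_) _
    have : (C (1 / 4) : D.K[X]) = C (1 / 2) * C (1 / 2) := by rw [← C_mul]; congr 1; ring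
    rw [this, C_neg]; ring

theorem eval_pole_ne (hD : D.Admissible) {i : I} (hi : D.τ i = i) (b : D.Root)
    (hb : D.cartan i (D.rnd b) = -1) (k : D.Root ⊕ D.NR) (hk : k ∈ D.poles i) :
    ((X - C (D.rx b + 1 / 2)) * (X - C (-(D.rx b + 1 / 2)))).eval (pole k) ≠ 0 := by
  have hk : pnode k = i := (Finset.mem_filter.1 hk).2
  rw [eval_mul, eval_sub, eval_sub, eval_X, eval_C, eval_C]
  rcases b with a | l
  · have hb : D.cartan i a.node = -1 := hb
    have hx : D.rx (Sum.inl a) + 1 / 2 = a.w := by change a.w - 1 / 2 + 1 / 2 = _; ring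
    rw [hx]
    have h1 : ∀ c : D.NR, c.node = i → a ≠ c := by
      rintro c hc rfl; rw [hc, hD.c_self] at hb; norm_num at hb
    have h2 : ∀ c : D.NR, c.node = i → a.flip ≠ c := by
      rintro c hc rfl
      rw [NR.node_flip hD] at hc
      rw [← hD.ττ a.node, hc, hi, hD.c_self] at hb; norm_num at hb
    rcases k with (c | k) | c
    · have g1 := NR.w_sub_w_ne hD (h1 c hk) (-1 / 2)
      have g2 := NR.w_sub_w_ne hD (h2 c hk) (-1 / 2)
      rw [NR.w_flip] at g2
      refine mul_ne_zero (fun e => g1 ?_) fun e => g2 ?_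
      all_goals
        rw [← e]; change _ = c.w - 1 / 2 - _; push_cast; ring
    · have := NR.w_ne_zero hD a
      refine mul_ne_zero (fun e => this ?_) fun e => this ?_
      · change (0 : D.K) - a.w = 0 at e; linear_combination -e
      · change (0 : D.K) - -a.w = 0 at e; linear_combination e
    · have g1 := NR.w_sub_w_ne hD (h1 c hk) (1 / 2)
      have g2 := NR.w_sub_w_ne hD (h2 c hk) (1 / 2)
      rw [NR.w_flip] at g2
      refine mul_ne_zero (fun e => g1 ?_) fun e => g2 ?_
      all_goals
        rw [← e]; change _ = c.w + 1 / 2 - _; push_cast; ring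
  · have hb : D.cartan i l = -1 := hb
    have hx : D.rx (Sum.inr l) + 1 / 2 = 1 / 2 := by change (0 : D.K) + 1 / 2 = _; ring
    have hθ : D.theta i ≠ 1 := fun e => by
      have := sth_eq_zero hD e
      rw [sth, Finset.sum_eq_zero_iff] at this
      have h := this l (by simpa using (hD.adj_iff _ _).2 hb)
      rw [l.2] at h; exact one_ne_zero h
    rw [hx]
    rcases k with (c | k) | c
    · refine mul_ne_zero (fun e => NR.w_add_ne hD c (-1) ?_) fun e => NR.w_add_ne hD c 0 ?_
      all_goals
        rw [← e]; change _ = c.w - 1 / 2 - _; push_cast; ring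
    · exact absurd (by rw [← hk]; exact k.2) hθ
    · refine mul_ne_zero (fun e => NR.w_add_ne hD c 0 ?_) fun e => NR.w_add_ne hD c 1 ?_
      all_goals
        rw [← e]; change _ = c.w + 1 / 2 - _; push_cast; ring

theorem sys_serre_fixed (hD : D.Admissible) (Zs : I → D.ZRing[X]) (hZ : D.IsZSplitting Zs) (ε : I → ℂ)
    (hε : D.IsRootChoice ε) (i j : I) (p q m : ℕ) (hc : D.cartan i j = -1) (hi : D.τ i = i) :
    ⁅(sys hD Zs ε).B i p, ⁅(sys hD Zs ε).B i q, (sys hD Zs ε).B j m⁆⁆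
      + ⁅(sys hD Zs ε).B i q, ⁅(sys hD Zs ε).B i p, (sys hD Zs ε).B j m⁆⁆ =
      ((-1 : D.K) ^ p) • ∑ b with (sys hD Zs ε).nd b = j, (2 * (sys hD Zs ε).x b ^ m *
        (D.splitSer i ((sys hD Zs ε).x b + 1 / 2)).coeff ((p : ℤ) + q + 2)) • (sys hD Zs ε).y b := by
  rw [(sys hD Zs ε).serre_fixed i j p q m hc hi, Finset.smul_sum, ← Finset.sum_neg_distrib]
  refine Finset.sum_congr rfl fun b hb => ?_
  have hb : D.cartan i (D.rnd b) = -1 := by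
    rw [show D.rnd b = j from (Finset.mem_filter.1 hb).2, hc]
  rw [smul_smul, ← neg_smul]
  congr 1
  obtain ⟨M, hM⟩ := numer_dvd hD hi b hb
  have hev : evalU D.K ((X - C (D.rx b + 1 / 2)) * (X - C (-(D.rx b + 1 / 2)))) =
      lin (D.rx b + 1 / 2) * lin (-(D.rx b + 1 / 2)) := by
    rw [map_mul, evalU_X_sub_C, evalU_X_sub_C]
  have h := coeff_HSer_div hD Zs hZ ε hε i _ M hM (by
    rw [hev]; exact mul_ne_zero (lin_ne_zero _) (lin_ne_zero _)) (eval_pole_ne hD hi b hb) (p + q)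
  have hd : ∀ U H A B : D.Ser, A ≠ 0 → B ≠ 0 → U * H / (A * B) = U * (H * (A⁻¹ * B⁻¹)) :=
    fun U H A B h1 h2 => by field_simp
  rw [hev, hd _ _ _ _ (lin_ne_zero _) (lin_ne_zero _), u,
    show (HahnSeries.single (-1 : ℤ) (1 : D.K)) = invVar D.K from rfl, coeff_invVar_mul, hi,
    ← Finset.sum_add_distrib, Nat.cast_add, add_assoc _ (1 : ℤ) 1, one_add_one_eq_two] at h
  change (D.splitSer i (D.rx b + 1 / 2)).coeff _ = _ at h
  change -(D.rx b ^ m * _) = (-1) ^ p * (2 * D.rx b ^ m * (D.splitSer i (D.rx b + 1 / 2)).coeff _)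
  rw [h]
  have key : ∑ a with (sys hD Zs ε).nd a = i, ((-1) ^ p + (-1) ^ q) * (sys hD Zs ε).x a ^ (p + q) *
      (sys hD Zs ε).h a * (1 - 2 * (sys hD Zs ε).x a) /
        (((sys hD Zs ε).x b + 1 / 2) ^ 2 - (sys hD Zs ε).x a ^ 2) =
      -2 * (-1) ^ p * ∑ a with D.rnd a = i, ((sys hD Zs ε).res a * (D.rx a ^ (p + q) /
        ((X - C (D.rx b + 1 / 2)) * (X - C (-(D.rx b + 1 / 2)))).eval (D.rx a)) +
        (sys hD Zs ε).res a * ((-D.rx a) ^ (p + q) /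
        ((X - C (D.rx b + 1 / 2)) * (X - C (-(D.rx b + 1 / 2)))).eval (-D.rx a))) := by
    rw [Finset.mul_sum]
    refine Finset.sum_congr rfl fun a ha => ?_
    have ha : D.rnd a = i := (Finset.mem_filter.1 ha).2
    have hr : (sys hD Zs ε).res a = -((D.rx a - 1 / 2) * (sys hD Zs ε).h a) := by
      change -((D.rx a - (D.cartan (D.rnd a) (D.τ (D.rnd a)) : D.K) / 4) * _) = _
      rw [ha, hi, hD.c_self]; push_cast; ring
    have hq : ((-1 : D.K)) ^ q = (-1) ^ p * (-1) ^ (p + q) := by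
      rw [pow_add, ← mul_assoc, ← mul_pow]; simp
    rw [hr, neg_pow (D.rx a), hq]
    simp only [eval_mul, eval_sub, eval_X, eval_C, div_eq_mul_inv]
    change _ * D.rx a ^ _ * _ * (1 - 2 * D.rx a) * ((D.rx b + 1 * 2⁻¹) ^ 2 - D.rx a ^ 2)⁻¹ = _
    have e1 : ((D.rx b + 1 * 2⁻¹) ^ 2 - D.rx a ^ 2)⁻¹ =
        -((D.rx a - (D.rx b + 1 * 2⁻¹)) * (D.rx a - -(D.rx b + 1 * 2⁻¹)))⁻¹ := by
      rw [← inv_neg]; congr 1; ring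
    have e2 : (-D.rx a - (D.rx b + 1 * 2⁻¹)) * (-D.rx a - -(D.rx b + 1 * 2⁻¹)) =
        (D.rx a - (D.rx b + 1 * 2⁻¹)) * (D.rx a - -(D.rx b + 1 * 2⁻¹)) := by ring
    rw [e1, e2]
    generalize ((D.rx a - (D.rx b + 1 * 2⁻¹)) * (D.rx a - -(D.rx b + 1 * 2⁻¹)))⁻¹ = t
    ring
  rw [key]
  ring

theorem sys_serre_fixed_zero (hD : D.Admissible) (Zs : I → D.ZRing[X]) (hZ : D.IsZSplitting Zs)
    (ε : I → ℂ) (hε : D.IsRootChoice ε) (i j : I) (p q : ℕ) (hc : D.cartan i j = -1)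
    (hi : D.τ i = i) :
    ⁅(sys hD Zs ε).B i p, ⁅(sys hD Zs ε).B i q, (sys hD Zs ε).B j 0⁆⁆
      + ⁅(sys hD Zs ε).B i q, ⁅(sys hD Zs ε).B i p, (sys hD Zs ε).B j 0⁆⁆ =
      ((-1 : D.K) ^ p) • ∑ k ∈ Finset.range ((p : ℤ) + q + 2 + D.mu i).toNat, ((1 / 4 : D.K) ^ k) •
        (⁅(D.HSer i).coeff ((p : ℤ) + q + 2 - 2 * k - 2) • (1 : D.Op), (sys hD Zs ε).B j 1⁆
          - acomm ((D.HSer i).coeff ((p : ℤ) + q + 2 - 2 * k - 2) • (1 : D.Op))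
            ((sys hD Zs ε).B j 0)) := by
  rw [sys_serre_fixed hD Zs hZ ε hε i j p q 0 hc hi, (sys hD Zs ε).split_bracket_one j
    (fun n => (D.HSer i).coeff n)
    (fun b n => (D.splitSer i ((sys hD Zs ε).x b + 1 / 2)).coeff n) ((p : ℤ) + q + 2)]
  · simp only [pow_zero, mul_one]
  · intro b hb n
    have hb' : D.cartan i (D.rnd b) = -1 := by rw [show D.rnd b = j from hb, hc]
    rw [shift_HSer_coeff_eq hD Zs ε hi b hb', HSer_coeff_eq i (D.rx b + 1 / 2)]
    change D.rx b * _ - _ = -2 * ((D.splitSer i (D.rx b + 1 / 2)).coeff (n + 2)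
      - (D.splitSer i (D.rx b + 1 / 2)).coeff n / 4)
    ring
  · intro b _
    refine (isMonicSer_splitSer hD i _).1 _ ?_
    have := Int.self_le_toNat ((p : ℤ) + q + 2 + D.mu i)
    omega

theorem sys_serre_fixed_succ (hD : D.Admissible) (Zs : I → D.ZRing[X]) (hZ : D.IsZSplitting Zs)
    (ε : I → ℂ) (hε : D.IsRootChoice ε) (i j : I) (p q m : ℕ) (hc : D.cartan i j = -1)
    (hi : D.τ i = i) :
    ⁅(sys hD Zs ε).B i p, ⁅(sys hD Zs ε).B i q, (sys hD Zs ε).B j (m + 1)⁆⁆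
      + ⁅(sys hD Zs ε).B i q, ⁅(sys hD Zs ε).B i p, (sys hD Zs ε).B j (m + 1)⁆⁆ =
      ((-1 : D.K) ^ p) • ⁅(D.HSer i).coeff ((p : ℤ) + q + 2) • (1 : D.Op),
        (sys hD Zs ε).B j m⁆ := by
  rw [sys_serre_fixed hD Zs hZ ε hε i j p q (m + 1) hc hi, (sys hD Zs ε).split_bracket_succ j _
    (fun b => (D.splitSer i ((sys hD Zs ε).x b + 1 / 2)).coeff ((p : ℤ) + q + 2))]
  intro b hb
  have hb' : D.cartan i (D.rnd b) = -1 := by rw [show D.rnd b = j from hb, hc]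
  rw [shift_HSer_coeff_eq hD Zs ε hi b hb', HSer_coeff_eq i (D.rx b + 1 / 2)]
  change _ = -2 * D.rx b * (D.splitSer i (D.rx b + 1 / 2)).coeff ((p : ℤ) + q + 2)
  ring

end Datum

end

section

namespace Datum

universe uI
variable {I : Type uI} {D : Datum I} [Fintype I]

open Polynomial

/-! ### The Serre relation for adjacent `i` and `τ i` -/

theorem coeff_HSer_div_lin (hD : D.Admissible) (Zs : I → D.ZRing[X]) (hZ : D.IsZSplitting Zs)
    (ε : I → ℂ) (hε : D.IsRootChoice ε) (i : I) (Q M : D.K[X]) (hQ : D.numer i = Q * M)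
    (hQne : evalU D.K Q ≠ 0) (hQ0 : ∀ k ∈ D.poles i, Q.eval (pole k) ≠ 0) (c : D.K)
    (hc : ∀ k ∈ D.poles i, pole k ≠ c) (n : ℕ) :
    (D.u * D.HSer i / (evalU D.K Q * lin c)).coeff ((n : ℤ) + 1) =
      ∑ a with D.rnd a = i, (sys hD Zs ε).res a *
        (D.rx a ^ n / (Q.eval (D.rx a) * (D.rx a - c))) +
      ∑ a with D.rnd a = D.τ i, (sys hD Zs ε).res a *
        ((-D.rx a) ^ n / (Q.eval (-D.rx a) * (-D.rx a - c))) +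
      M.eval c / (∏ k ∈ D.poles i, (c - pole k)) * c ^ n := by
  set p : Option (D.Root ⊕ D.NR) → D.K := fun o => o.elim c pole with hp
  have hinj : Set.InjOn p (Finset.insertNone (D.poles i) : Finset (Option (D.Root ⊕ D.NR))) := by
    rintro (_ | k) hk (_ | l) hl h
    · rfl
    · exact absurd h.symm (hc l (by simpa using hl))
    · exact absurd h (hc k (by simpa using hk))
    · have := pole_injOn hD i (by simpa using hk) (by simpa using hl) h
      rw [this]
  have h : D.u * D.HSer i / (evalU D.K Q * lin c) =
      evalU D.K M / evalU D.K (∏ k ∈ Finset.insertNone (D.poles i), (X - C (p k))) := by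
    have hd : ∀ q m d l : D.Ser, q ≠ 0 → q * m / d / (q * l) = m / (l * d) := fun q m d l h => by
      field_simp
    rw [u_mul_HSer hD, hQ, map_mul, Finset.prod_insertNone, map_mul, ← evalU_X_sub_C]
    exact hd _ _ _ _ hQne
  rw [h, coeff_partial_fractions _ _ hinj, ← sum_poles hD Zs hZ ε hε i
    fun v => v ^ n / (Q.eval v * (v - c)), Finset.sum_insertNone, add_comm]
  congr 1
  · refine Finset.sum_congr rfl fun k hk => ?_
    have h1 := hQ0 k hk
    have h2 : pole k - c ≠ 0 := sub_ne_zero.2 (hc k hk)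
    have h3 : ∏ l ∈ (Finset.insertNone (D.poles i)).erase (some k), (p (some k) - p l) =
        (pole k - c) * ∏ l ∈ (D.poles i).erase k, (pole k - pole l) := by
      rw [prod_erase_eq, Finset.prod_insertNone, if_neg (by simp), prod_erase_eq]
      congr 1
      exact Finset.prod_congr rfl fun l _ => by simp [p]
    have hd : ∀ q m d x y : D.K, q ≠ 0 → y ≠ 0 → m / (y * d) * x = q * m / d * (x / (q * y)) :=
      fun q m d x y h h' => by field_simp
    rw [h3, pfRes, hQ, eval_mul]
    have h4 := hd (Q.eval (pole k)) (M.eval (pole k))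
      (∏ l ∈ (D.poles i).erase k, (pole k - pole l)) (pole k ^ n) (pole k - c) h1 h2
    exact h4
  · have h3 : ∏ l ∈ (Finset.insertNone (D.poles i)).erase none, (p none - p l) =
        ∏ l ∈ D.poles i, (c - pole l) := by
      rw [prod_erase_eq, Finset.prod_insertNone, if_pos rfl, one_mul]
      exact Finset.prod_congr rfl fun l _ => by simp [p]
    rw [h3]; rfl

variable (D) in
/-- `u H_{τ i}(u) / ((u - x - 1/2)(u + x - 1))`. -/
def aiiiSer (i : I) (x : D.K) : D.Ser :=
  D.u * D.HSer (D.τ i) / (lin (x + 1 / 2) * lin (1 - x))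

theorem lin_mul_aiiiSer (i : I) (x : D.K) :
    lin (x + 1 / 2) * lin (1 - x) * D.aiiiSer i x = D.u * D.HSer (D.τ i) := by
  have h1 := lin_ne_zero (x + 1 / 2)
  have h2 := lin_ne_zero (1 - x)
  rw [aiiiSer]
  generalize lin (x + 1 / 2) = A at *
  generalize lin (1 - x) = B at *
  field_simp

theorem isMonicSer_aiiiSer (hD : D.Admissible) (i : I) (x : D.K) :
    IsMonicSer (D.mu (D.τ i) - 1) (D.aiiiSer i x) := by
  have hd : ∀ A B C : D.Ser, A / (B * C) = A * (B⁻¹ * C⁻¹) := fun A B C => by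
    rw [← mul_inv, ← div_eq_mul_inv]
  have h := ((isMonicSer_lin (0 : D.K)).mul (isMonicSer_HSer hD (D.τ i))).mul
    ((isMonicSer_inv_lin (x + 1 / 2)).mul (isMonicSer_inv_lin (1 - x)))
  rw [← u_eq] at h
  rw [aiiiSer, hd]
  convert h using 1
  ring

theorem shift_sub_HSer (hD : D.Admissible) {i : I} (hc : D.cartan i (D.τ i) = -1) (a : D.NR)
    (ha : a.node = i) (n : ℤ) :
    shift a.sh ((D.HSer (D.τ i)).coeff n) - (D.HSer (D.τ i)).coeff n =
      3 * (D.aiiiSer i a.x).coeff n - a.x * (D.aiiiSer i a.x).coeff (n - 1) := by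
  have h := HSer_shift hD (D.τ i) a
  have e1 : a.x + ((-1 : ℤ) : D.K) / 2 = a.x - 1 / 2 := by push_cast; ring
  have e2 : -a.x - ((2 : ℤ) : D.K) / 2 = -a.x - 1 := by push_cast; ring
  have e3 : a.x - ((-1 : ℤ) : D.K) / 2 = a.x + 1 / 2 := by push_cast; ring
  have e4 : -a.x + ((2 : ℤ) : D.K) / 2 = 1 - a.x := by push_cast; ring
  rw [hD.ττ, ha, hD.c_self, hD.c_symm, hc, e1, e2, e3, e4] at h
  have h1 := lin_mul_aiiiSer i a.x
  have h2 : D.u * (mapSer (shift a.sh) (D.HSer (D.τ i)) - D.HSer (D.τ i)) =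
      (lin (a.x - 1 / 2) * lin (-a.x - 1) - lin (a.x + 1 / 2) * lin (1 - a.x)) *
        D.aiiiSer i a.x := by
    have hne := mul_ne_zero (lin_ne_zero (a.x + 1 / 2)) (lin_ne_zero (1 - a.x))
    refine mul_left_cancel₀ hne ?_
    linear_combination (-D.u) * h - (lin (a.x - 1 / 2) * lin (-a.x - 1) -
      lin (a.x + 1 / 2) * lin (1 - a.x)) * h1
  have h3 := congrArg (fun F => HahnSeries.coeff F (n - 1)) h2
  simp only [sub_mul, mul_assoc, HahnSeries.coeff_sub, coeff_lin_mul, u_eq, mul_sub,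
    mapSer_coeff, sub_add_cancel] at h3
  linear_combination h3

theorem aiii_residue (hD : D.Admissible) (Zs : I → D.ZRing[X]) (hZ : D.IsZSplitting Zs)
    (ε : I → ℂ) {i : I} (hc : D.cartan i (D.τ i) = -1) (a : D.NR) (ha : a.node = i) :
    ∃ M : D.K[X], D.numer (D.τ i) = (X - C (a.x + 1 / 2)) * M ∧
      M.eval (1 - a.x) / (∏ k ∈ D.poles (D.τ i), (1 - a.x - pole k)) =
        shift a.sh ((sys hD Zs ε).h (Sum.inl a)) / 4 := by
  have hf : D.τ i ≠ i := fun e => by rw [e, hD.c_self] at hc; norm_num at hc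
  have hf' : D.τ (D.τ i) ≠ D.τ i := by rw [hD.ττ]; exact hf.symm
  have hw : a.x + 1 / 2 = a.w := by rw [NR.x]; ring
  have hadj : a ∈ Finset.univ.filter fun b : D.NR => D.adj (D.τ i) b.node := by
    rw [Finset.mem_filter, ha, hD.adj_iff, hD.c_symm, hc]; simp
  set M : D.K[X] := D.num₀ (D.τ i) * (D.bZ (D.τ i)).map D.zToK *
    ∏ b ∈ (Finset.univ.filter fun b : D.NR => D.adj (D.τ i) b.node).erase a, (X - C b.w) with hM
  have hnum : D.numer (D.τ i) = (X - C (a.x + 1 / 2)) * M := by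
    rw [hM, numer, ← Finset.mul_prod_erase _ _ hadj, hw]; ring
  refine ⟨M, hnum, ?_⟩
  have hself := NR.shift_w_self hD a
  have hx1 : shift a.sh a.x = a.x - 1 := by rw [NR.shift_x, hself, NR.x]; ring
  have hMs : shift a.sh (M.eval (-a.x)) = M.eval (1 - a.x) := by
    have h1 : M.map (shift a.sh) = M := by
      rw [hM, Polynomial.map_mul, Polynomial.map_mul, map_bZ, Polynomial.map_prod, num₀, if_neg hf']
      have h40 : shift a.sh (4 : D.K) = 4 := map_ofNat _ 4
      congr 1
      · simp [h40]
      · refine Finset.prod_congr rfl fun b hb => ?_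
        have hb2 : b ≠ a.flip := by
          rintro rfl
          have := (Finset.mem_filter.1 (Finset.mem_of_mem_erase hb)).2
          rw [NR.node_flip hD, ha] at this
          exact hD.not_adj_self _ this
        simp [NR.shift_w hD (Finset.ne_of_mem_erase hb) hb2]
    conv_rhs => rw [← h1]
    rw [show (1 : D.K) - a.x = shift a.sh (-a.x) by rw [map_neg, hx1]; ring, eval_map, eval₂_hom]
  set k₁ : D.Root ⊕ D.NR := Sum.inr a.flip with hk₁
  set k₂ : D.Root ⊕ D.NR := Sum.inl (Sum.inl a.flip) with hk₂
  have m₁ : k₁ ∈ D.poles (D.τ i) := Finset.mem_filter.2 ⟨Finset.mem_univ _, by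
    change a.flip.node = _; rw [NR.node_flip hD, ha]⟩
  have m₂ : k₂ ∈ (D.poles (D.τ i)).erase k₁ := Finset.mem_erase.2 ⟨by simp [hk₁, hk₂],
    Finset.mem_filter.2 ⟨Finset.mem_univ _, by
      change a.flip.node = _; rw [NR.node_flip hD, ha]⟩⟩
  have p₁ : pole k₁ = -a.x := by change a.flip.w + 1 / 2 = _; rw [NR.w_flip, NR.x]; ring
  have p₂ : pole k₂ = -a.x - 1 := by change a.flip.w - 1 / 2 = _; rw [NR.w_flip, NR.x]; ring
  set R := ∏ k ∈ ((D.poles (D.τ i)).erase k₁).erase k₂, (1 - a.x - pole k) with hR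
  have hP : ∏ k ∈ D.poles (D.τ i), (1 - a.x - pole k) = 2 * R := by
    rw [← Finset.mul_prod_erase _ _ m₁, ← Finset.mul_prod_erase _ _ m₂, p₁, p₂]; ring
  have hS : shift a.sh (∏ l ∈ (D.poles (D.τ i)).erase k₁, (-a.x - pole l)) = R := by
    rw [← Finset.mul_prod_erase _ _ m₂, p₂, map_mul, map_prod, hR]
    rw [show shift a.sh (-a.x - (-a.x - 1)) = 1 by
      rw [show -a.x - (-a.x - 1) = 1 by ring, map_one], one_mul]
    refine Finset.prod_congr rfl fun k hk => ?_
    obtain ⟨hk2, hk⟩ := Finset.mem_erase.1 hk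
    obtain ⟨hk1, hk⟩ := Finset.mem_erase.1 hk
    have hkn : pnode k = D.τ i := (Finset.mem_filter.1 hk).2
    have : shift a.sh (pole k) = pole k := by
      rcases k with (b | k) | b
      · have hb : b ≠ a := by rintro rfl; exact hf (hkn.symm.trans ha)
        have hb' : b ≠ a.flip := by rintro rfl; exact hk2 rfl
        change shift a.sh b.x = b.x
        rw [NR.shift_x, NR.shift_w hD hb hb', NR.x]
      · exact map_zero _
      · have hb : b ≠ a := by rintro rfl; exact hf (hkn.symm.trans ha)
        have hb' : b ≠ a.flip := by rintro rfl; exact hk1 rfl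
        change shift a.sh (b.w + 1 / 2) = b.w + 1 / 2
        rw [map_add, NR.shift_w hD hb hb', NR.shift_half]
    rw [map_sub, this, map_neg, hx1]; ring
  have hres := congrArg (shift a.sh) (pfRes_inr hD Zs hZ ε a)
  have hr : (sys hD Zs ε).res (Sum.inl a) = -((a.x + 1 / 4) * (sys hD Zs ε).h (Sum.inl a)) := by
    change -((a.x - (D.cartan a.node (D.τ a.node) : D.K) / 4) * _) = _
    rw [ha, hc]; push_cast; ring
  have h4 : shift a.sh (1 / 4 : D.K) = 1 / 4 := by rw [map_div₀, map_one, map_ofNat]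
  rw [ha, pfRes, p₁, map_div₀, hS, hnum, eval_mul, map_mul, hMs, hr, eval_sub, eval_X, eval_C, hw,
    map_sub, map_neg, map_neg, map_mul, map_add, hx1, hself, h4] at hres
  have hne : (3 / 2 : D.K) - 2 * a.x ≠ 0 := fun e => NR.w_add_ne hD a (-5 / 4) (by
    rw [NR.x] at e; push_cast; linear_combination (-1 / 2) * e)
  rw [hP]
  refine mul_left_cancel₀ hne ?_
  have hd : ∀ x y z : D.K, x / (2 * y) = z ↔ x * y⁻¹ = 2 * z := fun x y z => by
    rw [div_eq_mul_inv, mul_inv]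
    constructor
    · rintro rfl; ring
    · intro h; linear_combination (1 / 2) * h
  have hd' : ∀ x y : D.K, x / (2 * y) = x * y⁻¹ / 2 := fun x y => by
    rw [div_eq_mul_inv, mul_inv]; ring
  rw [hd', NR.x] at *
  rw [div_eq_mul_inv] at hres
  linear_combination (1 / 2) * hres

end Datum

end

section

namespace Datum

universe uI
variable {I : Type uI} {D : Datum I} [Fintype I]

open Polynomial

theorem aiiiSer_coeff (hD : D.Admissible) (Zs : I → D.ZRing[X]) (hZ : D.IsZSplitting Zs)
    (ε : I → ℂ) (hε : D.IsRootChoice ε) {i : I} (hc : D.cartan i (D.τ i) = -1) (a : D.Root)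
    (ha : (sys hD Zs ε).nd a = i) (n : ℕ) :
    (D.aiiiSer i ((sys hD Zs ε).x a)).coeff ((n : ℤ) + 1) =
      (sys hD Zs ε).aiiiCoeff i a n := by
  have hf : D.τ i ≠ i := fun e => by rw [e, hD.c_self] at hc; norm_num at hc
  rcases a with a | k
  swap
  · exact absurd (fixed_of_theta k.2) (by rw [show (k : I) = i from ha]; exact hf)
  have ha' : a.node = i := ha
  obtain ⟨M, hM, hres⟩ := aiii_residue hD Zs hZ ε hc a ha'
  have hfix : ∀ k : {i : I // D.theta i = 1}, (k : I) ≠ D.τ i := fun k e => by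
    have h1 := fixed_of_theta k.2
    rw [e, hD.ττ] at h1
    exact hf h1.symm
  have hQ0 : ∀ k ∈ D.poles (D.τ i), (X - C (a.x + 1 / 2)).eval (pole k) ≠ 0 := by
    intro k hk
    have hk : pnode k = D.τ i := (Finset.mem_filter.1 hk).2
    rw [eval_sub, eval_X, eval_C]
    rcases k with (b | k) | b
    · have hb : b ≠ a := by rintro rfl; exact hf (hk.symm.trans ha')
      intro e
      apply NR.w_sub_w_ne hD hb (1 / 2)
      change b.w - 1 / 2 - (a.w - 1 / 2 + 1 / 2) = 0 at e
      push_cast; linear_combination -e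
    · exact absurd hk (hfix k)
    · have hb : b ≠ a := by rintro rfl; exact hf (hk.symm.trans ha')
      intro e
      apply NR.w_sub_w_ne hD hb (-1 / 2)
      change b.w + 1 / 2 - (a.w - 1 / 2 + 1 / 2) = 0 at e
      push_cast; linear_combination -e
  have hpc : ∀ k ∈ D.poles (D.τ i), pole k ≠ 1 - a.x := by
    intro k hk e
    have hk : pnode k = D.τ i := (Finset.mem_filter.1 hk).2
    have hsub : ∀ (b : D.NR) (q : ℚ), q ≠ 0 → a.flip.w - b.w + (q : D.K) ≠ 0 := by
      intro b q hq
      by_cases hb : b = a.flip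
      · rw [hb, sub_self, zero_add]; exact_mod_cast hq
      · exact NR.w_sub_w_ne hD hb q
    rcases k with (b | k) | b
    · apply hsub b 2 (by norm_num)
      change b.w - 1 / 2 = 1 - (a.w - 1 / 2) at e
      rw [NR.w_flip]; push_cast; linear_combination -e
    · exact absurd hk (hfix k)
    · apply hsub b 1 (by norm_num)
      change b.w + 1 / 2 = 1 - (a.w - 1 / 2) at e
      rw [NR.w_flip]; push_cast; linear_combination -e
  have h := coeff_HSer_div_lin hD Zs hZ ε hε (D.τ i) (X - C (a.x + 1 / 2)) M hM
    (by rw [evalU_X_sub_C]; exact lin_ne_zero _) hQ0 (1 - a.x) hpc n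
  rw [evalU_X_sub_C, hres] at h
  change (D.aiiiSer i a.x).coeff _ = _ at h
  change (D.aiiiSer i a.x).coeff _ = _
  rw [h, ShiftSystem.aiiiCoeff]
  simp only [eval_sub, eval_X, eval_C]
  have hs := (sys hD Zs ε).sum_neg i (hD.ττ i) fun b => (sys hD Zs ε).res b *
    ((sys hD Zs ε).x b ^ n / (((sys hD Zs ε).x b - (a.x + 1 / 2)) * ((sys hD Zs ε).x b - (1 - a.x))))
  have hs' : ∑ b with D.rnd b = D.τ i, (sys hD Zs ε).res b *
      (D.rx b ^ n / ((D.rx b - (a.x + 1 / 2)) * (D.rx b - (1 - a.x)))) = _ := hs.symm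
  have hs2 : ∑ b with D.rnd b = D.τ (D.τ i), (sys hD Zs ε).res b *
      ((-D.rx b) ^ n / ((-D.rx b - (a.x + 1 / 2)) * (-D.rx b - (1 - a.x)))) =
      ∑ b with (sys hD Zs ε).nd b = i, (sys hD Zs ε).res b *
      ((-(sys hD Zs ε).x b) ^ n / ((-(sys hD Zs ε).x b - (a.x + 1 / 2)) *
        (-(sys hD Zs ε).x b - (1 - a.x)))) := by rw [hD.ττ]; rfl
  have hmem : Sum.inl a ∈ Finset.univ.filter fun b : D.Root => (sys hD Zs ε).nd b = i :=
    Finset.mem_filter.2 ⟨Finset.mem_univ _, ha⟩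
  rw [hs', hs2, ← Finset.sum_add_distrib, ← Finset.add_sum_erase _ _ hmem]
  have hset : (Finset.univ.filter fun b : D.Root => (sys hD Zs ε).nd b = i).erase (Sum.inl a) =
      Finset.univ.filter fun b : D.Root => (sys hD Zs ε).nd b = i ∧ b ≠ Sum.inl a := by
    ext b; simp only [Finset.mem_erase, Finset.mem_filter]; tauto
  rw [hset]
  have hx : (sys hD Zs ε).x (Sum.inl a) = a.x := rfl
  have hxn : (sys hD Zs ε).x ((sys hD Zs ε).neg (Sum.inl a)) = -a.x - 1 := by
    change a.flip.w - 1 / 2 = _; rw [NR.w_flip, NR.x]; ring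
  have hr : (sys hD Zs ε).res (Sum.inl a) = -((a.x + 1 / 4) * (sys hD Zs ε).h (Sum.inl a)) := by
    change -((a.x - (D.cartan a.node (D.τ a.node) : D.K) / 4) * _) = _
    rw [ha', hc]; push_cast; ring
  have hrn : (sys hD Zs ε).res ((sys hD Zs ε).neg (Sum.inl a)) =
      (a.x + 3 / 4) * (sys hD Zs ε).h ((sys hD Zs ε).neg (Sum.inl a)) := by
    change -((a.flip.x - (D.cartan a.flip.node (D.τ a.flip.node) : D.K) / 4) * _) = _
    rw [NR.node_flip hD, ha', hD.ττ, hD.c_symm, hc, show a.flip.x = -a.x - 1 from hxn]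
    push_cast; ring
  have n1 : a.x + 3 / 4 ≠ 0 := fun e => NR.w_add_ne hD a (1 / 4) (by
    rw [NR.x] at e; push_cast; linear_combination e)
  have n2 : a.x + 1 / 4 ≠ 0 := fun e => NR.w_add_ne hD a (-1 / 4) (by
    rw [NR.x] at e; push_cast; linear_combination e)
  rw [hxn, hx, hr, hrn]
  have t1 : ∀ h y : D.K, (a.x + 3 / 4) * h * (y / ((-a.x - 1 - (a.x + 1 / 2)) *
      (-a.x - 1 - (1 - a.x)))) = h * y / 4 := fun h y => by
    rw [show (-a.x - 1 - (a.x + 1 / 2)) * (-a.x - 1 - (1 - a.x)) = 4 * (a.x + 3 / 4) by ring]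
    generalize a.x + 3 / 4 = z at *
    field_simp
  have t2 : ∀ h y : D.K, -((a.x + 1 / 4) * h) * (y / ((-a.x - (a.x + 1 / 2)) *
      (-a.x - (1 - a.x)))) = -(h * y / 2) := fun h y => by
    rw [show (-a.x - (a.x + 1 / 2)) * (-a.x - (1 - a.x)) = 2 * (a.x + 1 / 4) by ring]
    generalize a.x + 1 / 4 = z at *
    field_simp
  rw [t1, t2]
  have t3 : ∀ A B S T U : D.K, A + -B + S + U / 4 * T = S + A - B + U * T / 4 :=
    fun A B S T U => by ring
  rw [t3]
  congr 3
  refine Finset.sum_congr (by ext b; simp only [Finset.mem_filter]) fun b _ => ?_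
  simp only [mul_div_assoc]
  congr 4 <;> ring

theorem sys_serre_aiii (hD : D.Admissible) (Zs : I → D.ZRing[X]) (hZ : D.IsZSplitting Zs)
    (ε : I → ℂ) (hε : D.IsRootChoice ε) (i : I) (p q m : ℕ) (hc : D.cartan i (D.τ i) = -1) :
    ⁅(sys hD Zs ε).B i p, ⁅(sys hD Zs ε).B i q, (sys hD Zs ε).B (D.τ i) m⁆⁆
      + ⁅(sys hD Zs ε).B i q, ⁅(sys hD Zs ε).B i p, (sys hD Zs ε).B (D.τ i) m⁆⁆ =
      (4 : D.K) • ((-1 : D.K) ^ p • ∑ k ∈ Finset.range ((p : ℤ) + m + 2 + D.mu (D.τ i)).toNat,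
          ((3 : D.K) ^ (k + 1))⁻¹ • ⁅(sys hD Zs ε).B i (q + k),
            (D.HSer (D.τ i)).coeff ((p : ℤ) + m + 1 - k) • (1 : D.Op)⁆
        + (-1 : D.K) ^ q • ∑ k ∈ Finset.range ((q : ℤ) + m + 2 + D.mu (D.τ i)).toNat,
          ((3 : D.K) ^ (k + 1))⁻¹ • ⁅(sys hD Zs ε).B i (p + k),
            (D.HSer (D.τ i)).coeff ((q : ℤ) + m + 1 - k) • (1 : D.Op)⁆) := by
  have hf : D.τ i ≠ i := fun e => by rw [e, hD.c_self] at hc; norm_num at hc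
  have hinr : ∀ k : {i : I // D.theta i = 1}, (k : I) ≠ i := fun k e =>
    hf (by rw [← e]; exact fixed_of_theta k.2)
  have hbr : ∀ p q : ℕ, ∑ k ∈ Finset.range ((p : ℤ) + m + 2 + D.mu (D.τ i)).toNat,
      ((3 : D.K) ^ (k + 1))⁻¹ • ⁅(sys hD Zs ε).B i (q + k),
        (D.HSer (D.τ i)).coeff ((p : ℤ) + m + 1 - k) • (1 : D.Op)⁆ =
      -∑ a with (sys hD Zs ε).nd a = i, ((sys hD Zs ε).x a ^ q *
        (D.aiiiSer i ((sys hD Zs ε).x a)).coeff ((p : ℤ) + m + 1)) • (sys hD Zs ε).y a := by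
    intro p q
    refine (sys hD Zs ε).aiii_bracket i (fun n => (D.HSer (D.τ i)).coeff n)
      (fun a n => (D.aiiiSer i ((sys hD Zs ε).x a)).coeff n) _ q _ ?_ ?_
    · rintro (a | k) ha n
      · exact shift_sub_HSer hD hc a ha n
      · exact absurd ha (hinr k)
    · intro a _
      refine (isMonicSer_aiiiSer hD i _).1 _ ?_
      have := Int.self_le_toNat ((p : ℤ) + m + 2 + D.mu (D.τ i))
      omega
  have hx : ∀ a, (sys hD Zs ε).nd a = i →
      (sys hD Zs ε).x ((sys hD Zs ε).neg a) = -(sys hD Zs ε).x a - 1 := by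
    rintro (a | k) ha
    · change a.flip.w - 1 / 2 = -(a.w - 1 / 2) - 1
      rw [NR.w_flip]; ring
    · exact absurd ha (hinr k)
  have h := (sys hD Zs ε).aiii_sum i (hD.ττ i) hf hc hx p q m
    (fun a n => (D.aiiiSer i ((sys hD Zs ε).x a)).coeff ((n : ℤ) + 1))
    (fun a ha n => aiiiSer_coeff hD Zs hZ ε hε hc a ha n)
  refine Eq.trans h ?_
  rw [hbr, hbr, smul_neg, smul_neg, ← neg_add, smul_neg, neg_inj, Finset.smul_sum, Finset.smul_sum,
    ← Finset.sum_add_distrib, Finset.smul_sum]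
  refine Finset.sum_congr rfl fun a _ => ?_
  push_cast
  generalize (sys hD Zs ε).y a = y
  generalize (sys hD Zs ε).x a = x
  simp only [smul_smul, ← add_smul]
  congr 1
  ring

end Datum

end

section

namespace Datum

universe uI
variable {I : Type uI} {D : Datum I} [Fintype I]

open Polynomial

/-! ### Membership in `𝒜` -/

variable (D) in
/-- The rational functions whose multiplication operators lie in `𝒜`. -/
def scalars : Subring D.K := D.A.toSubring.comap (scalHom D.ZIdx D.WIdx)

theorem mem_scalars {f : D.K} : f ∈ D.scalars ↔ scal f ∈ D.A := Iff.rfl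

theorem algebraMap_mem_scalars (c : ℂ) : algebraMap ℂ D.K c ∈ D.scalars := by
  rw [mem_scalars, scal_algebraMap]; exact D.A.algebraMap_mem c

theorem half_mem_scalars : (1 / 2 : D.K) ∈ D.scalars := by
  have := algebraMap_mem_scalars (D := D) (1 / 2)
  rwa [map_div₀, map_one, map_ofNat] at this

theorem zToK_mem_scalars (f : D.ZRing) : D.zToK f ∈ D.scalars :=
  Algebra.subset_adjoin (by simp only [Set.mem_union]; left; left; left; left; left; exact ⟨f, rfl⟩)

theorem wVar_mem_scalars (k : D.WIdx) : D.wVar k ∈ D.scalars :=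
  Algebra.subset_adjoin (by simp only [Set.mem_union]; left; left; left; left; right; exact ⟨k, rfl⟩)

theorem op_single_mem (k : D.WIdx) : op (1 : D.K) (Pi.single k 1) ∈ D.A :=
  Algebra.subset_adjoin (by simp only [Set.mem_union]; left; left; left; right; exact ⟨k, rfl⟩)

theorem op_neg_single_mem (k : D.WIdx) : op (1 : D.K) (-Pi.single k 1) ∈ D.A :=
  Algebra.subset_adjoin (by simp only [Set.mem_union]; left; left; right; exact ⟨k, rfl⟩)

theorem inv_wVar_mem (k : D.WIdx) (m : ℤ) : (D.wVar k + (m : D.K) / 2)⁻¹ ∈ D.scalars :=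
  Algebra.subset_adjoin (by simp only [Set.mem_union]; right; exact ⟨k, m, rfl⟩)

theorem inv_add_wVar_mem {k l : D.WIdx} (h : k ≠ l) (h' : (k.1 : I) = l.1) :
    (D.wVar k + D.wVar l)⁻¹ ∈ D.scalars ∧ (D.wVar k - D.wVar l)⁻¹ ∈ D.scalars := by
  obtain ⟨i, r⟩ := k
  obtain ⟨j, s⟩ := l
  obtain rfl : i = j := Subtype.ext h'
  have hrs : r ≠ s := fun e => h (by rw [e])
  constructor
  · refine Algebra.subset_adjoin ?_
    simp only [Set.mem_union]; left; right
    exact ⟨i, r, s, 0, hrs, Or.inl (by rw [Int.cast_zero, add_zero]; rfl)⟩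
  · refine Algebra.subset_adjoin ?_
    simp only [Set.mem_union]; left; right
    exact ⟨i, r, s, 0, hrs, Or.inr (by rw [Int.cast_zero, add_zero]; rfl)⟩

theorem inv_neg_mem {f : D.K} (h : f⁻¹ ∈ D.scalars) : (-f)⁻¹ ∈ D.scalars := by
  have e : (-f)⁻¹ = -f⁻¹ := inv_neg
  rw [e]; exact neg_mem h

theorem zeval_mem {p : D.ZRing[X]} {f : D.K} (hf : f ∈ D.scalars) : D.zeval p f ∈ D.scalars := by
  rw [zeval, eval₂_eq_sum_range]
  exact sum_mem fun n _ => mul_mem (zToK_mem_scalars _) (pow_mem hf n)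

theorem om_mem (hD : D.Admissible) (t : D.T) : om t ∈ D.scalars := by
  obtain ⟨k, -, -, h⟩ := exists_index hD
  rcases h t with ⟨h1, -⟩ | ⟨h1, -⟩ <;> rw [h1]
  exacts [wVar_mem_scalars _, neg_mem (wVar_mem_scalars _)]

theorem inv_om_mem (hD : D.Admissible) (t : D.T) (m : ℤ) :
    (om t + (m : D.K) / 2)⁻¹ ∈ D.scalars := by
  obtain ⟨k, -, -, h⟩ := exists_index hD
  rcases h t with ⟨h1, -⟩ | ⟨h1, -⟩ <;> rw [h1]
  · exact inv_wVar_mem _ _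
  · have := inv_neg_mem (inv_wVar_mem (k t) (-m))
    convert this using 2
    push_cast; ring

namespace NR

theorem w_mem (hD : D.Admissible) (a : D.NR) : a.w ∈ D.scalars := by
  rcases a with ⟨t, _ | _⟩
  exacts [neg_mem (om_mem hD t), om_mem hD t]

theorem x_mem (hD : D.Admissible) (a : D.NR) : a.x ∈ D.scalars :=
  sub_mem (w_mem hD a) half_mem_scalars

theorem sgn_mem (a : D.NR) : a.sgn ∈ D.scalars := by
  rcases a with ⟨t, _ | _⟩
  exacts [neg_mem (one_mem _), one_mem _]

theorem inv_sgn (a : D.NR) : (a.sgn)⁻¹ = a.sgn :=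
  inv_eq_of_mul_eq_one_right (sgn_mul_sgn a)

theorem inv_w_add_mem (hD : D.Admissible) (a : D.NR) (m : ℤ) :
    (a.w + (m : D.K) / 2)⁻¹ ∈ D.scalars := by
  rcases a with ⟨t, _ | _⟩
  · have := inv_neg_mem (inv_om_mem hD t (-m))
    convert this using 2
    change -om t + _ = _
    push_cast; ring
  · exact inv_om_mem hD t m

theorem inv_w_mem (hD : D.Admissible) (a : D.NR) : (a.w)⁻¹ ∈ D.scalars := by
  have := inv_w_add_mem hD a 0
  rwa [Int.cast_zero, show (0 : D.K) / 2 = 0 by simp, add_zero] at this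

theorem inv_w_sub_w_mem (hD : D.Admissible) {a b : D.NR} (h : b ≠ a) (hn : a.node = b.node) :
    (a.w - b.w)⁻¹ ∈ D.scalars := by
  by_cases hb : b = a.flip
  · rw [hb, w_flip, sub_neg_eq_add, ← two_mul, mul_inv]
    refine mul_mem ?_ (inv_w_mem hD a)
    have := half_mem_scalars (D := D)
    rwa [one_div] at this
  obtain ⟨k, hk, hk1, hk2⟩ := exists_index hD
  have hne : k a.1 ≠ k b.1 := by
    intro e
    have e1 := hk e
    rcases a with ⟨s, p⟩
    rcases b with ⟨t, q⟩
    obtain rfl : s = t := e1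
    cases p <;> cases q <;> simp_all [flip]
  have hnode : ((k a.1).1 : I) = (k b.1).1 := by
    have h1 : ∀ c : D.NR, ((k c.1).1 : I) = c.node ∨ ((k c.1).1 : I) = D.τ c.node := by
      rintro ⟨t, _ | _⟩ <;> rw [hk1] <;> simp only [node, if_true, Bool.false_eq_true, if_false] <;>
        split_ifs <;> simp [hD.ττ]
    by_contra hne'
    have h2 : ((k b.1).1 : I) = D.τ (k a.1).1 := by
      rcases h1 a with e1 | e1 <;> rcases h1 b with e2 | e2
      · exact absurd (by rw [e1, e2, hn]) hne'
      · rw [e1, e2, hn]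
      · rw [e1, e2, hn, hD.ττ]
      · exact absurd (by rw [e1, e2, hn]) hne'
    have h3 : D.τ ((k a.1).1 : I) ≠ (k a.1).1 := fun e => hne' (by rw [h2, e])
    exact (hD.mem_τ h3).1 (h2 ▸ (k b.1).1.2) (k a.1).1.2
  have key := inv_add_wVar_mem hne hnode
  have hw : ∀ c : D.NR, c.w = D.wVar (k c.1) ∨ c.w = -D.wVar (k c.1) := by
    rintro ⟨t, _ | _⟩
    · rcases hk2 t with ⟨h1, -⟩ | ⟨h1, -⟩
      · right; change -om t = _; rw [h1]
      · left; change -om t = _; rw [h1, neg_neg]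
    · rcases hk2 t with ⟨h1, -⟩ | ⟨h1, -⟩
      · left; exact h1
      · right; exact h1
  rcases hw a with h1 | h1 <;> rcases hw b with h2 | h2 <;> rw [h1, h2]
  · exact key.2
  · rw [sub_neg_eq_add]; exact key.1
  · rw [← neg_add']; exact inv_neg_mem key.1
  · rw [show -D.wVar (k a.1) - -D.wVar (k b.1) = -(D.wVar (k a.1) - D.wVar (k b.1)) by ring]
    exact inv_neg_mem key.2

theorem g_mem (hD : D.Admissible) {a b : D.NR} (h : b ≠ a) : g a b ∈ D.scalars := by
  unfold g
  split_ifs with h2 h1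
  · have hn : a.node = b.node := by
      by_contra hne
      rcases hD.c_off _ _ hne with e | e <;> rw [e] at h2 <;> norm_num at h2
    rw [mul_inv, inv_sgn]
    exact mul_mem (sgn_mem a) (inv_w_sub_w_mem hD h hn)
  · exact pow_mem (mul_mem (sgn_mem a) (sub_mem (x_mem hD a) (w_mem hD b))) _
  · exact one_mem _

theorem X_mem (hD : D.Admissible) (Zs : I → D.ZRing[X]) (a : D.NR) : X Zs a ∈ D.scalars := by
  have hs := mul_mem (sgn_mem a) (x_mem hD a)
  refine mul_mem (mul_mem (mul_mem (pow_mem hs _) (zeval_mem hs)) ?_)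
    (prod_mem fun b hb => g_mem hD (Finset.ne_of_mem_erase hb))
  split_ifs
  · have hx : (a.x)⁻¹ ∈ D.scalars := by
      have := inv_w_add_mem hD a (-1)
      convert this using 2
      rw [x]; push_cast; ring
    refine mul_mem ?_ ?_
    · rw [← inv_pow, kap_eq hD, inv_div, div_eq_mul_inv]
      exact pow_mem (mul_mem (w_mem hD a) hx) _
    · rw [← inv_pow, mul_inv, inv_sgn]
      exact pow_mem (mul_mem (sgn_mem a) (inv_w_mem hD a)) _
  · exact one_mem _

theorem op_sh_mem (hD : D.Admissible) (a : D.NR) : op (1 : D.K) a.sh ∈ D.A := by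
  obtain ⟨k, -, -, h⟩ := exists_index hD
  rcases a with ⟨t, _ | _⟩
  · change op (1 : D.K) (eT t) ∈ D.A
    rcases h t with ⟨-, h1⟩ | ⟨-, h1⟩ <;> rw [h1]
    exacts [op_single_mem _, op_neg_single_mem _]
  · change op (1 : D.K) (-eT t) ∈ D.A
    rcases h t with ⟨-, h1⟩ | ⟨-, h1⟩ <;> rw [h1]
    · exact op_neg_single_mem _
    · rw [neg_neg]; exact op_single_mem _

end NR

theorem X₀_mem (hD : D.Admissible) (Zs : I → D.ZRing[X]) (ε : I → ℂ) (i : I) :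
    D.X₀ Zs ε i ∈ D.scalars := by
  refine mul_mem (neg_mem (mul_mem (algebraMap_mem_scalars _) (zeval_mem (zero_mem _))))
    (prod_mem fun t _ => ?_)
  unfold f₀
  split_ifs
  · have h1 := inv_om_mem hD t 1
    have h2 := inv_neg_mem (inv_om_mem hD t (-1))
    have e : (1 / 4 - om t ^ 2 : D.K) =
        (om t + ((1 : ℤ) : D.K) / 2) * -(om t + ((-1 : ℤ) : D.K) / 2) := by push_cast; ring
    rw [e, mul_inv]
    exact mul_mem h1 h2
  · exact neg_mem (om_mem hD t)
  · exact one_mem _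

/-- The images of the `B_i^{(s)}` lie in `𝒜`. -/
theorem sys_B_mem (hD : D.Admissible) (Zs : I → D.ZRing[X]) (ε : I → ℂ) (i : I) (p : ℕ) :
    (sys hD Zs ε).B i p ∈ D.A := by
  refine neg_mem (sum_mem fun a _ => ?_)
  have h : ∀ (f g : D.K) (n : D.WIdx → ℤ), f ∈ D.scalars → g ∈ D.scalars → op (1 : D.K) n ∈ D.A →
      f • op g n ∈ D.A := by
    intro f g n hf hg hn
    have : f • op g n = scal (f * g) * op 1 n := by
      rw [smul_op, scal, op_mul, map_one, mul_one, zero_add]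
    rw [this]
    exact D.A.mul_mem (mem_scalars.1 (mul_mem hf hg)) hn
  rcases a with a | k
  · exact h _ _ _ (pow_mem (NR.x_mem hD a) p) (NR.X_mem hD Zs a) (NR.op_sh_mem hD a)
  · exact h _ _ _ (pow_mem (zero_mem _) p) (X₀_mem hD Zs ε k) D.A.one_mem

/-- The images of the `H_i^{(r)}` lie in `𝒜`. -/
theorem HSer_coeff_mem (hD : D.Admissible) (i : I) (r : ℤ) :
    scal ((D.HSer i).coeff r) ∈ D.A := by
  have hl : ∀ {c : D.K}, c ∈ D.scalars → lin c ∈ serSubring D.scalars := fun hc =>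
    sub_mem invVar_mem_serSubring (C_mem_serSubring hc)
  have hl' : ∀ {c : D.K}, c ∈ D.scalars → (lin c)⁻¹ ∈ serSubring D.scalars := fun hc =>
    inv_linear_mem_serSubring hc
  have hh := half_mem_scalars (D := D)
  have hh' : (-1 / 2 : D.K) ∈ D.scalars := by rw [neg_half]; exact neg_mem hh
  have hz := zero_mem D.scalars
  have hq : -((D.wp i : D.K) / 4) ∈ D.scalars := by
    have := algebraMap_mem_scalars (D := D) (-((D.wp i : ℂ) / 4))
    rwa [map_neg, map_div₀, map_intCast, map_ofNat] at this
  have hZ : evalU D.K ((D.bZ i).map D.zToK) ∈ serSubring D.scalars := by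
    rw [evalU_bZ]
    split_ifs
    · exact mul_mem (pow_mem (hl hz) _) (prod_mem fun s _ => mul_mem (hl (zToK_mem_scalars _))
        (hl (neg_mem (zToK_mem_scalars _))))
    · exact prod_mem fun s _ => hl (zToK_mem_scalars _)
  have hphi : ∀ b : D.NR, phi (D.cartan i b.node) b.w ∈ serSubring D.scalars := by
    intro b
    have hw := NR.w_mem hD b
    unfold phi
    split_ifs
    · rw [mul_inv]; exact mul_mem (hl' (add_mem hw hh)) (hl' (sub_mem hw hh))
    · exact hl hw
    · exact one_mem _
  have h : D.HSer i ∈ serSubring D.scalars := by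
    rw [HSer_eq hD, base_eq]
    refine mul_mem (mul_mem (mul_mem (mul_mem (mul_mem (mul_mem (hl hq) (hl' hz)) (pow_mem
      (mul_mem (mul_mem (hl hh) (hl hh')) (mul_mem (hl' hz) (hl' hz))) _)) hZ) (pow_mem
      (mul_mem (hl' hh) (hl' hh')) _)) (pow_mem (hl hz) _)) (prod_mem fun b _ => hphi b)
  exact h r

end Datum

end

section

universe uI

/-! ### Simply laced Cartan matrices -/

theorem IsADE.entries {I : Type uI} {C : Matrix I I ℤ} (h : IsADE C) :
    (∀ i j, C i j = C j i) ∧ (∀ i, C i i = 2) ∧ ∀ i j, i ≠ j → C i j = 0 ∨ C i j = -1 := by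
  have key : ∀ {J : Type} [DecidableEq J] {A : Matrix J J ℤ} (e : I ≃ J), A.IsSymm → (∀ i, A i i = 2) →
      A.IsSimplyLaced → C = A.submatrix e e →
      (∀ i j, C i j = C j i) ∧ (∀ i, C i i = 2) ∧ ∀ i j, i ≠ j → C i j = 0 ∨ C i j = -1 := by
    rintro J _ A e h1 h2 h3 rfl
    exact ⟨fun i j => h1.apply _ _, fun i => h2 _, fun i j hij => h3 (e.injective.ne hij)⟩
  rcases h with ⟨n, -, e, h⟩ | ⟨n, -, e, h⟩ | ⟨e, h⟩ | ⟨e, h⟩ | ⟨e, h⟩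
  · exact key e (CartanMatrix.A_isSymm n) (fun i => congrFun (CartanMatrix.A_diag n) i) (CartanMatrix.isSimplyLaced_A n) h
  · exact key e (CartanMatrix.D_isSymm n) (CartanMatrix.D_diag n) (CartanMatrix.isSimplyLaced_D n) h
  · exact key e CartanMatrix.E₆_isSymm CartanMatrix.E₆_diag CartanMatrix.isSimplyLaced_E₆ h
  · exact key e CartanMatrix.E₇_isSymm CartanMatrix.E₇_diag CartanMatrix.isSimplyLaced_E₇ h
  · exact key e CartanMatrix.E₈_isSymm CartanMatrix.E₈_diag CartanMatrix.isSimplyLaced_E₈ h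

namespace Datum

variable {I : Type uI} {D : Datum I} [Fintype I]

/-! ### The homomorphism -/

/-- The images of the generators. -/
def genImage (hD : D.Admissible) (Zs : I → Polynomial D.ZRing) (ε : I → ℂ) : Gen I → D.Op
  | .H i r => scal ((D.HSer i).coeff r)
  | .B i s => (sys hD Zs ε).B i ((s : ℕ) - 1)

/-- The homomorphism from the free algebra to difference operators. -/
def freeHom (hD : D.Admissible) (Zs : I → Polynomial D.ZRing) (ε : I → ℂ) :
    FreeAlgebra ℂ (Gen I) →ₐ[ℂ] D.Op :=
  FreeAlgebra.lift ℂ (genImage hD Zs ε)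

theorem freeHom_gH (hD : D.Admissible) (Zs : I → Polynomial D.ZRing) (ε : I → ℂ) (i : I) (r : ℤ) :
    freeHom hD Zs ε (gH i r) = (D.HSer i).coeff r • (1 : D.Op) := by
  rw [freeHom, gH, FreeAlgebra.lift_ι_apply, genImage, scal_eq_smul]

theorem freeHom_gB (hD : D.Admissible) (Zs : I → Polynomial D.ZRing) (ε : I → ℂ) (i : I) (s : ℕ+) :
    freeHom hD Zs ε (gB i s) = (sys hD Zs ε).B i ((s : ℕ) - 1) := by
  rw [freeHom, gB, FreeAlgebra.lift_ι_apply, genImage]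

theorem map_lie_ring {R S : Type*} [Ring R] [Ring S] (f : R →+* S) (a b : R) :
    f ⁅a, b⁆ = ⁅f a, f b⁆ := by
  simp only [Ring.lie_def, map_sub, map_mul]

theorem map_acomm {R S : Type*} [Ring R] [Ring S] (f : R →+* S) (a b : R) :
    f (acomm a b) = acomm (f a) (f b) := by
  simp only [acomm, map_add, map_mul]

theorem freeHom_lie (hD : D.Admissible) (Zs : I → Polynomial D.ZRing) (ε : I → ℂ)
    (a b : FreeAlgebra ℂ (Gen I)) :
    freeHom hD Zs ε ⁅a, b⁆ = ⁅freeHom hD Zs ε a, freeHom hD Zs ε b⁆ :=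
  map_lie_ring (freeHom hD Zs ε).toRingHom a b

theorem freeHom_acomm (hD : D.Admissible) (Zs : I → Polynomial D.ZRing) (ε : I → ℂ)
    (a b : FreeAlgebra ℂ (Gen I)) :
    freeHom hD Zs ε (acomm a b) = acomm (freeHom hD Zs ε a) (freeHom hD Zs ε b) :=
  map_acomm (freeHom hD Zs ε).toRingHom a b

/-- The defining relations hold for difference operators. -/
theorem freeHom_rel (hD : D.Admissible) (Zs : I → Polynomial D.ZRing) (hZ : D.IsZSplitting Zs)
    (ε : I → ℂ) (hε : D.IsRootChoice ε) {a b : FreeAlgebra ℂ (Gen I)}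
    (h : Rel D.cartan D.τ D.mu a b) : freeHom hD Zs ε a = freeHom hD Zs ε b := by
  have hs : ∀ s : ℕ+, ∃ p : ℕ, (s : ℕ) = p + 1 := fun s => ⟨s.natPred, by simp⟩
  cases h with
  | H_low i r hr =>
    rw [freeHom_gH, (isMonicSer_HSer hD i).1 _ hr, map_zero]
    exact zero_smul D.K (1 : D.Op)
  | H_lead i =>
    rw [freeHom_gH, (isMonicSer_HSer hD i).2, one_smul, map_one]
  | HH i j r₁ r₂ =>
    rw [freeHom_lie, freeHom_gH, freeHom_gH, ← scal_eq_smul, ← scal_eq_smul, map_zero, Ring.lie_def,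
      sub_eq_zero]
    have h := fun f g : D.K => (scalHom D.ZIdx D.WIdx).map_mul f g
    exact (h _ _).symm.trans ((congrArg _ (mul_comm _ _)).trans (h _ _))
  | HB i j r s =>
    obtain ⟨p, hp⟩ := hs s
    have h := (sys hD Zs ε).cartan_rel j p (fun n => (D.HSer i).coeff n) r
      (((D.cartan i j : D.K) - D.cartan (D.τ i) j) / 2)
      (((D.cartan i j : D.K) + D.cartan (D.τ i) j) / 2)
      ((D.cartan i j : D.K) * D.cartan (D.τ i) j / 4) (by
        rintro a rfl
        exact sys_hb hD Zs ε i a r)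
    simp only [map_add, map_sub, map_smul, freeHom_lie, freeHom_acomm, freeHom_gH, freeHom_gB,
      smul_eq_algebraMap_smul, map_div₀, map_mul, map_intCast, map_ofNat, PNat.add_coe, hp,
      PNat.val_ofNat]
    exact h
  | BB i j s₁ s₂ =>
    obtain ⟨p, hp⟩ := hs s₁
    obtain ⟨q, hq⟩ := hs s₂
    have h := sys_quad hD Zs hZ ε hε i j p q
    simp only [map_add, map_sub, map_smul, freeHom_lie, freeHom_acomm, freeHom_gH, freeHom_gB,
      smul_eq_algebraMap_smul, map_div₀, map_intCast, map_ofNat, PNat.add_coe, hp, hq,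
      PNat.val_ofNat, apply_ite (freeHom hD Zs ε), map_zero, map_mul, map_pow, map_neg, map_one]
    refine h.trans ?_
    congr 2
    rw [smul_smul, ← hp]
    congr 3
    have : ((s₁ : ℕ) : ℤ) = p + 1 := by exact_mod_cast hp
    have : ((s₂ : ℕ) : ℤ) = q + 1 := by exact_mod_cast hq
    push_cast; omega
  | BB_zero i j s₁ s₂ hij =>
    obtain ⟨p, hp⟩ := hs s₁
    obtain ⟨q, hq⟩ := hs s₂
    have h := sys_comm hD Zs hZ ε hε i j p q hij
    simp only [map_smul, freeHom_lie, freeHom_gH, freeHom_gB, smul_eq_algebraMap_smul, hp, hq,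
      apply_ite (freeHom hD Zs ε), map_zero, map_pow, map_neg, map_one]
    refine h.trans ?_
    congr 1
    rw [smul_smul]
    congr 3
    have : ((s₁ : ℕ) : ℤ) = p + 1 := by exact_mod_cast hp
    have : ((s₂ : ℕ) : ℤ) = q + 1 := by exact_mod_cast hq
    push_cast; omega
  | serre_ordinary i j s₁ s₂ s hij hi hj =>
    simp only [serreLHS, map_add, freeHom_lie, freeHom_gB, map_zero]
    exact (sys hD Zs ε).serre_rel i j _ _ _ hij (Ne.symm hi) hj
  | serre_split i j s₁ s₂ s hij hi =>
    obtain ⟨p, hp⟩ := hs s₁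
    obtain ⟨q, hq⟩ := hs s₂
    have e1 : ((p + 1 : ℕ) : ℤ) + ((q + 1 : ℕ) : ℤ) = (p : ℤ) + q + 2 := by push_cast; ring
    simp only [serreLHS, serreSplitBracket, map_add, map_smul, freeHom_lie, freeHom_gB, hp, hq,
      Nat.add_sub_cancel, e1]

    split_ifs with h1
    · subst h1
      have h := sys_serre_fixed_zero hD Zs hZ ε hε i j p q hij hi.symm
      simp only [map_sum, map_smul, map_sub, freeHom_lie, freeHom_acomm, freeHom_gH, freeHom_gB,
        smul_eq_algebraMap_smul, map_div₀, map_ofNat, map_pow, map_neg, map_one, PNat.add_coe,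
        PNat.one_coe, Nat.sub_self, Nat.add_sub_cancel]
      exact h
    · obtain ⟨m, rfl⟩ := PNat.exists_eq_succ_of_ne_one h1
      obtain ⟨m', hm⟩ := hs m
      have h := sys_serre_fixed_succ hD Zs hZ ε hε i j p q m' hij hi.symm
      have e2 : ((m + 1 - 1 : ℕ+) : ℕ) = m := by rw [PNat.add_sub]
      simp only [freeHom_lie, freeHom_gH, freeHom_gB, smul_eq_algebraMap_smul, map_pow, map_neg,
        map_one, PNat.add_coe, PNat.one_coe, hm, e2, Nat.add_sub_cancel]
      exact h
  | serre_AIII i s₁ s₂ s hi =>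
    obtain ⟨p, hp⟩ := hs s₁
    obtain ⟨q, hq⟩ := hs s₂
    obtain ⟨m, hm⟩ := hs s
    have h := sys_serre_aiii hD Zs hZ ε hε i p q m hi
    have e0 : ∀ (k n : ℕ) (h : 0 < k + 1 + n), freeHom hD Zs ε (gB i ⟨k + 1 + n, h⟩) =
        (sys hD Zs ε).B i (k + n) := fun k n h =>
      (freeHom_gB hD Zs ε i ⟨k + 1 + n, h⟩).trans
        (congrArg _ (show k + 1 + n - 1 = k + n by omega))
    simp only [serreLHS, serreAIIIBracket, map_add, map_sum, map_smul, freeHom_lie, freeHom_gB,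
      freeHom_gH, smul_eq_algebraMap_smul, map_inv₀, map_ofNat, map_pow, map_neg, map_one,
      hp, hq, hm, Nat.add_sub_cancel]
    have e1 : ∀ k : ℕ, ((k + 1 : ℕ) : ℤ) + ((m + 1 : ℕ) : ℤ) = (k : ℤ) + m + 2 := fun k => by
      push_cast; ring
    have e2 : ∀ k n : ℕ, (k : ℤ) + m + 2 - n - 1 = (k : ℤ) + m + 1 - n := fun k n => by ring
    simp only [e0, e1, e2]
    exact h

/-- Coefficients in `ℂ[z]` commute with all difference operators. -/
theorem commute_scal_zToK (f : D.ZRing) (r : D.Op) : Commute r (scal (D.zToK f)) := by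
  induction r using SkewMonoidAlgebra.induction_on with
  | zero => exact Commute.zero_left _
  | add r r' hr hr' => exact hr.add_left hr'
  | single a b =>
    have h : (SkewMonoidAlgebra.single a b : D.Op) = op b (Multiplicative.toAdd a) := rfl
    rw [h, Commute, SemiconjBy, scal, op_mul, op_mul, shift_zToK, shift_zero, add_zero, zero_add,
      mul_comm]

theorem freeHom_mem (hD : D.Admissible) (Zs : I → Polynomial D.ZRing) (ε : I → ℂ)
    (a : FreeAlgebra ℂ (Gen I)) : freeHom hD Zs ε a ∈ D.A := by
  induction a using FreeAlgebra.induction with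
  | grade0 c => rw [AlgHom.commutes]; exact D.A.algebraMap_mem c
  | grade1 x =>
    rcases x with ⟨i, r⟩ | ⟨i, s⟩
    · rw [freeHom, FreeAlgebra.lift_ι_apply]; exact HSer_coeff_mem hD i r
    · rw [freeHom, FreeAlgebra.lift_ι_apply]; exact sys_B_mem hD Zs ε i _
  | mul a b ha hb => rw [map_mul]; exact D.A.mul_mem ha hb
  | add a b ha hb => rw [map_add]; exact D.A.add_mem ha hb

/-- The homomorphism on the shifted iYangian. -/
def yHom (hD : D.Admissible) (Zs : I → Polynomial D.ZRing) (hZ : D.IsZSplitting Zs)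
    (ε : I → ℂ) (hε : D.IsRootChoice ε) : Y D.cartan D.τ D.mu →ₐ[ℂ] D.A :=
  RingQuot.liftAlgHom ℂ ⟨(freeHom hD Zs ε).codRestrict D.A (freeHom_mem hD Zs ε), fun _ _ h =>
    Subtype.ext (freeHom_rel hD Zs hZ ε hε h)⟩

variable (D) in
/-- The action of `ℂ[z]` by multiplication operators. -/
def zOp : D.ZRing →ₐ[ℂ] D.Op where
  __ := (scalHom D.ZIdx D.WIdx).comp D.zToK
  commutes' c := by
    change scal (D.zToK (MvPolynomial.C c)) = algebraMap ℂ D.Op c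
    rw [← scal_algebraMap, IsScalarTower.algebraMap_apply ℂ (MvPolynomial (D.ZIdx ⊕ D.WIdx) ℂ) D.K]
    congr 1
    simp [zToK]

variable (D) in
/-- The inclusion of `ℂ[z]` in `𝒜`. -/
def zHom : D.ZRing →ₐ[ℂ] D.A := D.zOp.codRestrict D.A fun f => zToK_mem_scalars f

end Datum

end

end IYangian

end

theorem theoremB {I : Type*} [Fintype I] (D : IYangian.Datum I)
    (hC : IYangian.IsADE D.cartan) (hτ : IYangian.IsDiagramInvolution D.cartan D.τ)
    (hI₁ : D.IsOrbitReps) (hor : D.IsOrientation)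
    (hlam : ∀ i, 0 ≤ D.lam i) (hlamτ : ∀ i, D.lam (D.τ i) = D.lam i)
    (heven : IYangian.IsEven D.mu) (hsph : IYangian.IsSpherical D.τ D.mu)
    (hdiff : D.IsDiff) (hpar : D.Parity)
    (hzeta : ∀ i, D.τ i ≠ i → D.zeta i + D.zeta (D.τ i) = D.fv i)
    (Zs : I → Polynomial D.ZRing) (hZs : D.IsZSplitting Zs)
    (ε : I → ℂ) (hε : D.IsRootChoice ε) :
    ∃! Φ : (IYangian.Y D.cartan D.τ D.mu ⊗[ℂ] D.ZRing) →ₐ[ℂ] D.A,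
      (∀ f : D.ZRing, (Φ (1 ⊗ₜ f) : D.Op) = IYangian.scal (D.zToK f)) ∧
      (∀ (i : I) (r : ℤ),
        (Φ (IYangian.yH D.cartan D.τ D.mu i r ⊗ₜ 1) : D.Op) = IYangian.scal ((D.HSer i).coeff r)) ∧
      (∀ (i : I) (s : ℕ+), D.τ i ≠ i →
        (Φ (IYangian.yB D.cartan D.τ D.mu i s ⊗ₜ 1) : D.Op) = D.BNonfixed Zs i s) ∧
      (∀ (i : I) (s : ℕ+), D.τ i = i →
        (Φ (IYangian.yB D.cartan D.τ D.mu i s ⊗ₜ 1) : D.Op) = D.BFixed Zs ε i s) := by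
  obtain ⟨h1, h2, h3⟩ := hC.entries
  have hD : D.Admissible := ⟨hτ.1, hτ.2, h1, h2, h3, hI₁, hor, hlam, hlamτ, heven, hdiff, hpar, hzeta⟩
  set Ψ := IYangian.Datum.yHom hD Zs hZs ε hε
  have hΨH : ∀ i r, (Ψ (IYangian.yH D.cartan D.τ D.mu i r) : D.Op) =
      IYangian.scal ((D.HSer i).coeff r) := by
    intro i r
    rw [IYangian.scal_eq_smul, ← IYangian.Datum.freeHom_gH hD Zs ε]
    exact congrArg Subtype.val (RingQuot.liftAlgHom_mkAlgHom_apply ..)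
  have hΨB : ∀ i s, (Ψ (IYangian.yB D.cartan D.τ D.mu i s) : D.Op) =
      (IYangian.Datum.sys hD Zs ε).B i ((s : ℕ) - 1) := by
    intro i s
    rw [← IYangian.Datum.freeHom_gB]
    exact congrArg Subtype.val (RingQuot.liftAlgHom_mkAlgHom_apply ..)
  have hcomm : ∀ y f, Commute (Ψ y) (D.zHom f) := fun y f => Subtype.ext
    (IYangian.Datum.commute_scal_zToK f _)
  have hlift : ∀ y f, Algebra.TensorProduct.lift Ψ D.zHom hcomm (y ⊗ₜ f) = Ψ y * D.zHom f :=
    fun _ _ => Algebra.TensorProduct.lift_tmul ..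
  refine ⟨Algebra.TensorProduct.lift Ψ D.zHom hcomm, ⟨?_, ?_, ?_, ?_⟩, ?_⟩
  · intro f
    rw [hlift, map_one, one_mul]
    rfl
  · intro i r
    rw [hlift, map_one, mul_one, hΨH]
  · intro i s hi
    rw [hlift, map_one, mul_one, hΨB,
      IYangian.Datum.sys_B_nonfixed hD Zs ε i hi]
  · intro i s hi
    rw [hlift, map_one, mul_one, hΨB,
      IYangian.Datum.sys_B_fixed hD Zs ε i hi]
  · rintro Φ ⟨hz, hH, hB, hB'⟩
    refine Algebra.TensorProduct.ext ?_ ?_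
    · rw [Algebra.TensorProduct.lift_comp_includeLeft]
      refine RingQuot.ringQuot_ext' _ _ _ (FreeAlgebra.hom_ext ?_)
      funext x
      refine Subtype.ext ?_
      rcases x with ⟨i, r⟩ | ⟨i, s⟩
      · exact (hH i r).trans (hΨH i r).symm
      · refine Eq.trans ?_ (hΨB i s).symm
        by_cases hi : D.τ i = i
        · rw [IYangian.Datum.sys_B_fixed hD Zs ε i hi]; exact hB' i s hi
        · rw [IYangian.Datum.sys_B_nonfixed hD Zs ε i hi]; exact hB i s hi
    · refine AlgHom.ext fun f => Subtype.ext ?_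
      change (Φ (1 ⊗ₜ f) : D.Op) = _
      rw [hz]
      change _ = ((Algebra.TensorProduct.lift Ψ D.zHom hcomm (1 ⊗ₜ f) : D.A) : D.Op)
      rw [hlift, map_one, one_mul]
      rfl
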